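/- Setting. Let $T>0$, let $(\Omega,\mathcal F,\mathbb P)$ be a probability space and let $H,Z$ be separable real Hilbert spaces. Let $Q$ be a non-negative self-adjoint nuclear operator on $Z$, with orthonormal eigenbasis $(e_i)_i$ of $Z$, $Qe_i=\lambda_ie_i$. Let $W=(W_t)_{t\in[0,T]}$ be a $Z$-valued $Q$-Brownian motion: $W_0=0$, continuous paths, independent increments, and $W_t-W_s$ ($s<t$) centered Gaussian with covariance operator $(t-s)Q$. Let $\mathcal F_T$ be the $\mathbb P$-augmentation of $\sigma(W_t:t\in[0,T])$ and write $L^2(\Omega;E)=L^2(\Omega,\mathcal F_T,\mathbb P;E)$. Let $Z_0=Q^{1/2}Z$ with $\langle y,z\rangle_{Z_0}=\langle Q^{-1/2}y,Q^{-1/2}z\rangle_Z$ ($Q^{-1/2}$ the pseudo-inverse), and let $Z_0^{\otimes k}\otimes H$ be the Hilbert space of Hilbert–Schmidt $k$-linear maps $Z_0^k\to H$, i.e. the iterated space $L_2(Z_0;\dots L_2(Z_0;H)\dots)$. For $\psi\in L^2([0,T];L_2(Z_0;\mathbb R))$ let $\mathscr W(\psi)=\int_0^T\psi(t)\,dW_t$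 be the Wiener integral. Malliavin calculus. Let $\mathscr P(H)$ be the linear span of the random variables $F=q(\mathscr W(\psi_1),\dots,\mathscr W(\psi_N))\,x$ with $N\in\mathbb N$, $q$ a real polynomial, $\psi_n\in L^2([0,T];L_2(Z_0;\mathbb R))$ and $x\in H$. For such $F$ and $k\ge 0$ set $$D^kF=\sum_{n_1,\dots,n_k=1}^N\partial_{n_1}\cdots\partial_{n_k}q\,(\mathscr W(\psi_1),\dots,\mathscr W(\psi_N))\;\psi_{n_1}\otimes\cdots\otimes\psi_{n_k}\otimes x\in L^2\big(\Omega;L^2([0,T]^k;Z_0^{\otimes k}\otimes H)\big),$$ and extend linearly to $\mathscr P(H)$ ($D^0F=F$). Let $\mathbb D^{k,2}(H)\subseteq L^2(\Omega;H)$ be the closure of $\mathscr P(H)$ under $\|F\|^2=\mathbb E\|F\|_H^2+\sum_{j=1}^k\mathbb E\|D^jF\|^2$, extend $D^k$ to it by continuity, and let $\mathbb D^{\infty,2}(H)=\bigcap_{k\ge1}\mathbb D^{k,2}(H)$. The divergence $\delta^k$ is the adjoint of $D^k$: its domain consists of the $\Psi\in L^2(\Omega;L^2([0,T]^k;Z_0^{\otimes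 k}\otimes H))$ for which there is $C$ with $|\mathbb E\langle D^kG,\Psi\rangle|\le C\|G\|_{L^2(\Omega;H)}$ for all $G\in\mathbb D^{k,2}(H)$, and $\delta^k(\Psi)\in L^2(\Omega;H)$ is then the unique element with $\mathbb E\langle G,\delta^k(\Psi)\rangle_H=\mathbb E\langle D^kG,\Psi\rangle$ for all $G\in\mathbb D^{k,2}(H)$. Chaos. Let $(g_j)_{j\in\mathbb N}$ be an orthonormal basis of $L^2([0,T])$. For $i$ with $\lambda_i>0$ and $j\in\mathbb N$ let $\xi_{i,j}=\int_0^Tg_j(t)\,dW^{(i)}_t$ with $W^{(i)}=\lambda_i^{-1/2}\langle W,e_i\rangle_Z$. For finitely supported multi-indices $\alpha=(\alpha_{i,j})$ of non-negative integers let $\xi_\alpha=(\alpha!)^{-1/2}\prod_{i,j}h_{\alpha_{i,j}}(\xi_{i,j})$, where $h_n(s)=(-1)^ne^{s^2/2}\frac{d^n}{ds^n}e^{-s^2/2}$, and for $F\in L^2(\Omega;H)$ let $$\Pi_kF=\sum_{|\alpha|=k}\mathbb E[F\xi_\alpha]\,\xi_\alpha,$$ the projection of $F$ onto the $k$-th Wiener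 chaos. Proposition (Stroock–Taylor formula, $H$-valued). Let $F\in\mathbb D^{\infty,2}(H)$. Then for every $k\ge 0$ the sum defining $\Pi_kF$ converges in $L^2(\Omega;H)$, the deterministic kernel $\mathbb E[D^kF]$ belongs to the domain of $\delta^k$, and $$\Pi_kF=\frac1{k!}\,\delta^k\big(\mathbb E[D^kF]\big),$$ where for $k=0$ both sides equal $\mathbb E[F]$. Moreover $$F=\sum_{k=0}^\infty\Pi_kF=\sum_{k=0}^\infty\frac1{k!}\,\delta^k\big(\mathbb E[D^kF]\big),$$ where both sums converge in $L^2(\Omega;H)$. -/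

import Mathlib

open MeasureTheory ProbabilityTheory
open scoped Nat InnerProductSpace

noncomputable section

namespace StroockTaylor

section RangeSpace

variable {Z : Type*} [NormedAddCommGroup Z] [InnerProductSpace ℝ Z] [CompleteSpace Z]

/-- The range `R Z` of a bounded operator `R` on `Z` (as a type of its own, since it carries a norm
different from the one of `Z`). -/
def RangeSpace (R : Z →L[ℝ] Z) : Type _ := LinearMap.range (R : Z →ₗ[ℝ] Z)

namespace RangeSpace

variable (R : Z →L[ℝ] Z)

instance : AddCommGroup (RangeSpace R) :=
  inferInstanceAs (AddCommGroup (LinearMap.range (R : Z →ₗ[ℝ] Z)))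

instance : Module ℝ (RangeSpace R) :=
  inferInstanceAs (Module ℝ (LinearMap.range (R : Z →ₗ[ℝ] Z)))

/-- The linear inclusion `R Z ⊆ Z`. -/
def incl : RangeSpace R →ₗ[ℝ] Z := (LinearMap.range (R : Z →ₗ[ℝ] Z)).subtype

/-- The restriction of `R` to a bijection from the orthogonal complement of its kernel onto its
range. -/
def kerPerpEquiv : (LinearMap.ker (R : Z →ₗ[ℝ] Z))ᗮ ≃ₗ[ℝ] RangeSpace R :=
  LinearEquiv.ofBijective
    ((R : Z →ₗ[ℝ] Z).rangeRestrict ∘ₗ (LinearMap.ker (R : Z →ₗ[ℝ] Z))ᗮ.subtype) <| by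
    constructor
    · rw [← LinearMap.ker_eq_bot, LinearMap.ker_eq_bot']
      rintro ⟨z, hz⟩ h
      have h1 : z ∈ LinearMap.ker (R : Z →ₗ[ℝ] Z) := by
        have := congrArg Subtype.val h
        simpa using this
      have h2 : inner ℝ z z = 0 := Submodule.inner_right_of_mem_orthogonal h1 hz
      exact Subtype.ext (inner_self_eq_zero.mp h2)
    · rintro ⟨y, z, rfl⟩
      obtain ⟨a, ha, b, hb, rfl⟩ :=
        (LinearMap.ker (R : Z →ₗ[ℝ] Z)).exists_add_mem_mem_orthogonal z
      refine ⟨⟨b, hb⟩, Subtype.ext ?_⟩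
      have : R a = 0 := ha
      simp [this]

/-- The pseudo-inverse of `R`: the preimage of least norm, i.e. the one orthogonal to the kernel. -/
def pinv : RangeSpace R →ₗ[ℝ] Z :=
  (LinearMap.ker (R : Z →ₗ[ℝ] Z))ᗮ.subtype ∘ₗ (kerPerpEquiv R).symm.toLinearMap

theorem apply_pinv (y : RangeSpace R) : R (pinv R y) = incl R y :=
  congrArg Subtype.val ((kerPerpEquiv R).apply_symm_apply y)

theorem norm_pinv_le (y : RangeSpace R) (z : Z) (hz : R z = incl R y) : ‖pinv R y‖ ≤ ‖z‖ := by
  have hk : z - pinv R y ∈ LinearMap.ker (R : Z →ₗ[ℝ] Z) := by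
    simp [hz, apply_pinv]
  have ho : inner ℝ (z - pinv R y) (pinv R y) = 0 :=
    Submodule.inner_right_of_mem_orthogonal hk ((kerPerpEquiv R).symm y).2
  have := norm_add_sq_eq_norm_sq_add_norm_sq_of_inner_eq_zero _ _ ho
  rw [sub_add_cancel] at this
  nlinarith [norm_nonneg z, norm_nonneg (pinv R y), mul_self_nonneg ‖z - pinv R y‖]

theorem pinv_injective : Function.Injective (pinv R) :=
  Subtype.val_injective.comp (kerPerpEquiv R).symm.injective

/-- The norm `‖y‖ = ‖R⁻¹ y‖`, with `R⁻¹` the pseudo-inverse. -/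
instance : NormedAddCommGroup (RangeSpace R) :=
  NormedAddCommGroup.induced (RangeSpace R) Z (pinv R) (pinv_injective R)

/-- The inner product `⟪y, z⟫ = ⟪R⁻¹ y, R⁻¹ z⟫`, with `R⁻¹` the pseudo-inverse. -/
instance : InnerProductSpace ℝ (RangeSpace R) where
  norm_smul_le c y := by
    change ‖pinv R (c • y)‖ ≤ ‖c‖ * ‖pinv R y‖
    rw [map_smul, norm_smul]
  inner y z := inner ℝ (pinv R y) (pinv R z)
  norm_sq_eq_re_inner y := norm_sq_eq_re_inner (𝕜 := ℝ) (pinv R y)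
  conj_inner_symm y z := inner_conj_symm (𝕜 := ℝ) (pinv R y) (pinv R z)
  add_left x y z := by
    change inner ℝ (pinv R (x + y)) (pinv R z) = _
    rw [map_add, inner_add_left]
  smul_left x y c := by
    change inner ℝ (pinv R (c • x)) (pinv R y) = _
    rw [map_smul, inner_smul_left]

theorem norm_eq (y : RangeSpace R) : ‖y‖ = ‖pinv R y‖ := rfl

theorem inner_eq (y z : RangeSpace R) : inner ℝ y z = inner ℝ (pinv R y) (pinv R z) := rfl

instance : CompleteSpace (RangeSpace R) := by
  let f : (LinearMap.ker (R : Z →ₗ[ℝ] Z))ᗮ ≃ₗᵢ[ℝ] RangeSpace R :=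
    { kerPerpEquiv R with
      norm_map' := fun x => by
        rw [norm_eq]
        change ‖(((kerPerpEquiv R).symm (kerPerpEquiv R x) :
          (LinearMap.ker (R : Z →ₗ[ℝ] Z))ᗮ) : Z)‖ = _
        rw [LinearEquiv.symm_apply_apply]
        rfl }
  exact (completeSpace_congr (e := f.toEquiv) f.isometry.isUniformEmbedding).mp inferInstance

/-- The continuous embedding `R Z → Z`. -/
def inclL : RangeSpace R →L[ℝ] Z :=
  (incl R).mkContinuous ‖R‖ fun y => by
    rw [← apply_pinv, norm_eq]
    exact R.le_opNorm _

end RangeSpace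

end RangeSpace

section HilbertSchmidt

variable (k : ℕ) (E : Type*) [NormedAddCommGroup E] [InnerProductSpace ℝ E] [CompleteSpace E]
  (H : Type*) [NormedAddCommGroup H] [InnerProductSpace ℝ H]

/-- The index set of a fixed orthonormal basis of the Hilbert space `E`. -/
def BasisIndex : Set E := (exists_hilbertBasis ℝ E).choose

/-- A fixed orthonormal basis of the Hilbert space `E`. -/
def stdBasis : HilbertBasis (BasisIndex E) ℝ E := (exists_hilbertBasis ℝ E).choose_spec.choose

/-- The Hilbert-Schmidt maps `E × ⋯ × E → H` of `k` arguments: the bounded `k`-linear maps `Ξ` with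
`∑ ‖Ξ (b i₁, …, b i_k)‖ ^ 2 < ∞`, the sum running over all `k`-tuples from an orthonormal basis `b`
of `E`. This is the `k`-times iterated space of Hilbert-Schmidt operators `L₂(E; … L₂(E; H) …)`,
that is `E ⊗ ⋯ ⊗ E ⊗ H`; neither the space nor its norm depends on `b`. -/
def hsSubmodule : Submodule ℝ (ContinuousMultilinearMap ℝ (fun _ : Fin k => E) H) where
  carrier := {Ξ | Memℓp (fun i : Fin k → BasisIndex E => Ξ fun l => stdBasis E (i l)) 2}
  zero_mem' := zero_memℓp
  add_mem' h₁ h₂ := h₁.add h₂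
  smul_mem' c _ h := h.const_smul c

/-- The type of Hilbert-Schmidt maps of `k` arguments from `E` to `H`. -/
def HS : Type _ := hsSubmodule k E H

namespace HS

instance : AddCommGroup (HS k E H) := inferInstanceAs (AddCommGroup (hsSubmodule k E H))

instance : Module ℝ (HS k E H) := inferInstanceAs (Module ℝ (hsSubmodule k E H))

/-- The underlying bounded multilinear map. -/
def toCMM : HS k E H →ₗ[ℝ] ContinuousMultilinearMap ℝ (fun _ : Fin k => E) H :=
  (hsSubmodule k E H).subtype

/-- The values on the tuples of basis vectors. -/
def coeff : HS k E H →ₗ[ℝ] lp (fun _ : Fin k → BasisIndex E => H) 2 where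
  toFun Ξ := ⟨fun i => toCMM k E H Ξ fun l => stdBasis E (i l), Ξ.2⟩
  map_add' _ _ := rfl
  map_smul' _ _ := rfl

theorem coeff_apply (Ξ : HS k E H) (i : Fin k → BasisIndex E) :
    coeff k E H Ξ i = toCMM k E H Ξ fun l => stdBasis E (i l) := rfl

theorem sum_prod_sq_le (ℓ : Fin k → StrongDual ℝ E) (s : Finset (BasisIndex E)) :
    ∑ i ∈ Fintype.piFinset (fun _ : Fin k => s), (∏ l, ℓ l (stdBasis E (i l))) ^ 2
      ≤ (∏ l, ‖ℓ l‖) ^ 2 := by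
  simp_rw [← Finset.prod_pow]
  rw [← Finset.prod_univ_sum (fun _ : Fin k => s)
    (fun l j => (ℓ l (stdBasis E j)) ^ 2)]
  refine Finset.prod_le_prod (fun l _ => Finset.sum_nonneg fun _ _ => sq_nonneg _) fun l _ => ?_
  have h := (stdBasis E).orthonormal.sum_inner_products_le
    ((InnerProductSpace.toDual ℝ E).symm (ℓ l)) (s := s)
  rw [LinearIsometryEquiv.norm_map] at h
  refine le_trans (le_of_eq (Finset.sum_congr rfl fun j _ => ?_)) h
  rw [real_inner_comm, InnerProductSpace.toDual_symm_apply, Real.norm_eq_abs, sq_abs]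

theorem norm_toCMM_le (Ξ : HS k E H) : ‖toCMM k E H Ξ‖ ≤ ‖coeff k E H Ξ‖ := by
  classical
  refine ContinuousMultilinearMap.opNorm_le_bound (norm_nonneg _) fun x => ?_
  let p : Finset (BasisIndex E) → Fin k → E := fun s l =>
    ∑ j ∈ s, (stdBasis E).repr (x l) j • stdBasis E j
  have hp : Filter.Tendsto p Filter.atTop (nhds x) :=
    tendsto_pi_nhds.mpr fun l => (stdBasis E).hasSum_repr (x l)
  refine le_of_tendsto (((toCMM k E H Ξ).cont.tendsto x).comp hp).norm
    (Filter.Eventually.of_forall fun s => ?_)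
  have e1 : toCMM k E H Ξ (p s) = ∑ i ∈ Fintype.piFinset (fun _ : Fin k => s),
      (∏ l, (stdBasis E).repr (x l) (i l)) • coeff k E H Ξ i := by
    simp only [p]
    rw [ContinuousMultilinearMap.map_sum_finset]
    refine Finset.sum_congr rfl fun i _ => ?_
    rw [ContinuousMultilinearMap.map_smul_univ, coeff_apply]
  have e2 : ∑ i ∈ Fintype.piFinset (fun _ : Fin k => s),
      (∏ l, (stdBasis E).repr (x l) (i l)) ^ 2 ≤ (∏ l, ‖x l‖) ^ 2 := by
    have := sum_prod_sq_le k E (fun l => InnerProductSpace.toDual ℝ E (x l)) s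
    simp only [LinearIsometryEquiv.norm_map] at this
    refine le_trans (le_of_eq (Finset.sum_congr rfl fun i _ => ?_)) this
    congr 1
    refine Finset.prod_congr rfl fun l _ => ?_
    rw [HilbertBasis.repr_apply_apply, InnerProductSpace.toDual_apply_apply, real_inner_comm]
  have e3 : ∑ i ∈ Fintype.piFinset (fun _ : Fin k => s), ‖coeff k E H Ξ i‖ ^ 2
      ≤ ‖coeff k E H Ξ‖ ^ 2 := by
    have := lp.sum_rpow_le_norm_rpow (p := 2) (by norm_num) (coeff k E H Ξ)
      (Fintype.piFinset (fun _ : Fin k => s))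
    simpa using this
  change ‖toCMM k E H Ξ (p s)‖ ≤ _
  rw [e1]
  calc _ ≤ ∑ i ∈ Fintype.piFinset (fun _ : Fin k => s),
        |∏ l, (stdBasis E).repr (x l) (i l)| * ‖coeff k E H Ξ i‖ := by
        refine (norm_sum_le _ _).trans (le_of_eq (Finset.sum_congr rfl fun i _ => ?_))
        rw [norm_smul, Real.norm_eq_abs]
    _ ≤ ‖coeff k E H Ξ‖ * ∏ l, ‖x l‖ := by
        refine abs_le_of_sq_le_sq' ?_ (by positivity) |>.2
        refine (Finset.sum_mul_sq_le_sq_mul_sq _ _ _).trans ?_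
        simp_rw [sq_abs]
        rw [mul_pow, mul_comm]
        gcongr

theorem coeff_injective : Function.Injective (coeff k E H) := by
  rw [← LinearMap.ker_eq_bot, LinearMap.ker_eq_bot']
  intro Ξ h
  have := norm_toCMM_le k E H Ξ
  rw [h, norm_zero] at this
  exact Subtype.ext (norm_le_zero_iff.mp this)

/-- The Hilbert-Schmidt norm. -/
instance : NormedAddCommGroup (HS k E H) :=
  NormedAddCommGroup.induced (HS k E H) _ (coeff k E H) (coeff_injective k E H)

/-- The Hilbert-Schmidt inner product `∑ ⟪Ξ₁ (b i₁, …, b i_k), Ξ₂ (b i₁, …, b i_k)⟫`. -/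
instance : InnerProductSpace ℝ (HS k E H) where
  norm_smul_le c Ξ := by
    change ‖coeff k E H (c • Ξ)‖ ≤ ‖c‖ * ‖coeff k E H Ξ‖
    rw [map_smul, norm_smul]
  inner Ξ₁ Ξ₂ := inner ℝ (coeff k E H Ξ₁) (coeff k E H Ξ₂)
  norm_sq_eq_re_inner Ξ := norm_sq_eq_re_inner (𝕜 := ℝ) (coeff k E H Ξ)
  conj_inner_symm Ξ₁ Ξ₂ := inner_conj_symm (𝕜 := ℝ) (coeff k E H Ξ₁) (coeff k E H Ξ₂)
  add_left x y z := by
    change inner ℝ (coeff k E H (x + y)) (coeff k E H z) = _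
    rw [map_add, inner_add_left]
  smul_left x y c := by
    change inner ℝ (coeff k E H (c • x)) (coeff k E H y) = _
    rw [map_smul, inner_smul_left]

theorem norm_eq (Ξ : HS k E H) : ‖Ξ‖ = ‖coeff k E H Ξ‖ := rfl

theorem inner_eq_tsum (Ξ₁ Ξ₂ : HS k E H) :
    inner ℝ Ξ₁ Ξ₂ = ∑' i : Fin k → BasisIndex E,
      inner ℝ (toCMM k E H Ξ₁ fun l => stdBasis E (i l)) (toCMM k E H Ξ₂ fun l => stdBasis E (i l)) :=
  rfl

instance [CompleteSpace H] : CompleteSpace (HS k E H) := by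
  refine Metric.complete_of_cauchySeq_tendsto fun u hu => ?_
  have hiso : ∀ Ξ Ξ' : HS k E H, dist Ξ Ξ' = dist (coeff k E H Ξ) (coeff k E H Ξ') := by
    intro Ξ Ξ'
    rw [dist_eq_norm, dist_eq_norm, norm_eq, map_sub]
  have hc : CauchySeq fun n => coeff k E H (u n) :=
    (Isometry.of_dist_eq fun a b => (hiso a b).symm).uniformContinuous.comp_cauchySeq hu
  have hm : CauchySeq fun n => toCMM k E H (u n) := by
    have hL : LipschitzWith 1 (toCMM k E H) := by
      refine LipschitzWith.of_dist_le_mul fun a b => ?_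
      rw [dist_eq_norm, dist_eq_norm, norm_eq, ← map_sub, NNReal.coe_one, one_mul]
      exact norm_toCMM_le k E H _
    exact hL.uniformContinuous.comp_cauchySeq hu
  obtain ⟨v, hv⟩ := cauchySeq_tendsto_of_complete hc
  obtain ⟨Ξ, hΞ⟩ := cauchySeq_tendsto_of_complete hm
  have hcoord : ∀ i, (Ξ fun l => stdBasis E (i l)) = v i := by
    intro i
    have h1 : Filter.Tendsto (fun n => coeff k E H (u n) i) Filter.atTop
        (nhds (Ξ fun l => stdBasis E (i l))) :=
      ((ContinuousMultilinearMap.apply ℝ (fun _ : Fin k => E) H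
        fun l => (stdBasis E (i l) : E)).continuous.tendsto Ξ).comp hΞ
    have h2 : Filter.Tendsto (fun n => coeff k E H (u n) i) Filter.atTop (nhds (v i)) :=
      ((lp.evalCLM ℝ (fun _ : Fin k → BasisIndex E => H) 2 i).continuous.tendsto v).comp hv
    exact tendsto_nhds_unique h1 h2
  have hmem : Ξ ∈ hsSubmodule k E H := by
    change Memℓp _ 2
    simp_rw [hcoord]
    exact v.2
  refine ⟨⟨Ξ, hmem⟩, ?_⟩
  have hce : coeff k E H ⟨Ξ, hmem⟩ = v := by
    ext i
    exact hcoord i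
  refine tendsto_iff_dist_tendsto_zero.mpr ?_
  refine (tendsto_iff_dist_tendsto_zero.mp hv).congr fun n => ?_
  rw [← hce]
  exact (hiso _ _).symm

variable {k E H}

/-- The elementary tensor `ℓ₁ ⊗ ⋯ ⊗ ℓ_k ⊗ x`, that is the map
`(z₁, …, z_k) ↦ (ℓ₁ z₁ ⋯ ℓ_k z_k) x`. -/
def tensor (ℓ : Fin k → StrongDual ℝ E) (x : H) : HS k E H :=
  ⟨((ContinuousMultilinearMap.mkPiAlgebra ℝ (Fin k) ℝ).compContinuousLinearMap ℓ).smulRight x, by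
    classical
    refine memℓp_gen' (C := (∏ l, ‖ℓ l‖) ^ 2 * ‖x‖ ^ 2) fun s => ?_
    let S : Finset (BasisIndex E) := s.biUnion fun i => Finset.univ.image i
    have hS : s ⊆ Fintype.piFinset (fun _ : Fin k => S) := by
      intro i hi
      rw [Fintype.mem_piFinset]
      exact fun l => Finset.mem_biUnion.mpr ⟨i, hi, Finset.mem_image_of_mem _ (Finset.mem_univ l)⟩
    calc _ = ∑ i ∈ s, (∏ l, ℓ l (stdBasis E (i l))) ^ 2 * ‖x‖ ^ 2 := by
          refine Finset.sum_congr rfl fun i _ => ?_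
          simp [norm_smul, mul_pow, ← Finset.prod_pow]
      _ ≤ ∑ i ∈ Fintype.piFinset (fun _ : Fin k => S),
            (∏ l, ℓ l (stdBasis E (i l))) ^ 2 * ‖x‖ ^ 2 :=
          Finset.sum_le_sum_of_subset_of_nonneg hS fun _ _ _ => by positivity
      _ ≤ _ := by
          rw [← Finset.sum_mul]
          gcongr
          exact sum_prod_sq_le k E ℓ S⟩

theorem tensor_apply (ℓ : Fin k → StrongDual ℝ E) (x : H) (z : Fin k → E) :
    toCMM k E H (tensor ℓ x) z = (∏ l, ℓ l (z l)) • x := by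
  change (((ContinuousMultilinearMap.mkPiAlgebra ℝ (Fin k) ℝ).compContinuousLinearMap ℓ).smulRight
    x) z = _
  simp

end HS

end HilbertSchmidt

section Basics

/-- The class of `f` in `L²(μ; E)` (set to `0` if `f` is not square-integrable). -/
def toL2 {α E : Type*} [MeasurableSpace α] [NormedAddCommGroup E] (μ : Measure α) (f : α → E) :
    Lp E 2 μ := by
  classical exact if h : MemLp f 2 μ then h.toLp f else 0

/-- The continuous linear map `I : E → F` with `I (v a) = u a` for every `a`, for a total family `v`
(set to `0` if no such map exists). -/
def extendFamily {A E F : Type*} [NormedAddCommGroup E] [NormedSpace ℝ E] [NormedAddCommGroup F]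
    [NormedSpace ℝ F] (v : A → E) (u : A → F) : E →L[ℝ] F := by
  classical exact if h : ∃ I : E →L[ℝ] F, ∀ a, I (v a) = u a then h.choose else 0

/-- The Lebesgue measure on the interval `[0, T]`. -/
def timeMeasure (T : ℝ) : Measure (Set.Icc (0 : ℝ) T) :=
  (volume : Measure ℝ).comap Subtype.val

/-- The Lebesgue measure on the cube `[0, T]^k`. -/
def cubeMeasure (T : ℝ) (k : ℕ) : Measure (Fin k → Set.Icc (0 : ℝ) T) :=
  Measure.pi fun _ => timeMeasure T

end Basics

section BrownianMotion

variable {Z : Type*} [NormedAddCommGroup Z] [InnerProductSpace ℝ Z] {T : ℝ}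
  {Ω : Type*} [MeasurableSpace Ω]

/-- Nuclear operators on a Hilbert space. -/
def IsNuclear (Q : Z →L[ℝ] Z) : Prop :=
  ∃ y z : ℕ → Z, Summable (fun i => ‖y i‖ * ‖z i‖) ∧
    ∀ x, HasSum (fun i => inner ℝ x (y i) • z i) (Q x)

/-- The non-negative self-adjoint square root of a non-negative self-adjoint operator. -/
def posSqrt [CompleteSpace Z] (Q : Z →L[ℝ] Z) : Z →L[ℝ] Z := by
  classical exact if h : ∃ R : Z →L[ℝ] Z, R.IsPositive ∧ R ∘L R = Q then h.choose else 0

/-- The space `Z₀ = Q^{1/2} Z` with `⟪y, z⟫ = ⟪Q^{-1/2} y, Q^{-1/2} z⟫`. -/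
abbrev CMSpace [CompleteSpace Z] (Q : Z →L[ℝ] Z) : Type _ := RangeSpace (posSqrt Q)

/-- `Q`-Brownian motions on `[0, T]`. -/
structure IsQBrownianMotion [MeasurableSpace Z] (Q : Z →L[ℝ] Z)
    (W : Set.Icc (0 : ℝ) T → Ω → Z) (P : Measure Ω) : Prop where
  measurable : ∀ t, Measurable (W t)
  zero : ∀ t : Set.Icc (0 : ℝ) T, (t : ℝ) = 0 → ∀ ω, W t ω = 0
  continuous : ∀ ω, Continuous fun t => W t ω
  indep : HasIndepIncrements W P
  gaussian : ∀ s t : Set.Icc (0 : ℝ) T, s < t → ∀ z : Z, charFun (P.map fun ω => W t ω - W s ω) z =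
    Complex.exp (-((((t : ℝ) - (s : ℝ)) * inner ℝ (Q z) z : ℝ) : ℂ) / 2)

/-- The σ-algebra generated by `(W_t)`, `t ∈ [0, T]`. A random variable is `P`-a.e. equal to a
measurable one for this σ-algebra if and only if it is measurable for its `P`-augmentation `ℱ_T`. -/
abbrev sigmaW [MeasurableSpace Z] (W : Set.Icc (0 : ℝ) T → Ω → Z) : MeasurableSpace Ω :=
  ⨆ t, (inferInstance : MeasurableSpace Z).comap (W t)

/-- The Wiener integral `g ↦ ∫₀ᵀ g(t) dB_t` on `L²([0, T])` for a real-valued process `B`: the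
continuous linear map sending the indicator function of `(s, t]` to `B_t - B_s`. -/
def scalarWienerIntegral (B : Set.Icc (0 : ℝ) T → Ω → ℝ) (P : Measure Ω) :
    Lp ℝ 2 (timeMeasure T) →L[ℝ] Lp ℝ 2 P :=
  extendFamily
    (fun p : {p : Set.Icc (0 : ℝ) T × Set.Icc (0 : ℝ) T // p.1 ≤ p.2} =>
      toL2 (timeMeasure T) (Set.indicator (Set.Ioc p.1.1 p.1.2) fun _ => (1 : ℝ)))
    (fun p => toL2 P fun ω => B p.1.2 ω - B p.1.1 ω)

variable [CompleteSpace Z]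

/-- The Wiener integral `ψ ↦ ∫₀ᵀ ψ(t) dW_t` on `L²([0, T]; L₂(Z₀; ℝ))`: the continuous linear map
sending the elementary integrand `1_{(s, t]} ⟪·, z⟫_Z` (restricted to `Z₀`) to `⟪W_t - W_s, z⟫_Z`.
The Hilbert-Schmidt functionals on `Z₀` are the bounded ones, with the same norm. -/
def wienerIntegral (Q : Z →L[ℝ] Z) (W : Set.Icc (0 : ℝ) T → Ω → Z) (P : Measure Ω) :
    Lp (StrongDual ℝ (CMSpace Q)) 2 (timeMeasure T) →L[ℝ] Lp ℝ 2 P :=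
  extendFamily
    (fun p : {p : Set.Icc (0 : ℝ) T × Set.Icc (0 : ℝ) T // p.1 ≤ p.2} × Z =>
      toL2 (timeMeasure T) (Set.indicator (Set.Ioc p.1.1.1 p.1.1.2) fun _ =>
        (innerSL ℝ p.2 ∘L RangeSpace.inclL (posSqrt Q) : StrongDual ℝ (CMSpace Q))))
    (fun p => toL2 P fun ω => inner ℝ (W p.1.1.2 ω - W p.1.1.1 ω) p.2)

end BrownianMotion

section Chaos

variable {Z : Type*} [NormedAddCommGroup Z] [InnerProductSpace ℝ Z] {T : ℝ}
  {Ω : Type*} [MeasurableSpace Ω] {ι : Type*}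

/-- The random variables `ξ_{i,j} = ∫₀ᵀ g_j(t) dW_t^{(i)}`, `W^{(i)} = λ_i^{-1/2} ⟪W, e_i⟫`, for the
indices `i` with `λ_i > 0`. -/
def xi (W : Set.Icc (0 : ℝ) T → Ω → Z) (P : Measure Ω) (e : ι → Z) (lam : ι → ℝ)
    (g : ℕ → Lp ℝ 2 (timeMeasure T)) (p : {i : ι // 0 < lam i} × ℕ) : Lp ℝ 2 P :=
  scalarWienerIntegral
    (fun t ω => (1 / Real.sqrt (lam p.1)) * inner ℝ (W t ω) (e p.1)) P (g p.2)

/-- The Wick polynomials `ξ_α = (α!)^{-1/2} ∏ h_{α_{i,j}}(ξ_{i,j})`. -/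
def wick (W : Set.Icc (0 : ℝ) T → Ω → Z) (P : Measure Ω) (e : ι → Z) (lam : ι → ℝ)
    (g : ℕ → Lp ℝ 2 (timeMeasure T)) (α : ({i : ι // 0 < lam i} × ℕ) →₀ ℕ) (ω : Ω) : ℝ :=
  (1 / Real.sqrt (α.prod fun _ n => (n ! : ℝ))) *
    α.prod fun p n => Polynomial.aeval (xi W P e lam g p ω) (Polynomial.hermite n)

variable {H : Type*} [NormedAddCommGroup H] [InnerProductSpace ℝ H]

/-- The term `E[F ξ_α] ξ_α` of the chaos expansion of `F`. -/
def wickTerm (W : Set.Icc (0 : ℝ) T → Ω → Z) (P : Measure Ω) (e : ι → Z) (lam : ι → ℝ)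
    (g : ℕ → Lp ℝ 2 (timeMeasure T)) (F : Lp H 2 P) (α : ({i : ι // 0 < lam i} × ℕ) →₀ ℕ) :
    Lp H 2 P :=
  toL2 P fun ω => wick W P e lam g α ω • ∫ ω', wick W P e lam g α ω' • F ω' ∂P

/-- The projection `Π_k F = ∑_{|α| = k} E[F ξ_α] ξ_α` onto the `k`-th Wiener chaos. -/
def chaosProj (W : Set.Icc (0 : ℝ) T → Ω → Z) (P : Measure Ω) (e : ι → Z) (lam : ι → ℝ)
    (g : ℕ → Lp ℝ 2 (timeMeasure T)) (k : ℕ) (F : Lp H 2 P) : Lp H 2 P :=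
  ∑' α : {α : ({i : ι // 0 < lam i} × ℕ) →₀ ℕ // α.degree = k}, wickTerm W P e lam g F α

end Chaos

section Malliavin

variable {Z : Type*} [NormedAddCommGroup Z] [InnerProductSpace ℝ Z] [CompleteSpace Z] {T : ℝ}
  {Ω : Type*} [MeasurableSpace Ω]

/-- The iterated partial derivative `∂_{n_1} ⋯ ∂_{n_k} q`. -/
def iterPderiv {N k : ℕ} (n : Fin k → Fin N) (q : MvPolynomial (Fin N) ℝ) :
    MvPolynomial (Fin N) ℝ :=
  (List.ofFn n).foldr (fun i p => MvPolynomial.pderiv i p) q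

/-- The space `L²([0, T]^k; Z₀^{⊗k} ⊗ H)`. -/
abbrev KernelSpace (Q : Z →L[ℝ] Z) (T : ℝ) (H : Type*) [NormedAddCommGroup H]
    [InnerProductSpace ℝ H] (k : ℕ) : Type _ :=
  Lp (HS k (CMSpace Q) H) 2 (cubeMeasure T k)

/-- The space `L²(Ω; L²([0, T]^k; Z₀^{⊗k} ⊗ H))`. -/
abbrev RandomKernel (Q : Z →L[ℝ] Z) (T : ℝ) (P : Measure Ω) (H : Type*) [NormedAddCommGroup H]
    [InnerProductSpace ℝ H] (k : ℕ) : Type _ :=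
  Lp (KernelSpace Q T H k) 2 P

variable {H : Type*} [NormedAddCommGroup H] [InnerProductSpace ℝ H]

/-- The kernel `(s_1, …, s_k) ↦ ψ_1(s_1) ⊗ ⋯ ⊗ ψ_k(s_k) ⊗ x`. -/
def tensorKernel (Q : Z →L[ℝ] Z) {k : ℕ}
    (ψ : Fin k → Lp (StrongDual ℝ (CMSpace Q)) 2 (timeMeasure T)) (x : H) :
    KernelSpace Q T H k :=
  toL2 (cubeMeasure T k) fun s => HS.tensor (fun l => ψ l (s l)) x

/-- The polynomial random variable `q(𝒲(ψ_1), …, 𝒲(ψ_N)) x`. -/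
def polyVar (Q : Z →L[ℝ] Z) (W : Set.Icc (0 : ℝ) T → Ω → Z) (P : Measure Ω) {N : ℕ}
    (q : MvPolynomial (Fin N) ℝ)
    (ψ : Fin N → Lp (StrongDual ℝ (CMSpace Q)) 2 (timeMeasure T)) (x : H) : Lp H 2 P :=
  toL2 P fun ω => MvPolynomial.eval (fun m => wienerIntegral Q W P (ψ m) ω) q • x

/-- The `k`-th Malliavin derivative of `q(𝒲(ψ_1), …, 𝒲(ψ_N)) x`,
`∑ ∂_{n_1} ⋯ ∂_{n_k} q (𝒲(ψ_1), …, 𝒲(ψ_N)) ψ_{n_1} ⊗ ⋯ ⊗ ψ_{n_k} ⊗ x`, the sum running over all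
`(n_1, …, n_k)`. -/
def polyDeriv (Q : Z →L[ℝ] Z) (W : Set.Icc (0 : ℝ) T → Ω → Z) (P : Measure Ω) {N : ℕ}
    (q : MvPolynomial (Fin N) ℝ)
    (ψ : Fin N → Lp (StrongDual ℝ (CMSpace Q)) 2 (timeMeasure T)) (x : H) (k : ℕ) :
    RandomKernel Q T P H k :=
  toL2 P fun ω => ∑ n : Fin k → Fin N,
    MvPolynomial.eval (fun m => wienerIntegral Q W P (ψ m) ω) (iterPderiv n q) •
      tensorKernel Q (fun l => ψ (n l)) x

/-- The graph of `F ↦ (D⁰F, …, DᵏF)` on the linear span `𝒫(H)` of the polynomial random variables;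
here `D⁰F = F`, up to the identification of `L²([0, T]⁰; Z₀^{⊗0} ⊗ H)` with `H`. -/
def polyGraph (Q : Z →L[ℝ] Z) (W : Set.Icc (0 : ℝ) T → Ω → Z) (P : Measure Ω) (H : Type*)
    [NormedAddCommGroup H] [InnerProductSpace ℝ H] (k : ℕ) :
    Submodule ℝ (Lp H 2 P × ((j : Fin (k + 1)) → RandomKernel Q T P H j)) :=
  Submodule.span ℝ {G | ∃ (N : ℕ) (q : MvPolynomial (Fin N) ℝ)
    (ψ : Fin N → Lp (StrongDual ℝ (CMSpace Q)) 2 (timeMeasure T)) (x : H),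
    G = (polyVar Q W P q ψ x, fun j : Fin (k + 1) => polyDeriv Q W P q ψ x (j : ℕ))}

/-- The space `𝔻^{k,2}(H)`: the closure of `𝒫(H)` for the norm of
`F ↦ (F, D¹F, …, DᵏF)`. -/
def malliavinSpace (Q : Z →L[ℝ] Z) (W : Set.Icc (0 : ℝ) T → Ω → Z) (P : Measure Ω) (H : Type*)
    [NormedAddCommGroup H] [InnerProductSpace ℝ H] (k : ℕ) : Submodule ℝ (Lp H 2 P) :=
  (polyGraph Q W P H k).topologicalClosure.map (LinearMap.fst ℝ _ _)

/-- The space `𝔻^{∞,2}(H) = ⋂_{k ≥ 1} 𝔻^{k,2}(H)`. -/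
def malliavinSpaceTop (Q : Z →L[ℝ] Z) (W : Set.Icc (0 : ℝ) T → Ω → Z) (P : Measure Ω) (H : Type*)
    [NormedAddCommGroup H] [InnerProductSpace ℝ H] : Submodule ℝ (Lp H 2 P) :=
  ⨅ (k : ℕ) (_ : 1 ≤ k), malliavinSpace Q W P H k

/-- The `k`-th Malliavin derivative `DᵏF` of `F ∈ 𝔻^{k,2}(H)`, given by the closure of the graph of
`(D⁰, …, Dᵏ)` on `𝒫(H)` (set to `0` if `F` is not in `𝔻^{k,2}(H)`). -/
def malliavinDeriv (Q : Z →L[ℝ] Z) (W : Set.Icc (0 : ℝ) T → Ω → Z) (P : Measure Ω) (k : ℕ)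
    (F : Lp H 2 P) : RandomKernel Q T P H k := by
  classical exact
    if h : ∃ U, (F, U) ∈ (polyGraph Q W P H k).topologicalClosure then h.choose (Fin.last k) else 0

/-- The domain of the `k`-th divergence operator, the adjoint of `Dᵏ`: all `Ψ`, square-integrable and
`ℱ_T`-measurable, such that `F ↦ E⟪DᵏF, Ψ⟫` is bounded for the norm of `L²(Ω; H)`. The inner products
of `L²` are the expectations of the pointwise inner products. -/
def divergenceDomain [MeasurableSpace Z] (Q : Z →L[ℝ] Z) (W : Set.Icc (0 : ℝ) T → Ω → Z)
    (P : Measure Ω) (H : Type*) [NormedAddCommGroup H] [InnerProductSpace ℝ H] (k : ℕ) :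
    Set (RandomKernel Q T P H k) :=
  {Ψ | AEStronglyMeasurable[sigmaW W] Ψ P ∧ ∃ C : ℝ, ∀ F ∈ malliavinSpace Q W P H k,
    |inner ℝ (malliavinDeriv Q W P k F) Ψ| ≤ C * ‖F‖}

/-- The `k`-th divergence `δᵏ(Ψ)`: the element of `L²(Ω, ℱ_T, P; H)` with
`E⟪F, δᵏ(Ψ)⟫ = E⟪DᵏF, Ψ⟫` for all `F ∈ 𝔻^{k,2}(H)` (set to `0` if there is none). -/
def divergence [MeasurableSpace Z] (Q : Z →L[ℝ] Z) (W : Set.Icc (0 : ℝ) T → Ω → Z)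
    (P : Measure Ω) (k : ℕ) (Ψ : RandomKernel Q T P H k) : Lp H 2 P := by
  classical exact
    if h : ∃ Y : Lp H 2 P, AEStronglyMeasurable[sigmaW W] Y P ∧
        ∀ F ∈ malliavinSpace Q W P H k,
          inner ℝ F Y = inner ℝ (malliavinDeriv Q W P k F) Ψ
    then h.choose else 0

/-- The deterministic kernel `E[DᵏF]`, as a constant element of `L²(Ω; L²([0, T]^k; Z₀^{⊗k} ⊗ H))`. -/
def meanDeriv (Q : Z →L[ℝ] Z) (W : Set.Icc (0 : ℝ) T → Ω → Z) (P : Measure Ω) [IsFiniteMeasure P]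
    (k : ℕ) (F : Lp H 2 P) : RandomKernel Q T P H k :=
  Lp.const 2 P (∫ ω, malliavinDeriv Q W P k F ω ∂P)

end Malliavin

end StroockTaylor

end

open StroockTaylor

namespace StroockTaylor

/-! Write `𝓗 = L²([0,T]; Z₀*)`, let `I` be the Wiener integral on `𝓗`, and let `b` be the
orthonormal basis of `𝓗` with `I(b_{i,j}) = ξ_{i,j}`. Everything rests on one bilinear identity,
valid for `F, G ∈ 𝔻^{k,2}(H)`: `⟪E[DᵏG], E[DᵏF]⟫ = k! ⟪G, Π_k F⟫`. The kernel `E[DᵏF]` is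
deterministic, so the left side is `E⟪DᵏG, E[DᵏF]⟫`. Hence `E[DᵏF]` lies in the domain of `δᵏ`, with
bound `‖k! Π_k F‖`, and `δᵏ(E[DᵏF]) = k! Π_k F`.

The identity comes from Gaussian integration by parts, `E[I(h) q] = E[∂_h q]` for polynomials `q`
(`IsIsonormal.integral_mul_eval`). Multiplication by `X_{b_p}` minus `∂_{b_p}` raises the index `p`
of a Hermite product, so `k` integrations by parts give, for a polynomial `F` and any `k`-tuple `r`
that counts to `α`, the equality of `E[F H_α]` with the coefficient of `E[DᵏF]` on `b_{r₁} ⊗ ⋯ ⊗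
b_{r_k}` (`IsIsonormal.sum_prod_mul_integral_iterPderiv`). Parseval over all tuples, together with
the fact that `k!/α!` tuples count to `α`, yields the identity for polynomials
(`inner_coefLp_polyDeriv`). Both sides are continuous for the graph norm, so it extends to the
closure, one variable at a time (`inner_coefLp_of_mem_closure`). It holds for every pair in the
closed graph, so closability of `Dᵏ` is not needed.

Uniqueness of the divergence and convergence of the chaos series both need the Hermite products to
be total in `L²(σ(W))` (`IsIsonormal.ae_eq_zero_of_integral_mul_hermiteProd`). A variable orthogonal
to all of them is orthogonal to every power of `I(h)`, hence to every `exp(i I(h))`, hence vanishes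
by uniqueness of characteristic functions.

It remains to see that the concrete objects fit. The covariance `min(s,t) ⟪Qz, z'⟫` of `⟪W_s, z⟫`
and `⟪W_t, z'⟫` is the Gram matrix of the integrands `1_{[0,s]} ⟪·, z⟫` in `𝓗`, so the Wiener
integral exists as an isometry with Gaussian values, and the vectors `g_j ⊗ λ_i^{-1/2} ⟪·, e_i⟫`
form an orthonormal basis of `𝓗`. -/

/-! ### Polynomials of Gaussian variables: moments and one-dimensional integration by parts -/

open MvPolynomial in
theorem memLp_eval_mvPolynomial {Ω : Type*} [MeasurableSpace Ω] {P : Measure Ω}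
    [IsFiniteMeasure P] {σ : Type*} {X : σ → Ω → ℝ}
    (hX : ∀ i (p : ENNReal), p ≠ ⊤ → MemLp (X i) p P) (q : MvPolynomial σ ℝ)
    (p : ENNReal) (hp : p ≠ ⊤) : MemLp (fun ω => eval (fun i => X i ω) q) p P := by
  induction q using MvPolynomial.induction_on generalizing p with
  | C a => simpa using memLp_const a
  | add q₁ q₂ h₁ h₂ =>
    simp only [map_add]
    exact (h₁ p hp).add (h₂ p hp)
  | mul_X q i h =>
    -- Hölder with exponents `2p, 2p` into `p`; this is why the induction runs over all finite `p`
    -- at once.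
    have h2 : (2 * p) ≠ ⊤ := ENNReal.mul_ne_top (by simp) hp
    have : ENNReal.HolderTriple (2 * p) (2 * p) p := by
      constructor
      rw [ENNReal.mul_inv (by simp) (by simp), ← add_mul, ENNReal.inv_two_add_inv_two, one_mul]
    simpa using (hX i _ h2).mul' (h _ h2)

theorem integrable_eval_mvPolynomial {Ω : Type*} [MeasurableSpace Ω] {P : Measure Ω}
    [IsFiniteMeasure P] {σ : Type*} {X : σ → Ω → ℝ}
    (hX : ∀ i (p : ENNReal), p ≠ ⊤ → MemLp (X i) p P) (q : MvPolynomial σ ℝ) :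
    Integrable (fun ω => MvPolynomial.eval (fun i => X i ω) q) P :=
  memLp_one_iff_integrable.mp (memLp_eval_mvPolynomial hX q 1 (by simp))

theorem integrable_eval_gaussianReal (v : NNReal) (p : Polynomial ℝ) :
    Integrable (fun x => p.eval x) (gaussianReal 0 v) := by
  have := integrable_eval_mvPolynomial (P := gaussianReal 0 v) (X := fun (_ : Unit) x => x)
    (fun _ r hr => memLp_id_gaussianReal' r hr) (Polynomial.aeval (MvPolynomial.X ()) p)
  refine this.congr (Filter.Eventually.of_forall fun x => ?_)
  simp only
  rw [← MvPolynomial.coe_aeval_eq_eval, RingHom.coe_coe, ← Polynomial.aeval_algHom_apply]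
  simp

/-- Integration by parts for polynomials under a centered Gaussian law. -/
theorem integral_mul_eval_gaussianReal (v : NNReal) (p : Polynomial ℝ) :
    ∫ x, x * p.eval x ∂(gaussianReal 0 v) = v * ∫ x, p.derivative.eval x ∂(gaussianReal 0 v) := by
  -- For `v = 0` the law is a Dirac mass at `0`, without density, and both sides vanish.
  by_cases hv : v = 0
  · subst hv; simp
  have hv' : (v : ℝ) ≠ 0 := by exact_mod_cast hv
  have hint : ∀ q : Polynomial ℝ, Integrable fun x => gaussianPDFReal 0 v x * q.eval x := by
    intro q
    have := integrable_eval_gaussianReal v q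
    rw [gaussianReal_of_var_ne_zero _ hv, integrable_withDensity_iff_integrable_smul'
      (measurable_gaussianPDF 0 v) (by simp [gaussianPDF_lt_top])] at this
    simpa [toReal_gaussianPDF] using this
  -- The density satisfies `φ' = -(x/v) φ`, so `x φ = -v φ'` and ordinary integration by parts
  -- applies.
  have hd : ∀ x, HasDerivAt (gaussianPDFReal 0 v) (-(x / v) * gaussianPDFReal 0 v x) x := by
    intro x
    have h1 : HasDerivAt (fun x : ℝ => -(x - 0) ^ 2 / (2 * v)) (-(x / v)) x := by
      have := ((((hasDerivAt_id x).sub_const 0).pow 2).neg).div_const (2 * (v : ℝ))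
      refine this.congr_deriv ?_
      simp
      field_simp
    have := (h1.exp).const_mul ((√(2 * Real.pi * v))⁻¹)
    refine this.congr_deriv ?_
    simp only [gaussianPDFReal]
    ring
  rw [integral_gaussianReal_eq_integral_smul hv, integral_gaussianReal_eq_integral_smul hv]
  have key := integral_mul_deriv_eq_deriv_mul_of_integrable (u := fun x => p.eval x)
    (v := gaussianPDFReal 0 v) (u' := fun x => p.derivative.eval x)
    (v' := fun x => -(x / v) * gaussianPDFReal 0 v x)
    (fun x _ => p.hasDerivAt x) (fun x _ => hd x) ?_ ?_ ?_
  · have e1 : ∫ x, p.eval x * (-(x / v) * gaussianPDFReal 0 v x)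
        = -(v : ℝ)⁻¹ * ∫ x, gaussianPDFReal 0 v x • (x * p.eval x) := by
      rw [← integral_const_mul]
      congr 1; ext x
      simp only [smul_eq_mul]; field_simp
    have e2 : ∫ x, p.derivative.eval x * gaussianPDFReal 0 v x
        = ∫ x, gaussianPDFReal 0 v x • p.derivative.eval x := by
      congr 1; ext x
      simp only [smul_eq_mul]; ring
    rw [e1, e2] at key
    field_simp at key
    linarith
  · refine (hint (Polynomial.C (-(v : ℝ)⁻¹) * Polynomial.X * p)).congr
      (Filter.Eventually.of_forall fun x => ?_)
    simp
    field_simp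
  · refine (hint p.derivative).congr (Filter.Eventually.of_forall fun x => ?_)
    simp [mul_comm]
  · refine (hint p).congr (Filter.Eventually.of_forall fun x => ?_)
    simp [mul_comm]

/-! ### Isonormal families and Gaussian integration by parts -/

section Isonormal

variable {Ω : Type*} [MeasurableSpace Ω] {P : Measure Ω} {𝓗 : Type*}
  [NormedAddCommGroup 𝓗] [InnerProductSpace ℝ 𝓗]

/-- Isonormal Gaussian families indexed by a Hilbert space. -/
def IsIsonormal (I : 𝓗 →L[ℝ] Lp ℝ 2 P) : Prop :=
  ∀ h, P.map (I h) = gaussianReal 0 (‖h‖₊ ^ 2)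

/-- The derivation of polynomials in the indeterminates `X_g`, `g ∈ 𝓗`, with `X_g ↦ ⟪g, h⟫`. -/
noncomputable def dirDeriv (h : 𝓗) : Derivation ℝ (MvPolynomial 𝓗 ℝ) (MvPolynomial 𝓗 ℝ) :=
  MvPolynomial.mkDerivation ℝ fun g => MvPolynomial.C ⟪g, h⟫_ℝ

@[simp]
theorem dirDeriv_X (h g : 𝓗) : dirDeriv h (MvPolynomial.X g) = MvPolynomial.C ⟪g, h⟫_ℝ :=
  MvPolynomial.mkDerivation_X ..

/-- The index type may be uncountable; the induction on `q` combines only finitely many null sets.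
-/
theorem eval_ae_congr {σ : Type*} {X Y : σ → Ω → ℝ} (h : ∀ i, X i =ᵐ[P] Y i)
    (q : MvPolynomial σ ℝ) :
    (fun ω => MvPolynomial.eval (fun i => X i ω) q) =ᵐ[P]
      fun ω => MvPolynomial.eval (fun i => Y i ω) q := by
  induction q using MvPolynomial.induction_on with
  | C a => simp
  | add q₁ q₂ h₁ h₂ =>
    filter_upwards [h₁, h₂] with ω h₁ h₂
    simp [h₁, h₂]
  | mul_X q i hq =>
    filter_upwards [hq, h i] with ω h₁ h₂
    simp [h₁, h₂]

theorem measurable_eval_mvPolynomial {σ α : Type*} [MeasurableSpace α] {X : α → σ → ℝ}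
    (hX : Measurable X) (q : MvPolynomial σ ℝ) :
    Measurable fun a => MvPolynomial.eval (X a) q := by
  induction q using MvPolynomial.induction_on with
  | C a => simp
  | add q₁ q₂ h₁ h₂ =>
    simp only [map_add]
    exact h₁.add h₂
  | mul_X q i hq =>
    simp only [map_mul, MvPolynomial.eval_X]
    exact hq.mul ((measurable_pi_apply i).comp hX)

namespace IsIsonormal

variable {I : 𝓗 →L[ℝ] Lp ℝ 2 P} (hI : IsIsonormal I)
include hI

theorem memLp (h : 𝓗) (p : ENNReal) (hp : p ≠ ⊤) : MemLp (I h) p P := by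
  have h1 : AEMeasurable (I h) P := (Lp.aestronglyMeasurable _).aemeasurable
  have := memLp_id_gaussianReal' (μ := 0) (v := ‖h‖₊ ^ 2) p hp
  rw [← hI h, memLp_map_measure_iff aestronglyMeasurable_id h1] at this
  exact this

theorem memLp_eval [IsFiniteMeasure P] (q : MvPolynomial 𝓗 ℝ) (p : ENNReal) (hp : p ≠ ⊤) :
    MemLp (fun ω => MvPolynomial.eval (fun g => I g ω) q) p P :=
  memLp_eval_mvPolynomial hI.memLp q p hp

theorem integrable_eval [IsFiniteMeasure P] (q : MvPolynomial 𝓗 ℝ) :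
    Integrable (fun ω => MvPolynomial.eval (fun g => I g ω) q) P :=
  integrable_eval_mvPolynomial hI.memLp q

theorem integral_eq_zero (h : 𝓗) : ∫ ω, I h ω ∂P = 0 := by
  have h1 : AEMeasurable (I h) P := (Lp.aestronglyMeasurable _).aemeasurable
  rw [← integral_map (f := fun x => x) h1 aestronglyMeasurable_id, hI h,
    integral_id_gaussianReal]

theorem variance_eq (h : 𝓗) : Var[I h; P] = ‖h‖ ^ 2 := by
  have h1 : AEMeasurable (I h) P := (Lp.aestronglyMeasurable _).aemeasurable
  have := variance_map (X := id) aemeasurable_id h1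
  rw [hI h, variance_id_gaussianReal] at this
  simpa using this.symm

/-- The variance of the centered variable `I h` is `‖h‖²`, so `I` is a linear isometry and preserves
inner products. -/
theorem inner_apply (g h : 𝓗) : ⟪I g, I h⟫_ℝ = ⟪g, h⟫_ℝ := by
  have hn : ∀ h, ‖I h‖ = ‖h‖ := by
    intro h
    have h1 := hI.variance_eq h
    rw [variance_of_integral_eq_zero (Lp.aestronglyMeasurable _).aemeasurable
      (hI.integral_eq_zero h)] at h1
    have h2 : ⟪I h, I h⟫_ℝ = ‖h‖ ^ 2 := by
      rw [L2.inner_def, ← h1]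
      congr 1; ext ω
      simp [sq]
    rw [real_inner_self_eq_norm_sq] at h2
    exact (sq_eq_sq₀ (norm_nonneg _) (norm_nonneg _)).mp h2
  exact LinearIsometry.inner_map_map ⟨I.toLinearMap, hn⟩ g h

theorem covariance_eq [IsProbabilityMeasure P] (g h : 𝓗) : cov[I g, I h; P] = ⟪g, h⟫_ℝ := by
  rw [covariance_eq_sub (Lp.memLp _) (Lp.memLp _), hI.integral_eq_zero, zero_mul, sub_zero,
    ← hI.inner_apply, L2.inner_def]
  congr 1; ext ω
  simp [mul_comm]

/-- By linearity of `I`, a linear combination of the `I (f i)` is a.e. a single `I h`, hence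
Gaussian. -/
theorem isGaussianProcess {κ : Type*} (f : κ → 𝓗) : IsGaussianProcess (fun i => I (f i)) P where
  hasGaussianLaw s := by
    have hm : ∀ h, AEMeasurable (I h) P := fun h => (Lp.aestronglyMeasurable _).aemeasurable
    have hm' : AEMeasurable (fun ω => s.restrict fun i => I (f i) ω) P :=
      aemeasurable_pi_lambda _ fun i => hm _
    refine ⟨isGaussian_of_map_eq_gaussianReal fun L => ?_⟩
    classical
    let h : 𝓗 := ∑ i : s, L (Pi.single i 1) • f i
    refine ⟨0, ‖h‖₊ ^ 2, ?_⟩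
    rw [AEMeasurable.map_map_of_aemeasurable (by fun_prop) hm', ← hI h]
    refine Measure.map_congr ?_
    have h1 : ⇑(I h) =ᵐ[P] fun ω => ∑ i : s, L (Pi.single i 1) * I (f i) ω := by
      have : I h = ∑ i : s, L (Pi.single i 1) • I (f i) := by simp [h]
      rw [this]
      refine (Lp.coeFn_fun_finsetSum _ _).trans ?_
      have : ∀ᵐ ω ∂P, ∀ i : s, (L (Pi.single i 1) • I (f i)) ω = L (Pi.single i 1) * I (f i) ω :=
        ae_all_iff.mpr fun i => Lp.coeFn_smul _ _
      filter_upwards [this] with ω hω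
      exact Finset.sum_congr rfl fun i _ => hω i
    filter_upwards [h1] with ω hω
    rw [hω]
    have : (s.restrict fun i => I (f i) ω) = ∑ i : s, I (f i) ω • (Pi.single i (1 : ℝ)) := by
      ext j
      simp [Finset.sum_apply, Pi.single_apply]
    simp only [Function.comp_apply]
    rw [this, map_sum]
    exact Finset.sum_congr rfl fun i _ => by simp [mul_comm]

/-- Integration by parts. -/
theorem integral_mul_eval [IsProbabilityMeasure P] (h : 𝓗) (q : MvPolynomial 𝓗 ℝ) :
    ∫ ω, I h ω * MvPolynomial.eval (fun g => I g ω) q ∂P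
      = ∫ ω, MvPolynomial.eval (fun g => I g ω) (dirDeriv h q) ∂P := by
  have hm : ∀ h, AEMeasurable (I h) P := fun h => (Lp.aestronglyMeasurable _).aemeasurable
  -- `l g` is the coefficient of the orthogonal projection of `g` onto `h`, so `g - l g • h` is
  -- orthogonal to `h`.
  obtain ⟨l, hl⟩ : ∃ l : 𝓗 → ℝ, ∀ g, ⟪g, h⟫_ℝ = ‖h‖ ^ 2 * l g := by
    by_cases hh : h = 0
    · exact ⟨0, by simp [hh]⟩
    · refine ⟨fun g => ⟪g, h⟫_ℝ / ‖h‖ ^ 2, fun g => ?_⟩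
      field_simp [norm_ne_zero_iff.mpr hh]
  -- Measurable versions are chosen so that the whole family is measurable into `𝓗 → ℝ`, although
  -- `𝓗` is uncountable.
  let Y : 𝓗 → Ω → ℝ := fun g => (hm (g - l g • h)).mk
  have hYm : ∀ g, Measurable (Y g) := fun g => (hm (g - l g • h)).measurable_mk
  have hYe : ∀ g, ⇑(I (g - l g • h)) =ᵐ[P] Y g := fun g => (hm (g - l g • h)).ae_eq_mk
  have hY : AEMeasurable (fun ω g => Y g ω) P := (measurable_pi_lambda _ hYm).aemeasurable
  have hdec : ∀ g, ⇑(I g) =ᵐ[P] fun ω => l g * I h ω + Y g ω := by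
    intro g
    have : I g = l g • I h + I (g - l g • h) := by simp
    nth_rw 1 [this]
    filter_upwards [Lp.coeFn_add (l g • I h) (I (g - l g • h)), Lp.coeFn_smul (l g) (I h),
      hYe g] with ω h1 h2 h3
    rw [h1, Pi.add_apply, h2, h3]
    simp
  -- In a Gaussian process, uncorrelated subfamilies are independent; Fubini then separates the
  -- variable `I h` from the `Y g`.
  have hind : IndepFun (fun ω => I h ω) (fun ω g => Y g ω) P := by
    have hg : IsGaussianProcess (Sum.elim (fun _ : Unit => ⇑(I h)) Y) P := by
      have := hI.isGaussianProcess (Sum.elim (fun _ : Unit => h) fun g => g - l g • h)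
      refine this.congr ?_
      rintro (i | i)
      · exact Filter.EventuallyEq.rfl
      · exact hYe i
    have hc : ∀ (_ : Unit) (g : 𝓗), cov[I h, Y g; P] = 0 := by
      intro _ g
      have hce : cov[I h, Y g; P] = cov[I h, I (g - l g • h); P] := by
        have hi : P[Y g] = P[I (g - l g • h)] := integral_congr_ae (hYe g).symm
        rw [covariance, covariance, hi]
        refine integral_congr_ae ?_
        filter_upwards [hYe g] with ω hω
        rw [hω]
      rw [hce, hI.covariance_eq, inner_sub_right, inner_smul_right, real_inner_comm, hl,
        real_inner_self_eq_norm_sq]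
      ring
    have hmu : Measurable fun x : Unit → ℝ => x () := by fun_prop
    exact (hg.indepFun_of_covariance_eq_zero (fun _ => hm _)
      (fun g => (hYm g).aemeasurable) hc).comp hmu measurable_id
  have hmap := (indepFun_iff_map_prod_eq_prod_map_map (hm h) hY).mp hind
  rw [hI h] at hmap
  have hpm : AEMeasurable (fun ω => (I h ω, fun g => Y g ω)) P :=
    (hm h).prodMk hY
  have : IsProbabilityMeasure (P.map fun ω g => Y g ω) :=
    Measure.isProbabilityMeasure_map hY
  let G : MvPolynomial 𝓗 ℝ → ℝ × (𝓗 → ℝ) → ℝ :=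
    fun q z => MvPolynomial.eval (fun g => l g * z.1 + z.2 g) q
  have hG : ∀ q, Measurable (G q) := fun q =>
    measurable_eval_mvPolynomial (X := fun (z : ℝ × (𝓗 → ℝ)) g => l g * z.1 + z.2 g)
      (by fun_prop) q
  have hev : ∀ q, (fun ω => MvPolynomial.eval (fun g => I g ω) q) =ᵐ[P]
      fun ω => G q (I h ω, fun g => Y g ω) := fun q => eval_ae_congr hdec q
  let D : Derivation ℝ (MvPolynomial 𝓗 ℝ) (MvPolynomial 𝓗 ℝ) :=
    MvPolynomial.mkDerivation ℝ fun g => MvPolynomial.C (l g)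
  have hD : ∀ q, dirDeriv h q = (‖h‖ ^ 2 : ℝ) • D q := by
    intro q
    have : dirDeriv h = (‖h‖ ^ 2 : ℝ) • D := by
      refine MvPolynomial.derivation_ext fun g => ?_
      simp only [dirDeriv_X, Derivation.smul_apply, D, MvPolynomial.mkDerivation_X, hl]
      rw [MvPolynomial.smul_eq_C_mul, ← MvPolynomial.C_mul]
    rw [this, Derivation.smul_apply]
  -- With the values `y` of the independent part frozen, `q` becomes a one-variable polynomial in `I
  -- h`, whose derivative is the image of `D q`. The one-dimensional formula applies to it.
  let S : (𝓗 → ℝ) → MvPolynomial 𝓗 ℝ →ₐ[ℝ] Polynomial ℝ := fun y =>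
    MvPolynomial.aeval fun g => Polynomial.C (l g) * Polynomial.X + Polynomial.C (y g)
  have hS : ∀ y q x, (S y q).eval x = G q (x, y) := by
    intro y q x
    induction q using MvPolynomial.induction_on with
    | C a => simp [S, G]
    | add q₁ q₂ h₁ h₂ => simp only [map_add, Polynomial.eval_add, h₁, h₂, G]
    | mul_X q i hq =>
      rw [map_mul, Polynomial.eval_mul, hq]
      simp [S, G]
  have hSd : ∀ y q, (S y q).derivative = S y (D q) := by
    intro y q
    induction q using MvPolynomial.induction_on with
    | C a => simp [S]
    | add q₁ q₂ h₁ h₂ => simp only [map_add, h₁, h₂]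
    | mul_X q i hq =>
      rw [map_mul, Polynomial.derivative_mul, hq, Derivation.leibniz, map_add, smul_eq_mul,
        smul_eq_mul, map_mul, map_mul]
      simp [S, D, MvPolynomial.mkDerivation_X]
      ring
  have i1 : Integrable (fun z => z.1 * G q z)
      ((gaussianReal 0 (‖h‖₊ ^ 2)).prod (P.map fun ω g => Y g ω)) := by
    rw [← hmap, integrable_map_measure (by fun_prop) hpm]
    refine (hI.integrable_eval (MvPolynomial.X h * q)).congr ?_
    filter_upwards [hev q] with ω hω
    simp [hω]
  have i2 : Integrable (fun z => G (D q) z)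
      ((gaussianReal 0 (‖h‖₊ ^ 2)).prod (P.map fun ω g => Y g ω)) := by
    rw [← hmap, integrable_map_measure (by fun_prop) hpm]
    exact (hI.integrable_eval (D q)).congr (hev _)
  have himap : ∀ f : ℝ × (𝓗 → ℝ) → ℝ, Measurable f → ∫ ω, f (I h ω, fun g => Y g ω) ∂P
      = ∫ z, f z ∂(gaussianReal 0 (‖h‖₊ ^ 2)).prod (P.map fun ω g => Y g ω) := by
    intro f hf
    rw [← hmap, integral_map hpm hf.aestronglyMeasurable]
  calc ∫ ω, I h ω * MvPolynomial.eval (fun g => I g ω) q ∂P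
      = ∫ ω, (fun z => z.1 * G q z) (I h ω, fun g => Y g ω) ∂P := by
        refine integral_congr_ae ?_
        refine (hev q).mono fun ω hω => ?_
        simp only at hω
        simp [hω]
    _ = ∫ y, ∫ x, x * G q (x, y) ∂(gaussianReal 0 (‖h‖₊ ^ 2)) ∂(P.map fun ω g => Y g ω) := by
        rw [himap (fun z => z.1 * G q z) (by fun_prop), integral_prod_symm _ i1]
    _ = ∫ y, ‖h‖ ^ 2 * ∫ x, G (D q) (x, y) ∂(gaussianReal 0 (‖h‖₊ ^ 2))
          ∂(P.map fun ω g => Y g ω) := by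
        congr 1; ext y
        have := integral_mul_eval_gaussianReal (‖h‖₊ ^ 2) (S y q)
        simp only [hSd, hS] at this
        simpa using this
    _ = ‖h‖ ^ 2 * ∫ ω, G (D q) (I h ω, fun g => Y g ω) ∂P := by
        rw [integral_const_mul, ← integral_prod_symm _ i2, himap _ (hG _)]
    _ = _ := by
        rw [← integral_const_mul]
        refine integral_congr_ae ?_
        refine (hev (D q)).mono fun ω hω => ?_
        simp only at hω ⊢
        rw [hD, MvPolynomial.smul_eval, hω]

end IsIsonormal

end Isonormal

/-! ### Hermite products and the raising operator -/

section Hermite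

-- Differentiating `h_{n+2} = x h_{n+1} - h_{n+1}'` and using induction gives `h_{n+1} + (n+1)(x h_n
-- - h_n')`, which is `(n+2) h_{n+1}`.
open Polynomial in
theorem derivative_hermite_succ (n : ℕ) :
    derivative (hermite (n + 1)) = (n + 1 : ℤ[X]) * hermite n := by
  induction n with
  | zero => simp
  | succ n ih =>
    rw [hermite_succ (n + 1), derivative_sub, derivative_mul, ih, derivative_mul, hermite_succ n]
    simp
    ring

/-- The Hermite polynomials with real coefficients. -/
noncomputable def realHermite (n : ℕ) : Polynomial ℝ :=
  (Polynomial.hermite n).map (algebraMap ℤ ℝ)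

theorem aeval_realHermite {A : Type*} [CommRing A] [Algebra ℝ A] (x : A) (n : ℕ) :
    Polynomial.aeval x (realHermite n) = Polynomial.aeval x (Polynomial.hermite n) :=
  Polynomial.aeval_map_algebraMap ..

theorem realHermite_zero : realHermite 0 = 1 := by simp [realHermite]

theorem realHermite_succ (n : ℕ) :
    realHermite (n + 1) = Polynomial.X * realHermite n - (realHermite n).derivative := by
  simp [realHermite, Polynomial.hermite_succ, Polynomial.derivative_map]

theorem derivative_realHermite_succ (n : ℕ) :
    (realHermite (n + 1)).derivative = Polynomial.C (n + 1 : ℝ) * realHermite n := by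
  rw [realHermite, Polynomial.derivative_map, derivative_hermite_succ]
  simp [realHermite]

variable {𝓗 : Type*} {κ : Type*}

/-- The products `∏ h_{α_p}(X_{b_p})` of Hermite polynomials. -/
noncomputable def hermiteProd (b : κ → 𝓗) (α : κ →₀ ℕ) : MvPolynomial 𝓗 ℝ :=
  α.prod fun p n => Polynomial.aeval (MvPolynomial.X (b p)) (realHermite n)

variable {b : κ → 𝓗}

@[simp]
theorem hermiteProd_zero : hermiteProd b 0 = 1 := by simp [hermiteProd]

theorem hermiteProd_eq_mul_erase (α : κ →₀ ℕ) (p : κ) :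
    hermiteProd b α = Polynomial.aeval (MvPolynomial.X (b p)) (realHermite (α p))
      * hermiteProd b (α.erase p) :=
  (Finsupp.mul_prod_erase' α p _ fun _ => by simp [realHermite_zero]).symm

variable [NormedAddCommGroup 𝓗] [InnerProductSpace ℝ 𝓗]

theorem erase_add_single_self (α : κ →₀ ℕ) (p : κ) (n : ℕ) :
    (α + Finsupp.single p n).erase p = α.erase p := by
  classical
  ext q
  by_cases h : q = p
  · simp [h]
  · simp [h]

/-- The remaining factors involve only `X_{b_q}` with `b_q ⟂ b_p`. -/
theorem dirDeriv_hermiteProd_erase (hb : Orthonormal ℝ b) (α : κ →₀ ℕ) (p : κ) :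
    dirDeriv (b p) (hermiteProd b (α.erase p)) = 0 := by
  refine Finset.prod_induction _ (fun x => dirDeriv (b p) x = 0) (fun x y hx hy => ?_) ?_
    fun q hq => ?_
  · rw [Derivation.leibniz, hx, hy]
    simp
  · exact Derivation.map_one_eq_zero _
  · have hqp : q ≠ p := by
      rintro rfl
      simp at hq
    rw [Derivation.map_aeval, dirDeriv_X, hb.2 hqp]
    simp

theorem dirDeriv_hermiteProd (hb : Orthonormal ℝ b) (α : κ →₀ ℕ) (p : κ) :
    dirDeriv (b p) (hermiteProd b α)
      = Polynomial.aeval (MvPolynomial.X (b p)) (realHermite (α p)).derivative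
        * hermiteProd b (α.erase p) := by
  rw [hermiteProd_eq_mul_erase α p, Derivation.leibniz, dirDeriv_hermiteProd_erase hb,
    Derivation.map_aeval, dirDeriv_X, real_inner_self_eq_norm_sq, hb.1]
  simp [mul_comm]

/-- The operator `q ↦ X_{b_p} q - ∂_{b_p} q` is the adjoint of `∂_{b_p}` under the Gaussian law,
which makes iterated integration by parts possible. -/
theorem hermiteProd_add_single (hb : Orthonormal ℝ b) (α : κ →₀ ℕ) (p : κ) :
    hermiteProd b (α + Finsupp.single p 1)
      = MvPolynomial.X (b p) * hermiteProd b α - dirDeriv (b p) (hermiteProd b α) := by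
  rw [dirDeriv_hermiteProd hb, hermiteProd_eq_mul_erase α p,
    hermiteProd_eq_mul_erase (α + Finsupp.single p 1) p, erase_add_single_self]
  simp [realHermite_succ]
  ring

theorem dirDeriv_hermiteProd_add_single (hb : Orthonormal ℝ b) (α : κ →₀ ℕ) (p : κ) :
    dirDeriv (b p) (hermiteProd b (α + Finsupp.single p 1))
      = MvPolynomial.C (α p + 1 : ℝ) * hermiteProd b α := by
  rw [dirDeriv_hermiteProd hb, hermiteProd_eq_mul_erase α p, erase_add_single_self]
  simp [derivative_realHermite_succ]
  ring

theorem dirDeriv_hermiteProd_of_eq_zero (hb : Orthonormal ℝ b) {α : κ →₀ ℕ} {p : κ}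
    (h : α p = 0) : dirDeriv (b p) (hermiteProd b α) = 0 := by
  rw [dirDeriv_hermiteProd hb, h]
  simp [realHermite_zero]

end Hermite

/-! ### Integration by parts against Hermite products and orthogonality -/

section Orthogonality

variable {Ω : Type*} [MeasurableSpace Ω] {P : Measure Ω} [IsProbabilityMeasure P]
  {𝓗 : Type*} [NormedAddCommGroup 𝓗] [InnerProductSpace ℝ 𝓗] {κ : Type*} {b : κ → 𝓗}
  {I : 𝓗 →L[ℝ] Lp ℝ 2 P}

/-- The random variable obtained from a polynomial by the substitution `X_g ↦ I g`. -/
noncomputable def polyEval (I : 𝓗 →L[ℝ] Lp ℝ 2 P) (q : MvPolynomial 𝓗 ℝ) (ω : Ω) : ℝ :=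
  MvPolynomial.eval (fun g => I g ω) q

namespace IsIsonormal

variable (hI : IsIsonormal I)
include hI

theorem integrable_polyEval (q : MvPolynomial 𝓗 ℝ) : Integrable (polyEval I q) P :=
  hI.integrable_eval q

theorem memLp_polyEval (q : MvPolynomial 𝓗 ℝ) : MemLp (polyEval I q) 2 P :=
  hI.memLp_eval q 2 (by simp)

/-- By the raising identity and the Leibniz rule, the two terms `f · ∂_{b_p} H_α` cancel. -/
theorem integral_polyEval_mul_hermiteProd_add_single (hb : Orthonormal ℝ b)
    (f : MvPolynomial 𝓗 ℝ) (α : κ →₀ ℕ) (p : κ) :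
    ∫ ω, polyEval I (f * hermiteProd b (α + Finsupp.single p 1)) ω ∂P
      = ∫ ω, polyEval I (dirDeriv (b p) f * hermiteProd b α) ω ∂P := by
  have h1 := hI.integral_mul_eval (b p) (f * hermiteProd b α)
  have h2 : ∀ ω, polyEval I (f * hermiteProd b (α + Finsupp.single p 1)) ω
      = I (b p) ω * polyEval I (f * hermiteProd b α) ω
        - polyEval I (f * dirDeriv (b p) (hermiteProd b α)) ω := by
    intro ω
    rw [hermiteProd_add_single hb]
    simp [polyEval]
    ring
  have h3 : ∀ ω, polyEval I (dirDeriv (b p) (f * hermiteProd b α)) ω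
      = polyEval I (f * dirDeriv (b p) (hermiteProd b α)) ω
        + polyEval I (dirDeriv (b p) f * hermiteProd b α) ω := by
    intro ω
    rw [Derivation.leibniz]
    simp [polyEval]
    ring
  simp_rw [h2]
  rw [integral_sub]
  · have h4 := h1
    change _ = ∫ ω, polyEval I _ ω ∂P at h4
    simp_rw [h3] at h4
    rw [integral_add (hI.integrable_polyEval _) (hI.integrable_polyEval _)] at h4
    change ∫ ω, I (b p) ω * polyEval I _ ω ∂P = _ at h4
    rw [h4]
    ring
  · refine (hI.integrable_polyEval (MvPolynomial.X (b p) * (f * hermiteProd b α))).congr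
      (Filter.Eventually.of_forall fun ω => ?_)
    simp [polyEval]
  · exact hI.integrable_polyEval _

/-- Iterated integration by parts. -/
theorem integral_polyEval_mul_hermiteProd_list (hb : Orthonormal ℝ b) (r : List κ) :
    ∀ f : MvPolynomial 𝓗 ℝ,
      ∫ ω, polyEval I (f * hermiteProd b (r.map fun p => Finsupp.single p 1).sum) ω ∂P
        = ∫ ω, polyEval I (r.foldr (fun p q => dirDeriv (b p) q) f) ω ∂P := by
  induction r using List.reverseRecOn with
  | nil => simp
  | append_singleton r p ih =>
    intro f
    rw [List.map_append, List.sum_append, List.map_singleton, List.sum_singleton,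
      hI.integral_polyEval_mul_hermiteProd_add_single hb, ih, List.foldr_append]
    simp

/-- One integration by parts removes an index `p` from `α` and differentiates `H_β`: the result is
`0` if `β p = 0`, and otherwise `β p` times the same integral in lower degree. The accumulated
factors give `α!`. -/
theorem integral_polyEval_hermiteProd_mul (hb : Orthonormal ℝ b) [DecidableEq (κ →₀ ℕ)]
    (α : κ →₀ ℕ) : ∀ β : κ →₀ ℕ,
    ∫ ω, polyEval I (hermiteProd b β * hermiteProd b α) ω ∂P
      = if α = β then α.prod fun _ n => (n ! : ℝ) else 0 := by
  have key : ∀ (α : κ →₀ ℕ) (p : κ), ∃ β, α p ≠ 0 → α = β + Finsupp.single p 1 := by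
    intro α p
    refine ⟨α - Finsupp.single p 1, fun h => ?_⟩
    rw [tsub_add_cancel_of_le]
    simpa [Nat.one_le_iff_ne_zero] using h
  have hex : ∀ α : κ →₀ ℕ, α ≠ 0 → ∃ β p, α = β + Finsupp.single p 1 := by
    intro α h
    obtain ⟨p, hp⟩ := Finsupp.ne_iff.mp h
    obtain ⟨β, hβ⟩ := key α p
    exact ⟨β, p, hβ hp⟩
  induction hn : α.degree generalizing α with
  | zero =>
    intro β
    obtain rfl : α = 0 := α.degree_eq_zero_iff.mp hn
    by_cases hβ : 0 = β
    · subst hβ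
      simp [polyEval]
    · rw [if_neg hβ]
      obtain ⟨γ, p, rfl⟩ := hex β (Ne.symm hβ)
      have := hI.integral_polyEval_mul_hermiteProd_add_single hb 1 γ p
      simp only [one_mul, hermiteProd_zero, mul_one] at this ⊢
      rw [this]
      simp [polyEval, Derivation.map_one_eq_zero]
  | succ n ih =>
    intro β
    obtain ⟨γ, p, rfl⟩ := hex α (by rintro rfl; simp at hn)
    have hγ : γ.degree = n := by simpa using hn
    rw [hI.integral_polyEval_mul_hermiteProd_add_single hb]
    by_cases hβ : β p = 0
    · rw [dirDeriv_hermiteProd_of_eq_zero hb hβ, if_neg]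
      · simp [polyEval]
      · rintro rfl
        simp at hβ
    · obtain ⟨δ, hδ⟩ := key β p
      obtain rfl := hδ hβ
      rw [dirDeriv_hermiteProd_add_single hb]
      have : ∀ ω, polyEval I (MvPolynomial.C (δ p + 1 : ℝ) * hermiteProd b δ * hermiteProd b γ) ω
          = (δ p + 1) * polyEval I (hermiteProd b δ * hermiteProd b γ) ω := by
        intro ω
        simp [polyEval]
        ring
      simp_rw [this]
      rw [integral_const_mul, ih γ hγ]
      by_cases h : γ = δ
      · subst h
        rw [if_pos rfl, if_pos rfl, ← Finsupp.mul_prod_erase' γ p _ (by simp),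
          ← Finsupp.mul_prod_erase' (γ + Finsupp.single p 1) p _ (by simp), erase_add_single_self]
        simp [Nat.factorial_succ]
        ring
      · rw [if_neg h, if_neg (by simpa using h), mul_zero]

end IsIsonormal

end Orthogonality

/-! ### Totality of the Hermite products in `L²(σ(W))` -/

section Density

variable {Ω : Type*} [MeasurableSpace Ω] {P : Measure Ω} [IsProbabilityMeasure P]

-- The positive and negative parts of `Y` are densities of two finite measures. Their images on path
-- space have the same finite-dimensional characteristic functions, so they coincide by uniqueness
-- of projective limits, and every event of `σ(W)` is the preimage of a set of paths.
omit [IsProbabilityMeasure P] in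
theorem setIntegral_eq_zero_of_integral_cexp_eq_zero
    {Z : Type*} [NormedAddCommGroup Z] [InnerProductSpace ℝ Z] [CompleteSpace Z]
    [TopologicalSpace.SeparableSpace Z] [MeasurableSpace Z] [BorelSpace Z] {T : ℝ}
    {W : Set.Icc (0 : ℝ) T → Ω → Z} (hW : ∀ t, Measurable (W t)) {Y : Ω → ℝ}
    (hY : Integrable Y P)
    (h : ∀ (s : Finset (Set.Icc (0 : ℝ) T)) (L : StrongDual ℝ (s → Z)),
      ∫ ω, Y ω • Complex.exp (L (s.restrict fun t => W t ω) * Complex.I) ∂P = 0)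
    {A : Set Ω} (hA : MeasurableSet[sigmaW W] A) : ∫ ω in A, Y ω ∂P = 0 := by
  have : SecondCountableTopology Z := UniformSpace.secondCountable_of_separable Z
  let pW : Ω → Set.Icc (0 : ℝ) T → Z := fun ω t => W t ω
  have hpW : Measurable pW := measurable_pi_lambda _ hW
  let μ : (Ω → ℝ) → Measure Ω := fun Y => P.withDensity fun ω => ((Y ω).toNNReal : ENNReal)
  have hfin : ∀ Y : Ω → ℝ, Integrable Y P → IsFiniteMeasure (μ Y) := fun Y hY =>
    isFiniteMeasure_withDensity_ofReal hY.2
  have hmeas : ∀ Y : Ω → ℝ, Integrable Y P → AEMeasurable (fun ω => (Y ω).toNNReal) P :=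
    fun Y hY => hY.aemeasurable.real_toNNReal
  have hsub : ∀ {E : Type} [NormedAddCommGroup E] [NormedSpace ℝ E] (g : Ω → E),
      AEStronglyMeasurable g P → (∃ C, ∀ ω, ‖g ω‖ ≤ C) → ∀ s, MeasurableSet s →
      ∫ ω in s, g ω ∂(μ Y) - ∫ ω in s, g ω ∂(μ (-Y)) = ∫ ω in s, Y ω • g ω ∂P := by
    intro E _ _ g hg ⟨C, hC⟩ s hs
    rw [setIntegral_withDensity_eq_setIntegral_smul₀ (hmeas Y hY).restrict _ hs,
      setIntegral_withDensity_eq_setIntegral_smul₀ (hmeas (-Y) hY.neg).restrict _ hs,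
      ← integral_sub]
    · congr 1; ext ω
      simp only [NNReal.smul_def, Real.coe_toNNReal', Pi.neg_apply]
      rw [← sub_smul, max_zero_sub_eq_self]
    · exact (hY.real_toNNReal.smul_bdd C hg (Filter.Eventually.of_forall hC)).integrableOn
    · exact (hY.neg.real_toNNReal.smul_bdd C hg (Filter.Eventually.of_forall hC)).integrableOn
  have := hfin Y hY
  have := hfin (-Y) hY.neg
  have heq : (μ Y).map pW = (μ (-Y)).map pW := by
    refine IsProjectiveLimit.unique (P := fun s : Finset _ => ((μ Y).map pW).map s.restrict)
      (fun s => rfl) fun s => ?_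
    refine (Measure.ext_of_charFunDual (funext fun L => ?_)).symm
    change charFunDual (((μ Y).map pW).map s.restrict) L = _
    rw [charFunDual_apply, charFunDual_apply, Measure.map_map (by fun_prop) hpW,
      Measure.map_map (by fun_prop) hpW, integral_map (by fun_prop) (by fun_prop),
      integral_map (by fun_prop) (by fun_prop), ← sub_eq_zero, ← setIntegral_univ,
      ← setIntegral_univ (μ := μ (-Y)), hsub _ _ ⟨1, fun ω => ?_⟩ _ MeasurableSet.univ,
      setIntegral_univ]
    · exact h s L
    · have hL : Measurable fun ω => L (s.restrict (pW ω)) :=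
        L.continuous.measurable.comp (s.measurable_restrict.comp hpW)
      have hc : Continuous fun x : ℝ => Complex.exp (x * Complex.I) := by fun_prop
      exact (hc.measurable.comp hL).aestronglyMeasurable
    · rw [Complex.norm_exp_ofReal_mul_I]
  obtain ⟨B, hB, rfl⟩ : ∃ B, MeasurableSet B ∧ pW ⁻¹' B = A := by
    have : sigmaW W = MeasurableSpace.comap pW MeasurableSpace.pi := by
      simp only [sigmaW, MeasurableSpace.pi, MeasurableSpace.comap_iSup,
        MeasurableSpace.comap_comp]
      rfl
    rw [this] at hA
    exact hA
  have h1 : (μ Y) (pW ⁻¹' B) = (μ (-Y)) (pW ⁻¹' B) := by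
    rw [← Measure.map_apply hpW hB, heq, Measure.map_apply hpW hB]
  have h2 := hsub (fun _ => (1 : ℝ)) aestronglyMeasurable_const ⟨1, by simp⟩ _ (hpW hB)
  simpa [measureReal_def, h1] using h2.symm

variable {𝓗 : Type*} [NormedAddCommGroup 𝓗] [InnerProductSpace ℝ 𝓗] {κ : Type*}

/-- This is the three-term recursion: multiplication by `X_{b_p}` raises the index once and adds a
multiple of the lowered product. -/
theorem X_mul_mem_span_hermiteProd {b : κ → 𝓗} (hb : Orthonormal ℝ b) (p : κ)
    {q : MvPolynomial 𝓗 ℝ} (hq : q ∈ Submodule.span ℝ (Set.range (hermiteProd b))) :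
    MvPolynomial.X (b p) * q ∈ Submodule.span ℝ (Set.range (hermiteProd b)) := by
  induction hq using Submodule.span_induction with
  | zero => simp
  | add x y _ _ hx hy => rw [mul_add]; exact add_mem hx hy
  | smul c x _ hx => rw [mul_smul_comm]; exact Submodule.smul_mem _ _ hx
  | mem x hx =>
    obtain ⟨α, rfl⟩ := hx
    have h1 := hermiteProd_add_single hb α p
    rw [eq_sub_iff_add_eq] at h1
    rw [← h1]
    refine add_mem (Submodule.subset_span ⟨_, rfl⟩) ?_
    by_cases h : α p = 0
    · rw [dirDeriv_hermiteProd_of_eq_zero hb h]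
      exact zero_mem _
    · obtain ⟨β, rfl⟩ : ∃ β, α = β + Finsupp.single p 1 := by
        refine ⟨α - Finsupp.single p 1, ?_⟩
        rw [tsub_add_cancel_of_le]
        simpa [Nat.one_le_iff_ne_zero] using h
      rw [dirDeriv_hermiteProd_add_single hb, ← MvPolynomial.smul_eq_C_mul]
      exact Submodule.smul_mem _ _ (Submodule.subset_span ⟨_, rfl⟩)

omit [IsProbabilityMeasure P] in
theorem polyEval_add (I : 𝓗 →L[ℝ] Lp ℝ 2 P) (q r : MvPolynomial 𝓗 ℝ) (ω : Ω) :
    polyEval I (q + r) ω = polyEval I q ω + polyEval I r ω := by simp [polyEval]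

omit [IsProbabilityMeasure P] in
theorem polyEval_mul (I : 𝓗 →L[ℝ] Lp ℝ 2 P) (q r : MvPolynomial 𝓗 ℝ) (ω : Ω) :
    polyEval I (q * r) ω = polyEval I q ω * polyEval I r ω := by simp [polyEval]

omit [IsProbabilityMeasure P] in
theorem polyEval_smul (I : 𝓗 →L[ℝ] Lp ℝ 2 P) (c : ℝ) (r : MvPolynomial 𝓗 ℝ) (ω : Ω) :
    polyEval I (c • r) ω = c * polyEval I r ω := by simp [polyEval, MvPolynomial.smul_eval]

-- The span of the Hermite products involves only the indeterminates `X_{b_p}`, so `X_h` has to be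
-- replaced by a combination of these, with the same evaluation only up to a null set.
omit [IsProbabilityMeasure P] in
theorem exists_linear_polynomial {b : κ → 𝓗} (hb : Orthonormal ℝ b) (I : 𝓗 →L[ℝ] Lp ℝ 2 P)
    {h : 𝓗} (hh : h ∈ Submodule.span ℝ (Set.range b)) :
    ∃ l : MvPolynomial 𝓗 ℝ, polyEval I l =ᵐ[P] I h ∧
      ∀ q ∈ Submodule.span ℝ (Set.range (hermiteProd b)),
        l * q ∈ Submodule.span ℝ (Set.range (hermiteProd b)) := by
  induction hh using Submodule.span_induction with
  | zero =>
    refine ⟨0, ?_, by simp⟩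
    rw [map_zero]
    filter_upwards [Lp.coeFn_zero ℝ 2 P] with ω hω
    rw [hω, polyEval, map_zero, Pi.zero_apply]
  | add x y _ _ hx hy =>
    obtain ⟨l, hl, hl'⟩ := hx
    obtain ⟨m, hm, hm'⟩ := hy
    refine ⟨l + m, ?_, fun q hq => by rw [add_mul]; exact add_mem (hl' q hq) (hm' q hq)⟩
    rw [map_add]
    filter_upwards [hl, hm, Lp.coeFn_add (I x) (I y)] with ω h1 h2 h3
    rw [polyEval_add, h3, h1, h2, Pi.add_apply]
  | smul c x _ hx =>
    obtain ⟨l, hl, hl'⟩ := hx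
    refine ⟨c • l, ?_, fun q hq => by
      rw [smul_mul_assoc]; exact Submodule.smul_mem _ _ (hl' q hq)⟩
    rw [map_smul]
    filter_upwards [hl, Lp.coeFn_smul c (I x)] with ω h1 h2
    rw [polyEval_smul, h2, h1, Pi.smul_apply, smul_eq_mul]
  | mem x hx =>
    obtain ⟨p, rfl⟩ := hx
    exact ⟨MvPolynomial.X (b p), Filter.Eventually.of_forall fun ω => MvPolynomial.eval_X _,
      fun q hq => X_mul_mem_span_hermiteProd hb p hq⟩

namespace IsIsonormal

variable {I : 𝓗 →L[ℝ] Lp ℝ 2 P} (hI : IsIsonormal I)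
include hI

theorem integral_mul_pow_eq_zero {b : κ → 𝓗} (hb : Orthonormal ℝ b) {Y : Ω → ℝ}
    (hY : MemLp Y 2 P) (hY0 : ∀ α, ∫ ω, Y ω * polyEval I (hermiteProd b α) ω ∂P = 0)
    {h : 𝓗} (hh : h ∈ Submodule.span ℝ (Set.range b)) (n : ℕ) :
    ∫ ω, Y ω * I h ω ^ n ∂P = 0 := by
  obtain ⟨l, hl, hl'⟩ := exists_linear_polynomial hb I hh
  have h1 : ∀ n, l ^ n ∈ Submodule.span ℝ (Set.range (hermiteProd b)) := by
    intro n
    induction n with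
    | zero => exact Submodule.subset_span ⟨0, by simp⟩
    | succ n ih => rw [pow_succ']; exact hl' _ ih
  have h2 : ∀ q ∈ Submodule.span ℝ (Set.range (hermiteProd b)),
      ∫ ω, Y ω * polyEval I q ω ∂P = 0 := by
    intro q hq
    induction hq using Submodule.span_induction with
    | zero => simp [polyEval]
    | add x y _ _ hx hy =>
      simp_rw [polyEval_add, mul_add]
      have hi : ∀ q, Integrable (fun ω => Y ω * polyEval I q ω) P := fun q =>
        hY.integrable_mul (hI.memLp_polyEval q)
      rw [integral_add (hi x) (hi y), hx, hy, add_zero]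
    | smul c x _ hx =>
      simp_rw [polyEval_smul, mul_left_comm _ c]
      rw [integral_const_mul, hx, mul_zero]
    | mem x hx =>
      obtain ⟨α, rfl⟩ := hx
      exact hY0 α
  rw [← h2 _ (h1 n)]
  refine integral_congr_ae ?_
  filter_upwards [hl] with ω hω
  simp [← hω, polyEval]

omit [IsProbabilityMeasure P] in
theorem memLp_exp_abs (h : 𝓗) : MemLp (fun ω => Real.exp |I h ω|) 2 P := by
  have hm : AEMeasurable (I h) P := (Lp.aestronglyMeasurable _).aemeasurable
  have he : ∀ t : ℝ, Integrable (fun ω => Real.exp (t * I h ω)) P := by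
    intro t
    have := integrable_exp_mul_gaussianReal (μ := 0) (v := ‖h‖₊ ^ 2) t
    rw [← hI h, integrable_map_measure (by fun_prop) hm] at this
    exact this
  rw [memLp_two_iff_integrable_sq (by fun_prop)]
  refine ((he 2).add (he (-2))).mono' (by fun_prop) (Filter.Eventually.of_forall fun ω => ?_)
  rw [Real.norm_eq_abs, abs_of_nonneg (by positivity), ← Real.exp_nat_mul, Pi.add_apply]
  rcases abs_cases (I h ω) with ha | ha
  · rw [ha.1]
    push_cast
    linarith [Real.exp_pos (-2 * I h ω)]
  · rw [ha.1]
    have : ((2 : ℕ) : ℝ) * -I h ω = -2 * I h ω := by push_cast; ring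
    rw [this]
    linarith [Real.exp_pos (2 * I h ω)]

/-- The exponential series may be integrated termwise: it is dominated by `|Y| exp |I h|`,
integrable because Gaussian variables have all exponential moments. Each term is a multiple of some
`E[Y (I h)ⁿ] = 0`. -/
theorem integral_smul_cexp_eq_zero_of_mem_span {b : κ → 𝓗} (hb : Orthonormal ℝ b) {Y : Ω → ℝ}
    (hY : MemLp Y 2 P) (hY0 : ∀ α, ∫ ω, Y ω * polyEval I (hermiteProd b α) ω ∂P = 0)
    {h : 𝓗} (hh : h ∈ Submodule.span ℝ (Set.range b)) :
    ∫ ω, Y ω • Complex.exp (I h ω * Complex.I) ∂P = 0 := by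
  have hm : AEStronglyMeasurable (I h) P := Lp.aestronglyMeasurable _
  have hexp : ∀ x : ℝ, HasSum (fun n : ℕ => |x| ^ n / (n ! : ℝ)) (Real.exp |x|) := by
    intro x
    rw [Real.exp_eq_exp_ℝ]
    exact NormedSpace.expSeries_div_hasSum_exp (𝔸 := ℝ) _
  have key := hasSum_integral_of_dominated_convergence (μ := P)
    (F := fun (n : ℕ) ω => Y ω • ((I h ω * Complex.I) ^ n / (n ! : ℂ)))
    (f := fun ω => Y ω • Complex.exp (I h ω * Complex.I))
    (fun n ω => |Y ω| * (|I h ω| ^ n / (n ! : ℝ))) ?_ ?_ ?_ ?_ ?_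
  · refine key.unique ?_
    convert hasSum_zero with n
    have h1 : ∀ ω, Y ω • ((I h ω * Complex.I) ^ n / (n ! : ℂ))
        = (Y ω * I h ω ^ n) • (Complex.I ^ n / (n ! : ℂ)) := by
      intro ω
      rw [Complex.real_smul, Complex.real_smul]
      push_cast
      ring
    simp_rw [h1]
    rw [integral_smul_const, hI.integral_mul_pow_eq_zero hb hY hY0 hh, zero_smul]
  · intro n
    have := hY.1
    have h2 : AEStronglyMeasurable (fun ω => ((I h ω : ℝ) : ℂ)) P :=
      Complex.continuous_ofReal.comp_aestronglyMeasurable hm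
    refine this.smul ?_
    simp_rw [div_eq_mul_inv]
    exact ((h2.mul_const _).pow n).mul_const _
  · intro n
    refine Filter.Eventually.of_forall fun ω => ?_
    simp
  · exact Filter.Eventually.of_forall fun ω => ((hexp (I h ω)).mul_left _).summable
  · have : (fun ω => ∑' n : ℕ, |Y ω| * (|I h ω| ^ n / (n ! : ℝ)))
        = fun ω => |Y ω| * Real.exp |I h ω| := by
      ext ω
      exact ((hexp (I h ω)).mul_left _).tsum_eq
    rw [this]
    exact hY.abs.integrable_mul (hI.memLp_exp_abs h)
  · refine Filter.Eventually.of_forall fun ω => ?_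
    refine HasSum.const_smul _ ?_
    rw [Complex.exp_eq_exp_ℂ]
    exact NormedSpace.expSeries_div_hasSum_exp (𝔸 := ℂ) _

omit hI [IsProbabilityMeasure P] in
theorem integral_abs_mul_abs_le (f g : Lp ℝ 2 P) : ∫ ω, |f ω| * |g ω| ∂P ≤ ‖f‖ * ‖g‖ := by
  have h := real_inner_le_norm |f| |g|
  rw [norm_abs_eq_norm, norm_abs_eq_norm, L2.inner_def] at h
  refine le_trans (le_of_eq (integral_congr_ae ?_)) h
  filter_upwards [Lp.coeFn_abs f, Lp.coeFn_abs g] with ω h1 h2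
  simp [h1, h2, mul_comm]

-- Lipschitz continuity follows from `|e^{ia} - e^{ib}| ≤ |a - b|` and Cauchy-Schwarz. It carries
-- the vanishing from the span of `b` to all of `𝓗`.
omit hI in
theorem continuous_integral_smul_cexp (I : 𝓗 →L[ℝ] Lp ℝ 2 P) (Y : Lp ℝ 2 P) :
    Continuous fun h : 𝓗 => ∫ ω, Y ω • Complex.exp (I h ω * Complex.I) ∂P := by
  have hY := Lp.memLp Y
  have hint : ∀ h : 𝓗, Integrable (fun ω => Y ω • Complex.exp (I h ω * Complex.I)) P := by
    intro h
    have hm : AEStronglyMeasurable (I h) P := Lp.aestronglyMeasurable _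
    refine (hY.integrable one_le_two).smul_bdd 1 ?_ (Filter.Eventually.of_forall fun ω => ?_)
    · fun_prop
    · rw [Complex.norm_exp_ofReal_mul_I]
  refine (LipschitzWith.of_dist_le_mul (K := ‖Y‖₊ * ‖I‖₊) fun g h => ?_).continuous
  rw [dist_eq_norm, ← integral_sub (hint g) (hint h), dist_eq_norm]
  have habs : Integrable (fun ω => |Y ω| * |I (g - h) ω|) P :=
    hY.abs.integrable_mul (Lp.memLp (I (g - h))).abs
  calc _ ≤ ∫ ω, |Y ω| * |I (g - h) ω| ∂P := by
        refine norm_integral_le_of_norm_le habs ?_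
        have : I (g - h) = I g - I h := map_sub _ _ _
        rw [this]
        filter_upwards [Lp.coeFn_sub (I g) (I h)] with ω hω
        rw [hω, Pi.sub_apply, ← smul_sub, norm_smul, Real.norm_eq_abs]
        gcongr
        have e : Complex.exp (I g ω * Complex.I) - Complex.exp (I h ω * Complex.I)
            = Complex.exp (I h ω * Complex.I)
              * (Complex.exp (Complex.I * ((I g ω - I h ω : ℝ) : ℂ)) - 1) := by
          rw [mul_sub, ← Complex.exp_add, mul_one]
          congr 2
          push_cast
          ring
        rw [e, norm_mul, Complex.norm_exp_ofReal_mul_I, one_mul]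
        exact Real.norm_exp_I_mul_ofReal_sub_one_le
    _ ≤ ‖Y‖ * ‖I (g - h)‖ := integral_abs_mul_abs_le _ _
    _ ≤ ‖Y‖ * (‖I‖ * ‖g - h‖) := mul_le_mul_of_nonneg_left (I.le_opNorm _) (norm_nonneg _)
    _ = _ := by rw [NNReal.coe_mul, coe_nnnorm, coe_nnnorm, mul_assoc]

/-- The Hermite products are total in `L²(σ(W))` if `σ(W)` is generated by the isonormal family. -/
theorem ae_eq_zero_of_integral_mul_hermiteProd
    {Z : Type*} [NormedAddCommGroup Z] [InnerProductSpace ℝ Z] [CompleteSpace Z]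
    [TopologicalSpace.SeparableSpace Z] [MeasurableSpace Z] [BorelSpace Z] {T : ℝ}
    {W : Set.Icc (0 : ℝ) T → Ω → Z} (hW : ∀ t, Measurable (W t))
    (hWI : ∀ t z, ∃ h : 𝓗, I h =ᵐ[P] fun ω => ⟪W t ω, z⟫_ℝ)
    (b : HilbertBasis κ ℝ 𝓗) (Y : Lp ℝ 2 P) (hYm : AEStronglyMeasurable[sigmaW W] Y P)
    (hY0 : ∀ α, ∫ ω, Y ω * polyEval I (hermiteProd b α) ω ∂P = 0) : Y = 0 := by
  have hY := Lp.memLp Y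
  have hcexp : ∀ h : 𝓗, ∫ ω, Y ω • Complex.exp (I h ω * Complex.I) ∂P = 0 := by
    have hcl := isClosed_eq (continuous_integral_smul_cexp I Y)
      (continuous_const (y := (0 : ℂ)))
    have hd : Dense (Submodule.span ℝ (Set.range b) : Set 𝓗) :=
      Submodule.dense_iff_topologicalClosure_eq_top.mpr b.dense_span
    intro h
    exact hcl.closure_subset_iff.mpr (fun h hh =>
      hI.integral_smul_cexp_eq_zero_of_mem_span b.orthonormal hY hY0 hh) (hd h)
  have hle : sigmaW W ≤ ‹MeasurableSpace Ω› := iSup_le fun t => (hW t).comap_le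
  have h0 := Lp.ae_eq_zero_of_forall_setIntegral_eq_zero' ℝ hle Y (by simp) (by simp)
    (fun s _ _ => (hY.integrable one_le_two).integrableOn) ?_ hYm
  · exact (Lp.eq_zero_iff_ae_eq_zero).mpr h0
  intro A hA _
  refine setIntegral_eq_zero_of_integral_cexp_eq_zero hW (hY.integrable one_le_two)
    (fun s L => ?_) hA
  classical
  -- The functional `L` is a finite sum of terms `⟪W_t, z_t⟫`, each of them a value of `I`; so its
  -- exponential is covered by `hcexp`.
  let z : s → Z := fun t => (InnerProductSpace.toDual ℝ Z).symm
    (L ∘L ContinuousLinearMap.single ℝ (fun _ : s => Z) t)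
  choose f hf using fun t : s => hWI t (z t)
  rw [← hcexp (∑ t, f t)]
  refine integral_congr_ae ?_
  have h1 : ∀ᵐ ω ∂P, ∀ t, I (f t) ω = ⟪W t ω, z t⟫_ℝ := ae_all_iff.mpr hf
  have h2 : ⇑(I (∑ t, f t)) =ᵐ[P] fun ω => ∑ t, I (f t) ω := by
    rw [map_sum]
    exact Lp.coeFn_fun_finsetSum _ _
  filter_upwards [h1, h2] with ω h1 h2
  rw [h2]
  congr 4
  have h3 : (s.restrict fun t => W t ω)
      = ∑ t : s, ContinuousLinearMap.single ℝ (fun _ : s => Z) t (W t ω) := by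
    ext t
    simp [Finset.sum_apply, Pi.single_apply]
  rw [h3, map_sum]
  refine Finset.sum_congr rfl fun t _ => ?_
  rw [h1 t, real_inner_comm, InnerProductSpace.toDual_symm_apply]
  rfl

end IsIsonormal

end Density

/-! ### Classes of square-integrable functions -/

section ToL2

variable {α E : Type*} [MeasurableSpace α] [NormedAddCommGroup E] {μ : Measure α}

theorem toL2_eq_toLp {f : α → E} (h : MemLp f 2 μ) : toL2 μ f = h.toLp := dif_pos h

theorem coeFn_toL2 {f : α → E} (h : MemLp f 2 μ) : toL2 μ f =ᵐ[μ] f := by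
  rw [toL2_eq_toLp h]
  exact h.coeFn_toLp

theorem toL2_congr {f g : α → E} (h : f =ᵐ[μ] g) : toL2 μ f = toL2 μ g := by
  by_cases hf : MemLp f 2 μ
  · rw [toL2_eq_toLp hf, toL2_eq_toLp ((memLp_congr_ae h).mp hf)]
    exact MemLp.toLp_congr _ _ h
  · rw [toL2, toL2, dif_neg hf, dif_neg fun hg => hf ((memLp_congr_ae h).mpr hg)]

theorem toL2_coeFn (f : Lp E 2 μ) : toL2 μ f = f := by
  rw [toL2_eq_toLp (Lp.memLp f), Lp.toLp_coeFn]

end ToL2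

/-! ### Expansions in `L²(μ; E)` along an orthonormal family of `L²(μ)` -/

section TensorLp

variable {α E : Type*} [MeasurableSpace α] {μ : Measure α} [NormedAddCommGroup E]
  [InnerProductSpace ℝ E]

/-- The element `w ⊗ x` of `L²(μ; E)`. -/
noncomputable def tensorLp (w : Lp ℝ 2 μ) (x : E) : Lp E 2 μ :=
  (ContinuousLinearMap.toSpanSingleton ℝ x).compLp w

theorem coeFn_tensorLp (w : Lp ℝ 2 μ) (x : E) : tensorLp w x =ᵐ[μ] fun a => w a • x := by
  filter_upwards [(ContinuousLinearMap.toSpanSingleton ℝ x).coeFn_compLp w] with a ha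
  rw [tensorLp, ha, ContinuousLinearMap.toSpanSingleton_apply]

theorem inner_tensorLp_tensorLp (v w : Lp ℝ 2 μ) (x y : E) :
    ⟪tensorLp v x, tensorLp w y⟫_ℝ = ⟪v, w⟫_ℝ * ⟪x, y⟫_ℝ := by
  rw [L2.inner_def, L2.inner_def, ← integral_mul_const]
  refine integral_congr_ae ?_
  filter_upwards [coeFn_tensorLp v x, coeFn_tensorLp w y] with a h1 h2
  rw [h1, h2, real_inner_smul_left, real_inner_smul_right]
  simp
  ring

theorem norm_tensorLp (w : Lp ℝ 2 μ) (x : E) : ‖tensorLp w x‖ = ‖w‖ * ‖x‖ := by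
  rw [← sq_eq_sq₀ (norm_nonneg _) (by positivity), ← real_inner_self_eq_norm_sq,
    inner_tensorLp_tensorLp, real_inner_self_eq_norm_sq, real_inner_self_eq_norm_sq, mul_pow]

theorem tensorLp_add_left (v w : Lp ℝ 2 μ) (x : E) :
    tensorLp (v + w) x = tensorLp v x + tensorLp w x := by
  refine Lp.ext ?_
  filter_upwards [coeFn_tensorLp (v + w) x, coeFn_tensorLp v x, coeFn_tensorLp w x,
    Lp.coeFn_add v w, Lp.coeFn_add (tensorLp v x) (tensorLp w x)] with a h1 h2 h3 h4 h5
  rw [h1, h5, Pi.add_apply, h2, h3, h4, Pi.add_apply, add_smul]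

theorem tensorLp_smul_left (c : ℝ) (w : Lp ℝ 2 μ) (x : E) :
    tensorLp (c • w) x = c • tensorLp w x := by
  refine Lp.ext ?_
  filter_upwards [coeFn_tensorLp (c • w) x, coeFn_tensorLp w x,
    Lp.coeFn_smul c w, Lp.coeFn_smul c (tensorLp w x)] with a h1 h2 h3 h4
  rw [h1, h4, Pi.smul_apply, h2, h3, Pi.smul_apply, smul_eq_mul, mul_smul]

theorem tensorLp_add_right (w : Lp ℝ 2 μ) (x y : E) :
    tensorLp w (x + y) = tensorLp w x + tensorLp w y := by
  refine Lp.ext ?_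
  filter_upwards [coeFn_tensorLp w (x + y), coeFn_tensorLp w x, coeFn_tensorLp w y,
    Lp.coeFn_add (tensorLp w x) (tensorLp w y)] with a h1 h2 h3 h4
  rw [h1, h4, Pi.add_apply, h2, h3, smul_add]

theorem tensorLp_smul_right (c : ℝ) (w : Lp ℝ 2 μ) (x : E) :
    tensorLp w (c • x) = c • tensorLp w x := by
  refine Lp.ext ?_
  filter_upwards [coeFn_tensorLp w (c • x), coeFn_tensorLp w x,
    Lp.coeFn_smul c (tensorLp w x)] with a h1 h2 h3
  rw [h1, h3, Pi.smul_apply, h2, smul_comm]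

/-- The bilinear map `(w, x) ↦ w ⊗ x`. -/
noncomputable def tensorLpL : Lp ℝ 2 μ →L[ℝ] E →L[ℝ] Lp E 2 μ :=
  LinearMap.mkContinuous₂ (LinearMap.mk₂ ℝ tensorLp tensorLp_add_left tensorLp_smul_left
    tensorLp_add_right fun c w x => tensorLp_smul_right c w x) 1 fun w x => by
      simp [norm_tensorLp]

theorem tensorLpL_apply (w : Lp ℝ 2 μ) (x : E) : tensorLpL w x = tensorLp w x := rfl

variable [CompleteSpace E]

/-- The mean `∫ w F dμ`. -/
noncomputable def coefLp (w : Lp ℝ 2 μ) (F : Lp E 2 μ) : E := ∫ a, w a • F a ∂μ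

theorem inner_tensorLp_left (w : Lp ℝ 2 μ) (x : E) (F : Lp E 2 μ) :
    ⟪tensorLp w x, F⟫_ℝ = ⟪x, coefLp w F⟫_ℝ := by
  have hi : Integrable (fun a => w a • F a) μ :=
    memLp_one_iff_integrable.mp ((Lp.memLp F).smul (Lp.memLp w))
  rw [L2.inner_def, coefLp, ← integral_inner hi]
  refine integral_congr_ae ?_
  filter_upwards [coeFn_tensorLp w x] with a ha
  rw [ha, real_inner_smul_left, real_inner_smul_right]

/-- Linearity and continuity of the coefficient maps come from this form. -/
theorem coefLp_eq_adjoint (w : Lp ℝ 2 μ) (F : Lp E 2 μ) :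
    coefLp w F = ContinuousLinearMap.adjoint (tensorLpL w) F := by
  refine ext_inner_left ℝ fun x => ?_
  rw [ContinuousLinearMap.adjoint_inner_right, tensorLpL_apply, inner_tensorLp_left]

theorem coefLp_tensorLp (v w : Lp ℝ 2 μ) (x : E) :
    coefLp v (tensorLp w x) = ⟪v, w⟫_ℝ • x := by
  refine ext_inner_left ℝ fun y => ?_
  rw [← inner_tensorLp_left, inner_tensorLp_tensorLp, real_inner_smul_right]

variable {A : Type*} {ξ : A → Lp ℝ 2 μ} (hξ : Orthonormal ℝ ξ)
include hξ

omit [CompleteSpace E] in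
theorem orthogonalFamily_tensorLp :
    OrthogonalFamily ℝ (fun _ : A => E) fun a =>
      (⟨(tensorLpL (ξ a)).toLinearMap, fun x => by
        change ‖tensorLp (ξ a) x‖ = _
        rw [norm_tensorLp, hξ.1, one_mul]⟩ : E →ₗᵢ[ℝ] Lp E 2 μ) := by
  intro i j hij x y
  change ⟪tensorLp (ξ i) x, tensorLp (ξ j) y⟫_ℝ = 0
  rw [inner_tensorLp_tensorLp, hξ.2 hij, zero_mul]

/-- Bessel's inequality: expand `0 ≤ ‖S - F‖²` with `S` the partial sum, where `⟪S, F⟫ = ‖S‖²`. -/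
theorem sum_norm_coefLp_sq_le (F : Lp E 2 μ) (s : Finset A) :
    ∑ a ∈ s, ‖coefLp (ξ a) F‖ ^ 2 ≤ ‖F‖ ^ 2 := by
  have h1 := (orthogonalFamily_tensorLp (E := E) hξ).norm_sum (fun a => coefLp (ξ a) F) s
  change ‖∑ a ∈ s, tensorLp (ξ a) (coefLp (ξ a) F)‖ ^ 2 = _ at h1
  have h2 : ⟪∑ a ∈ s, tensorLp (ξ a) (coefLp (ξ a) F), F⟫_ℝ = ∑ a ∈ s, ‖coefLp (ξ a) F‖ ^ 2 := by
    rw [sum_inner]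
    exact Finset.sum_congr rfl fun a _ => by
      rw [inner_tensorLp_left, real_inner_self_eq_norm_sq]
  have h3 := norm_sub_sq_real (∑ a ∈ s, tensorLp (ξ a) (coefLp (ξ a) F)) F
  rw [h1, h2] at h3
  nlinarith [sq_nonneg ‖∑ a ∈ s, tensorLp (ξ a) (coefLp (ξ a) F) - F‖]

theorem summable_tensorLp_coefLp (F : Lp E 2 μ) :
    Summable fun a => tensorLp (ξ a) (coefLp (ξ a) F) := by
  refine ((orthogonalFamily_tensorLp (E := E) hξ).summable_iff_norm_sq_summable
    (fun a => coefLp (ξ a) F)).mpr ?_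
  exact summable_of_sum_le (fun _ => by positivity) (sum_norm_coefLp_sq_le hξ F)

theorem coefLp_tsum (F : Lp E 2 μ) (a : A) :
    coefLp (ξ a) (∑' a, tensorLp (ξ a) (coefLp (ξ a) F)) = coefLp (ξ a) F := by
  classical
  rw [coefLp_eq_adjoint, ContinuousLinearMap.map_tsum _ (summable_tensorLp_coefLp hξ F),
    tsum_eq_single a]
  · rw [← coefLp_eq_adjoint, coefLp_tensorLp, real_inner_self_eq_norm_sq, hξ.1]
    simp
  · intro c hc
    rw [← coefLp_eq_adjoint, coefLp_tensorLp, hξ.2 hc.symm, zero_smul]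

/-- The difference between `F` and its expansion stays in `M` and has zero coefficients. The
subspace `M` will be the `σ(W)`-measurable classes, where alone the chaos basis is known to be
total. -/
theorem hasSum_tensorLp_coefLp {M : Submodule ℝ (Lp E 2 μ)} (hM : IsClosed (M : Set (Lp E 2 μ)))
    (hξM : ∀ a x, tensorLp (ξ a) x ∈ M) (h0 : ∀ G ∈ M, (∀ a, coefLp (ξ a) G = 0) → G = 0)
    {F : Lp E 2 μ} (hF : F ∈ M) : HasSum (fun a => tensorLp (ξ a) (coefLp (ξ a) F)) F := by
  have hs := summable_tensorLp_coefLp hξ F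
  have hm : ∑' a, tensorLp (ξ a) (coefLp (ξ a) F) ∈ M := hM.mem_of_tendsto hs.hasSum
    (Filter.Eventually.of_forall fun s => M.sum_mem fun a _ => hξM _ _)
  have := h0 _ (M.sub_mem hF hm) fun a => by
    rw [coefLp_eq_adjoint, map_sub, ← coefLp_eq_adjoint, ← coefLp_eq_adjoint, coefLp_tsum hξ,
      sub_self]
  rw [sub_eq_zero] at this
  nth_rw 2 [this]
  exact hs.hasSum

theorem hasSum_inner_coefLp (F G : Lp E 2 μ) :
    HasSum (fun a => ⟪coefLp (ξ a) F, coefLp (ξ a) G⟫_ℝ)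
      ⟪F, ∑' a, tensorLp (ξ a) (coefLp (ξ a) G)⟫_ℝ := by
  have := (innerSL ℝ F).hasSum (summable_tensorLp_coefLp hξ G).hasSum
  refine this.congr_fun ?_ |> fun h => h
  intro a
  rw [innerSL_apply_apply, real_inner_comm, ← inner_tensorLp_left, real_inner_comm]

end TensorLp

/-! ### Counting tuples with a given multi-index -/

section Combinatorics

theorem hasSum_mul_prod {A B : Type*} {f : A → ℝ} {g : B → ℝ} {a b : ℝ} (hf : HasSum f a)
    (hg : HasSum g b) : HasSum (fun x : A × B => f x.1 * g x.2) (a * b) :=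
  hf.mul hg (summable_mul_of_summable_norm hf.summable.norm hg.summable.norm)

theorem hasSum_prod_pi {κ : Type*} (k : ℕ) {f : Fin k → κ → ℝ} {a : Fin k → ℝ}
    (hf : ∀ l, HasSum (f l) (a l)) :
    HasSum (fun r : Fin k → κ => ∏ l, f l (r l)) (∏ l, a l) := by
  induction k with
  | zero => simp
  | succ k ih =>
    have h1 := ih (f := fun l => f l.succ) (a := fun l => a l.succ) fun l => hf _
    have h2 := hasSum_mul_prod (hf 0) h1
    rw [Fin.prod_univ_succ, ← (Fin.consEquiv fun _ : Fin (k + 1) => κ).hasSum_iff]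
    refine h2.congr_fun fun x => ?_
    simp [Fin.prod_univ_succ, Fin.consEquiv]

variable {κ : Type*}

/-- The multi-index counting the entries of a tuple. -/
noncomputable def tupleCount {k : ℕ} (r : Fin k → κ) : κ →₀ ℕ := ∑ l, Finsupp.single (r l) 1

theorem degree_tupleCount {k : ℕ} (r : Fin k → κ) : (tupleCount r).degree = k := by
  simp [tupleCount]

theorem tupleCount_cons {k : ℕ} (p : κ) (r : Fin k → κ) :
    tupleCount (Fin.cons p r : Fin (k + 1) → κ) = Finsupp.single p 1 + tupleCount r := by
  simp [tupleCount, Fin.sum_univ_succ]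

/-- Tuples with a given count, sorted by their first entry. -/
noncomputable def tupleCountEquiv (k : ℕ) (α : κ →₀ ℕ) :
    {r : Fin (k + 1) → κ // tupleCount r = α} ≃
      Σ p : α.support, {r : Fin k → κ // tupleCount r = α - Finsupp.single (p : κ) 1} where
  toFun r :=
    have h : Finsupp.single (r.1 0) 1 + tupleCount (Fin.tail r.1) = α := by
      rw [← tupleCount_cons, Fin.cons_self_tail, r.2]
    ⟨⟨r.1 0, by
      rw [Finsupp.mem_support_iff, ← DFunLike.congr_fun h (r.1 0)]
      simp⟩, ⟨Fin.tail r.1, eq_tsub_of_add_eq ((add_comm _ _).trans h)⟩⟩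
  invFun s := ⟨Fin.cons s.1.1 s.2.1, by
    rw [tupleCount_cons, s.2.2, add_tsub_cancel_of_le]
    simpa [Nat.one_le_iff_ne_zero] using Finsupp.mem_support_iff.mp s.1.2⟩
  left_inv r := Subtype.ext (Fin.cons_self_tail r.1)
  right_inv _ := rfl

theorem finite_tupleCount (k : ℕ) (α : κ →₀ ℕ) :
    Finite {r : Fin k → κ // tupleCount r = α} := by
  induction k generalizing α with
  | zero => infer_instance
  | succ k ih =>
    have := fun p : α.support => ih (α - Finsupp.single (p : κ) 1)
    exact Finite.of_equiv _ (tupleCountEquiv k α).symm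

/-- Sorted by first entry `p`, the tuples for `α` contribute `α p · k!` after multiplication by
`α!`, and the `α p` add up to `k + 1`. -/
theorem card_tupleCount_mul (k : ℕ) (α : κ →₀ ℕ) (hα : α.degree = k) :
    Nat.card {r : Fin k → κ // tupleCount r = α} * (α.prod fun _ n => n !) = k ! := by
  induction k generalizing α with
  | zero =>
    obtain rfl : α = 0 := α.degree_eq_zero_iff.mp hα
    have : Nat.card {r : Fin 0 → κ // tupleCount r = 0} = 1 := by
      rw [Nat.card_eq_one_iff_unique]
      exact ⟨inferInstance, ⟨⟨Fin.elim0, by simp [tupleCount]⟩⟩⟩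
    simp [this]
  | succ k ih =>
    have := fun p : α.support => finite_tupleCount k (α - Finsupp.single (p : κ) 1)
    rw [Nat.card_congr (tupleCountEquiv k α), Nat.card_sigma, Finset.sum_mul]
    have hterm : ∀ p : α.support,
        Nat.card {r : Fin k → κ // tupleCount r = α - Finsupp.single (p : κ) 1}
          * (α.prod fun _ n => n !) = α p * k ! := by
      rintro ⟨p, hp⟩
      obtain ⟨β, rfl⟩ : ∃ β, α = β + Finsupp.single p 1 := by
        refine ⟨α - Finsupp.single p 1, ?_⟩
        rw [tsub_add_cancel_of_le]
        simpa [Nat.one_le_iff_ne_zero] using hp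
      have hβ : β.degree = k := by simpa using hα
      have h1 := ih β hβ
      simp only [add_tsub_cancel_right]
      rw [← h1, ← Finsupp.mul_prod_erase' β p _ (by simp),
        ← Finsupp.mul_prod_erase' (β + Finsupp.single p 1) p _ (by simp), erase_add_single_self]
      simp [Nat.factorial_succ]
      ring
    rw [Finset.sum_congr rfl fun p _ => hterm p, ← Finset.sum_mul, Nat.factorial_succ, ← hα,
      Finsupp.degree_apply]
    congr 1
    exact Finset.sum_coe_sort α.support fun p => α p

/-- Grouping the tuples by their count produces fibres of `k!/α!` elements; this is the origin of
the factor `k!` in the formula. -/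
theorem hasSum_degree_of_hasSum_tuple {k : ℕ} {f : (κ →₀ ℕ) → ℝ} {S : ℝ}
    (h : HasSum (fun r : Fin k → κ => f (tupleCount r)) S) :
    HasSum (fun α : {α : κ →₀ ℕ // α.degree = k} =>
      (k ! : ℝ) * (((α : κ →₀ ℕ).prod fun _ n => (n ! : ℝ))⁻¹ * f α)) S := by
  have hfin := finite_tupleCount (κ := κ) k
  rw [← (Equiv.sigmaFiberEquiv (tupleCount (κ := κ) (k := k))).hasSum_iff] at h
  have h2 : HasSum (fun α => (Nat.card {r : Fin k → κ // tupleCount r = α} : ℝ) * f α) S := by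
    refine h.sigma fun α => ?_
    have := Fintype.ofFinite {r : Fin k → κ // tupleCount r = α}
    have h3 := hasSum_fintype fun _ : {r : Fin k → κ // tupleCount r = α} => f α
    rw [Finset.sum_const, nsmul_eq_mul, Finset.card_univ, ← Nat.card_eq_fintype_card] at h3
    refine h3.congr_fun fun r => ?_
    simp [Equiv.sigmaFiberEquiv, r.2]
  rw [← hasSum_subtype_iff_of_support_subset (s := {α : κ →₀ ℕ | α.degree = k})] at h2
  · refine h2.congr_fun fun α => ?_
    have hp : ((α : κ →₀ ℕ).prod fun _ n => (n ! : ℝ)) ≠ 0 :=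
      Finset.prod_ne_zero_iff.mpr fun p _ => by positivity
    have hc := card_tupleCount_mul k α.1 α.2
    have hc' : (Nat.card {r : Fin k → κ // tupleCount r = α.1} : ℝ)
        * ((α : κ →₀ ℕ).prod fun _ n => (n ! : ℝ)) = k ! := by
      rw [← hc, Nat.cast_mul]
      congr 1
      simp [Finsupp.prod]
    rw [← hc']
    simp only [Function.comp_apply]
    field_simp
  · intro α hα
    by_contra hk
    refine hα ?_
    have : IsEmpty {r : Fin k → κ // tupleCount r = α} :=
      ⟨fun r => hk (by rw [← r.2]; exact degree_tupleCount r.1)⟩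
    simp

end Combinatorics

/-! ### The orthonormal family of normalized Hermite products -/

section ChaosBasis

variable {Ω : Type*} [MeasurableSpace Ω] {P : Measure Ω} [IsProbabilityMeasure P]
  {𝓗 : Type*} [NormedAddCommGroup 𝓗] [InnerProductSpace ℝ 𝓗] {κ : Type*}

/-- The normalized Hermite products as elements of `L²(P)`. -/
noncomputable def chaosBasis (I : 𝓗 →L[ℝ] Lp ℝ 2 P) (b : κ → 𝓗) (α : κ →₀ ℕ) : Lp ℝ 2 P :=
  toL2 P fun ω => (1 / √(α.prod fun _ n => (n ! : ℝ))) * polyEval I (hermiteProd b α) ω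

namespace IsIsonormal

variable {I : 𝓗 →L[ℝ] Lp ℝ 2 P} (hI : IsIsonormal I) {b : κ → 𝓗}
include hI

theorem coeFn_chaosBasis (b : κ → 𝓗) (α : κ →₀ ℕ) : chaosBasis I b α =ᵐ[P] fun ω =>
    (1 / √(α.prod fun _ n => (n ! : ℝ))) * polyEval I (hermiteProd b α) ω :=
  coeFn_toL2 ((hI.memLp_polyEval _).const_mul _)

theorem orthonormal_chaosBasis (hb : Orthonormal ℝ b) : Orthonormal ℝ (chaosBasis I b) := by
  classical
  rw [orthonormal_iff_ite]
  intro α β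
  have h1 : ⟪chaosBasis I b α, chaosBasis I b β⟫_ℝ
      = (1 / √(α.prod fun _ n => (n ! : ℝ))) * ((1 / √(β.prod fun _ n => (n ! : ℝ)))
        * ∫ ω, polyEval I (hermiteProd b β * hermiteProd b α) ω ∂P) := by
    rw [L2.inner_def, ← integral_const_mul, ← integral_const_mul]
    refine integral_congr_ae ?_
    filter_upwards [hI.coeFn_chaosBasis b α, hI.coeFn_chaosBasis b β] with ω h1 h2
    rw [h1, h2, polyEval_mul]
    simp
    ring
  rw [h1, hI.integral_polyEval_hermiteProd_mul hb]
  split_ifs with h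
  · subst h
    have hp : 0 < α.prod fun _ n => (n ! : ℝ) := Finset.prod_pos fun p _ => by positivity
    have := Real.sq_sqrt hp.le
    have hs : √(α.prod fun _ n => (n ! : ℝ)) ≠ 0 := (Real.sqrt_pos.mpr hp).ne'
    field_simp
    exact this.symm
  · simp

theorem integral_inner_mul_hermiteProd {H : Type*} [NormedAddCommGroup H] [InnerProductSpace ℝ H]
    [CompleteSpace H] (b : κ → 𝓗) (α : κ →₀ ℕ) (F : Lp H 2 P) (x : H) :
    ∫ ω, ⟪x, F ω⟫_ℝ * polyEval I (hermiteProd b α) ω ∂P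
      = √(α.prod fun _ n => (n ! : ℝ)) * ⟪x, coefLp (chaosBasis I b α) F⟫_ℝ := by
  rw [← inner_tensorLp_left, L2.inner_def, ← integral_const_mul]
  refine integral_congr_ae ?_
  filter_upwards [hI.coeFn_chaosBasis b α, coeFn_tensorLp (chaosBasis I b α) x] with ω h1 h2
  have hp : 0 < α.prod fun _ n => (n ! : ℝ) := Finset.prod_pos fun p _ => by positivity
  have hs : √(α.prod fun _ n => (n ! : ℝ)) ≠ 0 := (Real.sqrt_pos.mpr hp).ne'
  rw [h2, h1, real_inner_smul_left]
  field_simp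

/-- An `H`-valued square-integrable random variable that is measurable for the isonormal family
vanishes if all its chaos coefficients vanish. -/
theorem eq_zero_of_coefLp_eq_zero
    {Z : Type*} [NormedAddCommGroup Z] [InnerProductSpace ℝ Z] [CompleteSpace Z]
    [TopologicalSpace.SeparableSpace Z] [MeasurableSpace Z] [BorelSpace Z] {T : ℝ}
    {W : Set.Icc (0 : ℝ) T → Ω → Z} (hW : ∀ t, Measurable (W t))
    (hWI : ∀ t z, ∃ h : 𝓗, I h =ᵐ[P] fun ω => ⟪W t ω, z⟫_ℝ)
    {H : Type*} [NormedAddCommGroup H] [InnerProductSpace ℝ H]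
    [CompleteSpace H] [TopologicalSpace.SeparableSpace H]
    (b : HilbertBasis κ ℝ 𝓗) (F : Lp H 2 P) (hF : AEStronglyMeasurable[sigmaW W] F P)
    (h0 : ∀ α, coefLp (chaosBasis I b α) F = 0) : F = 0 := by
  have : SecondCountableTopology H := UniformSpace.secondCountable_of_separable H
  -- Since `H` is separable, it suffices to treat the scalar variables `⟪x, F⟫`, to which scalar
  -- totality applies.
  refine (Lp.eq_zero_iff_ae_eq_zero).mpr (ae_eq_zero_of_forall_inner (𝕜 := ℝ) fun x => ?_)
  have hm : MemLp (fun ω => ⟪x, F ω⟫_ℝ) 2 P := (Lp.memLp F).const_inner x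
  have hY := hI.ae_eq_zero_of_integral_mul_hermiteProd hW hWI b (hm.toLp) ?_ ?_
  · exact (hm.coeFn_toLp.symm).trans ((Lp.eq_zero_iff_ae_eq_zero).mp hY)
  · refine AEStronglyMeasurable.congr ?_ hm.coeFn_toLp.symm
    exact (innerSL ℝ x).continuous.comp_aestronglyMeasurable hF
  · intro α
    have := hI.integral_inner_mul_hermiteProd b α F x
    rw [h0, inner_zero_right, mul_zero] at this
    rw [← this]
    refine integral_congr_ae ?_
    filter_upwards [hm.coeFn_toLp] with ω hω
    rw [hω]

end IsIsonormal

end ChaosBasis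

/-! ### The dual as a Hilbert space and inner products of elementary tensors -/

section DualInner

variable {E : Type*} [NormedAddCommGroup E] [InnerProductSpace ℝ E] [CompleteSpace E]

/-- The inner product of the dual of a Hilbert space. -/
noncomputable instance strongDualInnerProductSpace : InnerProductSpace ℝ (StrongDual ℝ E) where
  toNormedSpace := inferInstance
  inner l m := ⟪(InnerProductSpace.toDual ℝ E).symm l, (InnerProductSpace.toDual ℝ E).symm m⟫_ℝ
  norm_sq_eq_re_inner l := by
    rw [← (InnerProductSpace.toDual ℝ E).symm.norm_map l]
    exact norm_sq_eq_re_inner (𝕜 := ℝ) _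
  conj_inner_symm l m := inner_conj_symm (𝕜 := ℝ) _ _
  add_left l m n := by rw [map_add, inner_add_left]
  smul_left l m c := by rw [map_smulₛₗ, inner_smul_left]; rfl

theorem strongDual_inner_eq (l m : StrongDual ℝ E) :
    ⟪l, m⟫_ℝ = ⟪(InnerProductSpace.toDual ℝ E).symm l, (InnerProductSpace.toDual ℝ E).symm m⟫_ℝ :=
  rfl

theorem strongDual_inner_toDual (x y : E) :
    ⟪InnerProductSpace.toDual ℝ E x, InnerProductSpace.toDual ℝ E y⟫_ℝ = ⟪x, y⟫_ℝ := by
  rw [strongDual_inner_eq, LinearIsometryEquiv.symm_apply_apply,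
    LinearIsometryEquiv.symm_apply_apply]

theorem HilbertBasis.hasSum_strongDual_mul {A : Type*} (b : HilbertBasis A ℝ E)
    (l m : StrongDual ℝ E) : HasSum (fun a => l (b a) * m (b a)) ⟪l, m⟫_ℝ := by
  refine (b.hasSum_inner_mul_inner ((InnerProductSpace.toDual ℝ E).symm l)
    ((InnerProductSpace.toDual ℝ E).symm m)).congr_fun fun a => ?_
  rw [InnerProductSpace.toDual_symm_apply, real_inner_comm, InnerProductSpace.toDual_symm_apply]

variable {H : Type*} [NormedAddCommGroup H] [InnerProductSpace ℝ H] {k : ℕ}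

theorem HS.ext {Ξ Θ : HS k E H} (h : ∀ z, HS.toCMM k E H Ξ z = HS.toCMM k E H Θ z) : Ξ = Θ :=
  Subtype.ext (ContinuousMultilinearMap.ext h)

/-- The sum over tuples of basis vectors factors into one Parseval sum for each slot. -/
theorem HS.inner_tensor_tensor (l m : Fin k → StrongDual ℝ E) (x y : H) :
    ⟪HS.tensor l x, HS.tensor m y⟫_ℝ = (∏ i, ⟪l i, m i⟫_ℝ) * ⟪x, y⟫_ℝ := by
  have h := (hasSum_prod_pi k fun i =>
    HilbertBasis.hasSum_strongDual_mul (stdBasis E) (l i) (m i)).mul_right ⟪x, y⟫_ℝ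
  rw [HS.inner_eq_tsum, ← h.tsum_eq]
  refine tsum_congr fun r => ?_
  rw [HS.tensor_apply, HS.tensor_apply, real_inner_smul_left, real_inner_smul_right,
    Finset.prod_mul_distrib]
  ring

theorem HS.norm_tensor (l : Fin k → StrongDual ℝ E) (x : H) :
    ‖HS.tensor l x‖ = (∏ i, ‖l i‖) * ‖x‖ := by
  rw [← sq_eq_sq₀ (norm_nonneg _) (by positivity), ← real_inner_self_eq_norm_sq,
    HS.inner_tensor_tensor, real_inner_self_eq_norm_sq, mul_pow, ← Finset.prod_pow]
  simp_rw [real_inner_self_eq_norm_sq]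

/-- The map is multilinear and bounded by `HS.norm_tensor`; its continuity makes tensor kernels
measurable. -/
theorem HS.continuous_tensor (x : H) :
    Continuous fun l : Fin k → StrongDual ℝ E => HS.tensor l x := by
  let M : MultilinearMap ℝ (fun _ : Fin k => StrongDual ℝ E) (HS k E H) :=
    { toFun := fun l => HS.tensor l x
      map_update_add' := fun {_} l i u v => HS.ext fun z => by
        rw [map_add, _root_.add_apply]
        simp only [HS.tensor_apply, ← add_smul]
        congr 1
        rw [Fintype.prod_eq_mul_prod_compl i, Fintype.prod_eq_mul_prod_compl i,
          Fintype.prod_eq_mul_prod_compl i]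
        simp only [Function.update_self, _root_.add_apply]
        rw [add_mul]
        congr 2 <;>
        · refine Finset.prod_congr rfl fun j hj => ?_
          have : j ≠ i := by simpa using hj
          simp [this]
      map_update_smul' := fun {_} l i c u => HS.ext fun z => by
        rw [map_smul, _root_.smul_apply]
        simp only [HS.tensor_apply, smul_smul]
        congr 1
        rw [Fintype.prod_eq_mul_prod_compl i, Fintype.prod_eq_mul_prod_compl i]
        simp only [Function.update_self, _root_.smul_apply, smul_eq_mul]
        rw [mul_assoc]
        congr 2
        refine Finset.prod_congr rfl fun j hj => ?_
        have : j ≠ i := by simpa using hj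
        simp [this] }
  exact (M.mkContinuous ‖x‖ fun l => by
    change ‖HS.tensor l x‖ ≤ _
    rw [HS.norm_tensor, mul_comm]).cont

end DualInner

/-- Simple approximations are taken coordinatewise, so that no separability of `E` is required. -/
theorem stronglyMeasurable_pi_of_fintype {ι α E : Type*} [Fintype ι] [MeasurableSpace α]
    [TopologicalSpace E] {f : ι → α → E} (hf : ∀ i, StronglyMeasurable (f i)) :
    StronglyMeasurable fun a i => f i a := by
  classical
  refine ⟨fun n => ⟨fun a i => (hf i).approx n a, fun y => ?_, ?_⟩, fun a => ?_⟩
  · have : (fun (a : α) i => (hf i).approx n a) ⁻¹' {y}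
        = ⋂ i, (hf i).approx n ⁻¹' {y i} := by
      ext a
      simp [funext_iff]
    rw [this]
    exact MeasurableSet.iInter fun i => SimpleFunc.measurableSet_fiber _ _
  · refine (Set.Finite.pi' fun i => ((hf i).approx n).finite_range).subset ?_
    rintro _ ⟨a, rfl⟩ i
    exact ⟨a, rfl⟩
  · exact tendsto_pi_nhds.mpr fun i => (hf i).tendsto_approx a

/-! ### Tensor kernels on the cube -/

section TensorKernel

instance isFiniteMeasure_timeMeasure (T : ℝ) : IsFiniteMeasure (timeMeasure T) := by
  refine ⟨?_⟩
  rw [timeMeasure, (MeasurableEmbedding.subtype_coe measurableSet_Icc).comap_apply, Set.image_univ,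
    Subtype.range_coe]
  exact measure_Icc_lt_top

variable {Z : Type*} [NormedAddCommGroup Z] [InnerProductSpace ℝ Z] [CompleteSpace Z] {T : ℝ}
  {Q : Z →L[ℝ] Z} {H : Type*} [NormedAddCommGroup H] [InnerProductSpace ℝ H] {k : ℕ}

theorem memLp_tensor (ψ : Fin k → Lp (StrongDual ℝ (CMSpace Q)) 2 (timeMeasure T)) (x : H) :
    MemLp (fun s => HS.tensor (fun l => ψ l (s l)) x) 2 (cubeMeasure T k) := by
  have hm : StronglyMeasurable fun s : Fin k → Set.Icc (0 : ℝ) T =>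
      HS.tensor (fun l => ψ l (s l)) x :=
    (HS.continuous_tensor x).comp_stronglyMeasurable (stronglyMeasurable_pi_of_fintype fun l =>
      (Lp.stronglyMeasurable (ψ l)).comp_measurable (measurable_pi_apply l))
  rw [memLp_two_iff_integrable_sq_norm hm.aestronglyMeasurable]
  have h := (Integrable.fintype_prod (𝕜 := ℝ) (μ := fun _ : Fin k => timeMeasure T)
    (f := fun l s => ‖ψ l s‖ ^ 2) fun l =>
      (memLp_two_iff_integrable_sq_norm (Lp.aestronglyMeasurable (ψ l))).mp (Lp.memLp (ψ l))
    ).mul_const (‖x‖ ^ 2)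
  refine h.congr (Filter.Eventually.of_forall fun s => ?_)
  simp only [HS.norm_tensor, mul_pow, Finset.prod_pow]

/-- The pointwise inner product is a product of functions of separate time variables, so Fubini
splits the integral. -/
theorem inner_tensorKernel_tensorKernel
    (ψ χ : Fin k → Lp (StrongDual ℝ (CMSpace Q)) 2 (timeMeasure T)) (x y : H) :
    ⟪tensorKernel Q ψ x, tensorKernel Q χ y⟫_ℝ = (∏ l, ⟪ψ l, χ l⟫_ℝ) * ⟪x, y⟫_ℝ := by
  rw [L2.inner_def]
  have h : ∫ s, (∏ l, ⟪ψ l (s l), χ l (s l)⟫_ℝ) * ⟪x, y⟫_ℝ ∂(cubeMeasure T k)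
      = (∏ l, ⟪ψ l, χ l⟫_ℝ) * ⟪x, y⟫_ℝ := by
    rw [integral_mul_const, cubeMeasure,
      integral_fintype_prod_eq_prod (fun l s => ⟪ψ l s, χ l s⟫_ℝ)]
    rfl
  rw [← h]
  refine integral_congr_ae ?_
  filter_upwards [coeFn_toL2 (memLp_tensor ψ x), coeFn_toL2 (memLp_tensor χ y)] with s h1 h2
  rw [tensorKernel, tensorKernel, h1, h2, HS.inner_tensor_tensor]

end TensorKernel

/-! ### Directional and partial derivatives, and the scalar Stroock formula -/

section StroockScalar

variable {𝓗 : Type*} [NormedAddCommGroup 𝓗] [InnerProductSpace ℝ 𝓗]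

theorem dirDeriv_rename {N : ℕ} (ψ : Fin N → 𝓗) (h : 𝓗) (q : MvPolynomial (Fin N) ℝ) :
    dirDeriv h (MvPolynomial.rename ψ q)
      = ∑ m, ⟪ψ m, h⟫_ℝ • MvPolynomial.rename ψ (MvPolynomial.pderiv m q) := by
  induction q using MvPolynomial.induction_on with
  | C a =>
    rw [MvPolynomial.rename_C, ← MvPolynomial.algebraMap_eq, Derivation.map_algebraMap]
    simp
  | add p q hp hq => simp only [map_add, hp, hq, smul_add, Finset.sum_add_distrib]
  | mul_X q i hq =>
    rw [map_mul, Derivation.leibniz, hq, MvPolynomial.rename_X, dirDeriv_X]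
    have : ∀ m, MvPolynomial.rename ψ (MvPolynomial.pderiv m (q * MvPolynomial.X i))
        = (if m = i then MvPolynomial.rename ψ q else 0)
          + MvPolynomial.X (ψ i) * MvPolynomial.rename ψ (MvPolynomial.pderiv m q) := by
      intro m
      rw [Derivation.leibniz, MvPolynomial.pderiv_X, smul_eq_mul, smul_eq_mul, map_add, map_mul,
        map_mul, MvPolynomial.rename_X]
      congr 1
      by_cases h : m = i
      · subst h; simp
      · simp [h, Ne.symm h]
    simp_rw [this, smul_add, Finset.sum_add_distrib, smul_ite, smul_zero, Finset.sum_ite_eq',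
      Finset.mem_univ, if_true, smul_eq_mul, Finset.mul_sum, mul_smul_comm]
    rw [mul_comm, ← MvPolynomial.smul_eq_C_mul]

/-- Iterating the chain rule identifies the successive directional derivatives with the pairing of
the algebraic `Dᵏq` with `h₁ ⊗ ⋯ ⊗ h_k`. -/
theorem foldr_dirDeriv_rename {N k : ℕ} (ψ : Fin N → 𝓗) (h : Fin k → 𝓗)
    (q : MvPolynomial (Fin N) ℝ) :
    (List.ofFn h).foldr (fun g p => dirDeriv g p) (MvPolynomial.rename ψ q)
      = ∑ n : Fin k → Fin N,
        (∏ l, ⟪ψ (n l), h l⟫_ℝ) • MvPolynomial.rename ψ (iterPderiv n q) := by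
  induction k with
  | zero => simp [iterPderiv]
  | succ k ih =>
    rw [List.ofFn_succ, List.foldr_cons, ih, map_sum]
    rw [← (Fin.consEquiv fun _ : Fin (k + 1) => Fin N).sum_comp, Fintype.sum_prod_type_right]
    refine Finset.sum_congr rfl fun n _ => ?_
    rw [Derivation.map_smul, dirDeriv_rename, Finset.smul_sum]
    refine Finset.sum_congr rfl fun m _ => ?_
    rw [smul_smul, Fin.prod_univ_succ, mul_comm]
    simp [Fin.consEquiv, iterPderiv, List.ofFn_succ]

variable {Ω : Type*} [MeasurableSpace Ω] {P : Measure Ω} [IsProbabilityMeasure P] {κ : Type*}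
  {I : 𝓗 →L[ℝ] Lp ℝ 2 P}

/-- The scalar Stroock formula for polynomials. -/
theorem IsIsonormal.sum_prod_mul_integral_iterPderiv (hI : IsIsonormal I) {b : κ → 𝓗}
    (hb : Orthonormal ℝ b) {N k : ℕ} (ψ : Fin N → 𝓗) (q : MvPolynomial (Fin N) ℝ)
    (r : Fin k → κ) :
    ∑ n : Fin k → Fin N, (∏ l, ⟪ψ (n l), b (r l)⟫_ℝ)
        * ∫ ω, polyEval I (MvPolynomial.rename ψ (iterPderiv n q)) ω ∂P
      = ∫ ω, polyEval I (MvPolynomial.rename ψ q) ω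
          * polyEval I (hermiteProd b (tupleCount r)) ω ∂P := by
  have h1 := hI.integral_polyEval_mul_hermiteProd_list hb (List.ofFn r)
    (MvPolynomial.rename ψ q)
  have h2 : ((List.ofFn r).map fun p => Finsupp.single p 1).sum = tupleCount r := by
    rw [List.map_ofFn, List.sum_ofFn]
    rfl
  have h3 : (List.ofFn r).foldr (fun p q => dirDeriv (b p) q) (MvPolynomial.rename ψ q)
      = (List.ofFn fun l => b (r l)).foldr (fun g p => dirDeriv g p)
        (MvPolynomial.rename ψ q) := by
    rw [← List.foldr_map (f := b) (g := fun g p => dirDeriv g p), List.map_ofFn]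
    rfl
  rw [h2, h3, foldr_dirDeriv_rename] at h1
  simp_rw [polyEval_mul] at h1
  rw [h1]
  have h4 : ∀ ω, polyEval I (∑ n : Fin k → Fin N, (∏ l, ⟪ψ (n l), b (r l)⟫_ℝ)
      • MvPolynomial.rename ψ (iterPderiv n q)) ω
      = ∑ n : Fin k → Fin N, (∏ l, ⟪ψ (n l), b (r l)⟫_ℝ)
        * polyEval I (MvPolynomial.rename ψ (iterPderiv n q)) ω := by
    intro ω
    simp [polyEval, MvPolynomial.smul_eval]
  simp_rw [h4]
  rw [integral_finsetSum _ fun n _ => (hI.integrable_polyEval _).const_mul _]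
  exact Finset.sum_congr rfl fun n _ => (integral_const_mul _ _).symm

end StroockScalar

/-! ### Means as coefficients along the constant `1` -/

section Mean

variable {Ω : Type*} [MeasurableSpace Ω] {P : Measure Ω} [IsProbabilityMeasure P]
  {E : Type*} [NormedAddCommGroup E] [InnerProductSpace ℝ E]

theorem tensorLp_const_one (x : E) : tensorLp (Lp.const 2 P (1 : ℝ)) x = Lp.const 2 P x := by
  refine Lp.ext ?_
  filter_upwards [coeFn_tensorLp (Lp.const 2 P (1 : ℝ)) x, Lp.coeFn_const 2 P (1 : ℝ),
    Lp.coeFn_const 2 P x] with ω h1 h2 h3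
  rw [h1, h2, h3]
  simp

omit [IsProbabilityMeasure P] in
theorem toL2_smul_const {f : Ω → ℝ} (hf : MemLp f 2 P) (x : E) :
    toL2 P (fun ω => f ω • x) = tensorLp (toL2 P f) x := by
  have h : (fun ω => f ω • x) =ᵐ[P] tensorLp (toL2 P f) x := by
    filter_upwards [coeFn_tensorLp (toL2 P f) x, coeFn_toL2 hf] with ω h1 h2
    rw [h1, h2]
  rw [toL2_congr h, toL2_coeFn]

theorem inner_const_one_toL2 {f : Ω → ℝ} (hf : MemLp f 2 P) :
    ⟪Lp.const 2 P (1 : ℝ), toL2 P f⟫_ℝ = ∫ ω, f ω ∂P := by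
  rw [L2.inner_def]
  refine integral_congr_ae ?_
  filter_upwards [coeFn_toL2 hf, Lp.coeFn_const 2 P (1 : ℝ)] with ω h1 h2
  rw [h1, h2]
  simp

theorem integral_eq_coefLp (F : Lp E 2 P) : ∫ ω, F ω ∂P = coefLp (Lp.const 2 P (1 : ℝ)) F := by
  refine integral_congr_ae ?_
  filter_upwards [Lp.coeFn_const 2 P (1 : ℝ)] with ω h2
  rw [h2]
  simp

end Mean

/-! ### The bilinear identity for polynomial variables -/

section Pairing

variable {Ω : Type*} [MeasurableSpace Ω] {P : Measure Ω} [IsProbabilityMeasure P]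
  {Z : Type*} [NormedAddCommGroup Z] [InnerProductSpace ℝ Z] [CompleteSpace Z] {T : ℝ}
  {Q : Z →L[ℝ] Z} {W : Set.Icc (0 : ℝ) T → Ω → Z}
  {H : Type*} [NormedAddCommGroup H] [InnerProductSpace ℝ H]

omit [IsProbabilityMeasure P] in
theorem eval_wienerIntegral {N : ℕ} (q : MvPolynomial (Fin N) ℝ)
    (ψ : Fin N → Lp (StrongDual ℝ (CMSpace Q)) 2 (timeMeasure T)) (ω : Ω) :
    MvPolynomial.eval (fun m => wienerIntegral Q W P (ψ m) ω) q
      = polyEval (wienerIntegral Q W P) (MvPolynomial.rename ψ q) ω := by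
  rw [polyEval, MvPolynomial.eval_rename]
  rfl

variable (hI : IsIsonormal (wienerIntegral Q W P))
include hI

theorem polyVar_eq_tensorLp {N : ℕ} (q : MvPolynomial (Fin N) ℝ)
    (ψ : Fin N → Lp (StrongDual ℝ (CMSpace Q)) 2 (timeMeasure T)) (x : H) :
    polyVar Q W P q ψ x
      = tensorLp (toL2 P (polyEval (wienerIntegral Q W P) (MvPolynomial.rename ψ q))) x := by
  rw [← toL2_smul_const (hI.memLp_polyEval _)]
  simp_rw [polyVar, eval_wienerIntegral]

theorem polyDeriv_eq_sum {N : ℕ} (q : MvPolynomial (Fin N) ℝ)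
    (ψ : Fin N → Lp (StrongDual ℝ (CMSpace Q)) 2 (timeMeasure T)) (x : H) (k : ℕ) :
    polyDeriv Q W P q ψ x k = ∑ n : Fin k → Fin N,
      tensorLp (toL2 P (polyEval (wienerIntegral Q W P)
        (MvPolynomial.rename ψ (iterPderiv n q)))) (tensorKernel Q (fun l => ψ (n l)) x) := by
  set S : RandomKernel Q T P H k := ∑ n : Fin k → Fin N,
    tensorLp (toL2 P (polyEval (wienerIntegral Q W P)
      (MvPolynomial.rename ψ (iterPderiv n q)))) (tensorKernel Q (fun l => ψ (n l)) x) with hS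
  have h : (fun ω => ∑ n : Fin k → Fin N,
      MvPolynomial.eval (fun m => wienerIntegral Q W P (ψ m) ω) (iterPderiv n q) •
        tensorKernel Q (fun l => ψ (n l)) x) =ᵐ[P] S := by
    refine Filter.EventuallyEq.trans ?_ (Lp.coeFn_fun_finsetSum _ _).symm
    have h1 : ∀ᵐ ω ∂P, ∀ n : Fin k → Fin N,
        tensorLp (toL2 P (polyEval (wienerIntegral Q W P) (MvPolynomial.rename ψ
          (iterPderiv n q)))) (tensorKernel Q (fun l => ψ (n l)) x) ω
        = polyEval (wienerIntegral Q W P) (MvPolynomial.rename ψ (iterPderiv n q)) ω •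
          tensorKernel Q (fun l => ψ (n l)) x := by
      refine ae_all_iff.mpr fun n => ?_
      filter_upwards [coeFn_tensorLp (toL2 P (polyEval (wienerIntegral Q W P)
        (MvPolynomial.rename ψ (iterPderiv n q)))) (tensorKernel Q (fun l => ψ (n l)) x),
        coeFn_toL2 (hI.memLp_polyEval (MvPolynomial.rename ψ (iterPderiv n q)))] with ω h1 h2
      rw [h1, h2]
    filter_upwards [h1] with ω hω
    simp_rw [hω, eval_wienerIntegral]
  rw [polyDeriv, toL2_congr h, toL2_coeFn]

variable [CompleteSpace H]

theorem coefLp_one_polyDeriv {N : ℕ} (q : MvPolynomial (Fin N) ℝ)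
    (ψ : Fin N → Lp (StrongDual ℝ (CMSpace Q)) 2 (timeMeasure T)) (x : H) (k : ℕ) :
    coefLp (Lp.const 2 P (1 : ℝ)) (polyDeriv Q W P q ψ x k) = ∑ n : Fin k → Fin N,
      (∫ ω, polyEval (wienerIntegral Q W P) (MvPolynomial.rename ψ (iterPderiv n q)) ω ∂P) •
        tensorKernel Q (fun l => ψ (n l)) x := by
  rw [polyDeriv_eq_sum hI, coefLp_eq_adjoint, map_sum]
  refine Finset.sum_congr rfl fun n _ => ?_
  rw [← coefLp_eq_adjoint, coefLp_tensorLp, inner_const_one_toL2 (hI.memLp_polyEval _)]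

variable {κ : Type*}

theorem coefLp_chaosBasis_polyVar
    (b : κ → Lp (StrongDual ℝ (CMSpace Q)) 2 (timeMeasure T)) (α : κ →₀ ℕ) {N : ℕ}
    (q : MvPolynomial (Fin N) ℝ) (ψ : Fin N → Lp (StrongDual ℝ (CMSpace Q)) 2 (timeMeasure T))
    (x : H) :
    coefLp (chaosBasis (wienerIntegral Q W P) b α) (polyVar Q W P q ψ x)
      = ((1 / √(α.prod fun _ n => (n ! : ℝ))) * ∫ ω, polyEval (wienerIntegral Q W P)
        (MvPolynomial.rename ψ q) ω * polyEval (wienerIntegral Q W P) (hermiteProd b α) ω ∂P)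
        • x := by
  rw [polyVar_eq_tensorLp hI, coefLp_tensorLp]
  congr 1
  rw [L2.inner_def, ← integral_const_mul]
  refine integral_congr_ae ?_
  filter_upwards [hI.coeFn_chaosBasis b α, coeFn_toL2 (hI.memLp_polyEval
    (MvPolynomial.rename ψ q))] with ω h1 h2
  rw [h1, h2]
  simp
  ring

omit hI [CompleteSpace H] in
/-- The projection onto the chaos of order `k` spanned by the normalized Hermite products. -/
noncomputable def chaosPart (I : Lp (StrongDual ℝ (CMSpace Q)) 2 (timeMeasure T) →L[ℝ] Lp ℝ 2 P)
    (b : κ → Lp (StrongDual ℝ (CMSpace Q)) 2 (timeMeasure T)) (k : ℕ) (F : Lp H 2 P) : Lp H 2 P :=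
  ∑' α : {α : κ →₀ ℕ // α.degree = k}, tensorLp (chaosBasis I b α) (coefLp (chaosBasis I b α) F)

theorem hasSum_inner_chaosPart {b : κ → Lp (StrongDual ℝ (CMSpace Q)) 2 (timeMeasure T)}
    (hb : Orthonormal ℝ b) (k : ℕ) (F G : Lp H 2 P) :
    HasSum (fun α : {α : κ →₀ ℕ // α.degree = k} =>
      ⟪coefLp (chaosBasis (wienerIntegral Q W P) b α) F,
        coefLp (chaosBasis (wienerIntegral Q W P) b α) G⟫_ℝ)
      ⟪F, chaosPart (wienerIntegral Q W P) b k G⟫_ℝ :=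
  hasSum_inner_coefLp ((hI.orthonormal_chaosBasis hb).comp
    (fun α : {α : κ →₀ ℕ // α.degree = k} => α.1) Subtype.val_injective) F G

/-- Self-adjointness of the projection; it lets the two arguments of the bilinear identity be
exchanged. -/
theorem inner_chaosPart_comm {b : κ → Lp (StrongDual ℝ (CMSpace Q)) 2 (timeMeasure T)}
    (hb : Orthonormal ℝ b) (k : ℕ) (F G : Lp H 2 P) :
    ⟪F, chaosPart (wienerIntegral Q W P) b k G⟫_ℝ
      = ⟪G, chaosPart (wienerIntegral Q W P) b k F⟫_ℝ := by
  refine (hasSum_inner_chaosPart hI hb k F G).unique ?_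
  refine (hasSum_inner_chaosPart hI hb k G F).congr_fun fun α => ?_
  rw [real_inner_comm]

/-- Both sides are sums of the same products of Hermite coefficients: the left one over `k`-tuples
by Parseval in `𝓗^{⊗k}`, the right one over multi-indices of degree `k`. -/
theorem inner_coefLp_polyDeriv (b : HilbertBasis κ ℝ (Lp (StrongDual ℝ (CMSpace Q)) 2
    (timeMeasure T))) (k : ℕ) {N M : ℕ} (q : MvPolynomial (Fin N) ℝ)
    (ψ : Fin N → Lp (StrongDual ℝ (CMSpace Q)) 2 (timeMeasure T)) (x : H)
    (q' : MvPolynomial (Fin M) ℝ)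
    (ψ' : Fin M → Lp (StrongDual ℝ (CMSpace Q)) 2 (timeMeasure T)) (y : H) :
    ⟪coefLp (Lp.const 2 P (1 : ℝ)) (polyDeriv Q W P q ψ x k),
        coefLp (Lp.const 2 P (1 : ℝ)) (polyDeriv Q W P q' ψ' y k)⟫_ℝ
      = (k ! : ℝ) * ⟪polyVar Q W P q ψ x,
        chaosPart (wienerIntegral Q W P) b k (polyVar Q W P q' ψ' y)⟫_ℝ := by
  set I := wienerIntegral Q W P with hIdef
  let c : (Fin k → Fin N) → ℝ := fun n =>
    ∫ ω, polyEval I (MvPolynomial.rename ψ (iterPderiv n q)) ω ∂P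
  let d : (Fin k → Fin M) → ℝ := fun n =>
    ∫ ω, polyEval I (MvPolynomial.rename ψ' (iterPderiv n q')) ω ∂P
  let f : (κ →₀ ℕ) → ℝ := fun α =>
    (∫ ω, polyEval I (MvPolynomial.rename ψ q) ω * polyEval I (hermiteProd b α) ω ∂P)
      * (∫ ω, polyEval I (MvPolynomial.rename ψ' q') ω * polyEval I (hermiteProd b α) ω ∂P)
      * ⟪x, y⟫_ℝ
  have h1 : HasSum (fun r : Fin k → κ => f (tupleCount r))
      ⟪coefLp (Lp.const 2 P (1 : ℝ)) (polyDeriv Q W P q ψ x k),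
        coefLp (Lp.const 2 P (1 : ℝ)) (polyDeriv Q W P q' ψ' y k)⟫_ℝ := by
    have e1 : ⟪coefLp (Lp.const 2 P (1 : ℝ)) (polyDeriv Q W P q ψ x k),
        coefLp (Lp.const 2 P (1 : ℝ)) (polyDeriv Q W P q' ψ' y k)⟫_ℝ
        = ∑ n : Fin k → Fin N, ∑ m : Fin k → Fin M,
          c n * d m * ⟪x, y⟫_ℝ * ∏ l, ⟪ψ (n l), ψ' (m l)⟫_ℝ := by
      rw [coefLp_one_polyDeriv hI, coefLp_one_polyDeriv hI, sum_inner]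
      refine Finset.sum_congr rfl fun n _ => ?_
      rw [inner_sum]
      refine Finset.sum_congr rfl fun m _ => ?_
      rw [real_inner_smul_left, real_inner_smul_right, inner_tensorKernel_tensorKernel]
      simp only [c, d, hIdef]
      ring
    rw [e1]
    -- Parseval in each of the `k` slots turns every product of inner products into a sum over
    -- tuples of basis vectors.
    have e2 := hasSum_sum (s := Finset.univ) fun (n : Fin k → Fin N) _ =>
      hasSum_sum (s := Finset.univ) fun (m : Fin k → Fin M) _ =>
        (hasSum_prod_pi k fun l => b.hasSum_inner_mul_inner (ψ (n l)) (ψ' (m l))).mul_left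
          (c n * d m * ⟪x, y⟫_ℝ)
    refine e2.congr_fun fun r => ?_
    simp only [f]
    rw [← hI.sum_prod_mul_integral_iterPderiv b.orthonormal,
      ← hI.sum_prod_mul_integral_iterPderiv b.orthonormal, Finset.sum_mul_sum, Finset.sum_mul]
    refine Finset.sum_congr rfl fun n _ => ?_
    rw [Finset.sum_mul]
    refine Finset.sum_congr rfl fun m _ => ?_
    rw [Finset.prod_mul_distrib]
    simp_rw [real_inner_comm (b _)]
    simp only [c, d]
    ring
  refine (hasSum_degree_of_hasSum_tuple h1).unique ?_
  refine ((hasSum_inner_chaosPart hI b.orthonormal k (polyVar Q W P q ψ x)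
    (polyVar Q W P q' ψ' y)).mul_left _).congr_fun fun α => ?_
  rw [coefLp_chaosBasis_polyVar hI, coefLp_chaosBasis_polyVar hI, real_inner_smul_left,
    real_inner_smul_right]
  have hp : 0 ≤ (α : κ →₀ ℕ).prod fun _ n => (n ! : ℝ) :=
    (Finset.prod_pos fun p _ => by positivity).le
  -- The weight `1/α!` splits into the two normalizations `1/√α!` of the chaos coefficients.
  nth_rw 1 [← Real.mul_self_sqrt hp]
  simp only [f, one_div, mul_inv, ← hIdef]
  ring

end Pairing

/-! ### Pairing with a deterministic element -/

section Mean

variable {Ω : Type*} [MeasurableSpace Ω] {P : Measure Ω}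

theorem sigmaW_le {Z : Type*} [NormedAddCommGroup Z] [InnerProductSpace ℝ Z] [MeasurableSpace Z]
    {T : ℝ} {W : Set.Icc (0 : ℝ) T → Ω → Z} (hW : ∀ t, Measurable (W t)) :
    sigmaW W ≤ (inferInstance : MeasurableSpace Ω) :=
  iSup_le fun t => (hW t).comap_le

theorem polyEval_smul' {𝓗 : Type*} [NormedAddCommGroup 𝓗] [InnerProductSpace ℝ 𝓗]
    (I : 𝓗 →L[ℝ] Lp ℝ 2 P) (c : ℝ) (r : MvPolynomial 𝓗 ℝ) :
    polyEval I (c • r) = fun ω => c * polyEval I r ω :=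
  funext (polyEval_smul I c r)

theorem inner_const_integral [IsProbabilityMeasure P] {E : Type*} [NormedAddCommGroup E]
    [InnerProductSpace ℝ E] [CompleteSpace E] (X Y : Lp E 2 P) :
    ⟪Y, Lp.const 2 P (∫ ω, X ω ∂P)⟫_ℝ
      = ⟪coefLp (Lp.const 2 P (1 : ℝ)) Y, coefLp (Lp.const 2 P (1 : ℝ)) X⟫_ℝ := by
  rw [integral_eq_coefLp, ← tensorLp_const_one, real_inner_comm, inner_tensorLp_left,
    real_inner_comm]

end Mean

/-! ### From polynomials to `𝔻^{k,2}(H)`: divergence and chaos expansion -/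

section Closure

variable {Ω : Type*} [MeasurableSpace Ω] {P : Measure Ω} [IsProbabilityMeasure P]
  {Z : Type*} [NormedAddCommGroup Z] [InnerProductSpace ℝ Z] [CompleteSpace Z] {T : ℝ}
  {Q : Z →L[ℝ] Z} {W : Set.Icc (0 : ℝ) T → Ω → Z}
  {H : Type*} [NormedAddCommGroup H] [InnerProductSpace ℝ H]

-- The space `𝔻^{∞,2}` only intersects the orders `k ≥ 1`; this supplies order `0`, since forgetting
-- derivatives is continuous on graphs.
omit [IsProbabilityMeasure P] in
theorem malliavinSpace_le_zero (k : ℕ) : malliavinSpace Q W P H k ≤ malliavinSpace Q W P H 0 := by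
  rintro F ⟨⟨F', U⟩, hU, rfl⟩
  let L : (Lp H 2 P × ((j : Fin (k + 1)) → RandomKernel Q T P H j)) →L[ℝ]
      (Lp H 2 P × ((j : Fin (0 + 1)) → RandomKernel Q T P H j)) :=
    (ContinuousLinearMap.fst ℝ _ _).prod (ContinuousLinearMap.pi fun j : Fin (0 + 1) =>
      (ContinuousLinearMap.proj (Fin.castLE (by omega) j) :
        ((j : Fin (k + 1)) → RandomKernel Q T P H j) →L[ℝ] RandomKernel Q T P H j) ∘L
        ContinuousLinearMap.snd ℝ _ _)
  refine ⟨L (F', U), ?_, rfl⟩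
  refine map_mem_closure L.continuous hU fun G hG => ?_
  have : polyGraph Q W P H k ≤ (polyGraph Q W P H 0).comap (L : _ →ₗ[ℝ] _) := by
    refine Submodule.span_le.mpr ?_
    rintro _ ⟨N, q, ψ, x, rfl⟩
    exact Submodule.subset_span ⟨N, q, ψ, x, rfl⟩
  exact this hG

omit [IsProbabilityMeasure P] in
theorem polyVar_mem_malliavinSpace (k : ℕ) {N : ℕ} (q : MvPolynomial (Fin N) ℝ)
    (ψ : Fin N → Lp (StrongDual ℝ (CMSpace Q)) 2 (timeMeasure T)) (x : H) :
    polyVar Q W P q ψ x ∈ malliavinSpace Q W P H k :=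
  ⟨(polyVar Q W P q ψ x, fun j : Fin (k + 1) => polyDeriv Q W P q ψ x (j : ℕ)),
    (polyGraph Q W P H k).le_topologicalClosure (Submodule.subset_span ⟨N, q, ψ, x, rfl⟩), rfl⟩

-- Only membership in the closed graph is recorded. Uniqueness of `U` plays no role below.
omit [IsProbabilityMeasure P] in
theorem exists_mem_closure_malliavinDeriv {k : ℕ} {F : Lp H 2 P}
    (hF : F ∈ malliavinSpace Q W P H k) :
    ∃ U, (F, U) ∈ (polyGraph Q W P H k).topologicalClosure ∧
      malliavinDeriv Q W P k F = U (Fin.last k) := by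
  have h : ∃ U, (F, U) ∈ (polyGraph Q W P H k).topologicalClosure := by
    obtain ⟨⟨F', U⟩, hU, rfl⟩ := hF
    exact ⟨U, hU⟩
  exact ⟨h.choose, h.choose_spec, by rw [malliavinDeriv, dif_pos h]⟩

variable (hI : IsIsonormal (wienerIntegral Q W P))
include hI

variable {κ : Type*}

/-- These elements are the test variables that determine the divergence. -/
theorem tensorLp_chaosBasis_mem_malliavinSpace
    (b : κ → Lp (StrongDual ℝ (CMSpace Q)) 2 (timeMeasure T)) (α : κ →₀ ℕ) (x : H) (k : ℕ) :
    tensorLp (chaosBasis (wienerIntegral Q W P) b α) x ∈ malliavinSpace Q W P H k := by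
  obtain ⟨N, ψ, -, q, hq⟩ := MvPolynomial.exists_fin_rename (hermiteProd b α)
  have h : tensorLp (chaosBasis (wienerIntegral Q W P) b α) x
      = polyVar Q W P ((1 / √(α.prod fun _ n => (n ! : ℝ))) • q) ψ x := by
    rw [polyVar_eq_tensorLp hI, map_smul, ← hq, chaosBasis, polyEval_smul']
  rw [h]
  exact polyVar_mem_malliavinSpace _ _ _ _

variable [CompleteSpace H]

/-- Each side is a continuous linear function of either argument. The variables `X` and `Y` serve to
give the last components the type of order `k` instead of order `↑(Fin.last k)`. -/
theorem inner_coefLp_of_mem_closure (b : HilbertBasis κ ℝ (Lp (StrongDual ℝ (CMSpace Q)) 2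
    (timeMeasure T))) (k : ℕ)
    {A B : Lp H 2 P × ((j : Fin (k + 1)) → RandomKernel Q T P H j)}
    (hA : A ∈ (polyGraph Q W P H k).topologicalClosure)
    (hB : B ∈ (polyGraph Q W P H k).topologicalClosure)
    {X Y : RandomKernel Q T P H k} (hX : X = A.2 (Fin.last k)) (hY : Y = B.2 (Fin.last k)) :
    ⟪coefLp (Lp.const 2 P (1 : ℝ)) X, coefLp (Lp.const 2 P (1 : ℝ)) Y⟫_ℝ
      = (k ! : ℝ) * ⟪A.1, chaosPart (wienerIntegral Q W P) b k B.1⟫_ℝ := by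
  let D : (Lp H 2 P × ((j : Fin (k + 1)) → RandomKernel Q T P H j)) →L[ℝ] KernelSpace Q T H k :=
    (ContinuousLinearMap.adjoint (tensorLpL (E := KernelSpace Q T H k)
      (Lp.const 2 P (1 : ℝ)))) ∘L
      (ContinuousLinearMap.proj (Fin.last k) :
        ((j : Fin (k + 1)) → RandomKernel Q T P H j) →L[ℝ] RandomKernel Q T P H k) ∘L
        ContinuousLinearMap.snd ℝ _ _
  have hD : ∀ A, ∀ X : RandomKernel Q T P H k, X = A.2 (Fin.last k) →
      D A = coefLp (Lp.const 2 P (1 : ℝ)) X := by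
    rintro A X rfl
    exact (coefLp_eq_adjoint _ _).symm
  let R : Lp H 2 P → (Lp H 2 P × ((j : Fin (k + 1)) → RandomKernel Q T P H j)) →L[ℝ] ℝ :=
    fun F => (k ! : ℝ) • (innerSL ℝ (chaosPart (wienerIntegral Q W P) b k F) ∘L
      ContinuousLinearMap.fst ℝ _ _)
  have hR : ∀ F A, R F A
      = (k ! : ℝ) * ⟪A.1, chaosPart (wienerIntegral Q W P) b k F⟫_ℝ := fun F A => by
    simp [R, real_inner_comm]
  have key : ∀ B, (∀ (N : ℕ) (q : MvPolynomial (Fin N) ℝ)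
      (ψ : Fin N → Lp (StrongDual ℝ (CMSpace Q)) 2 (timeMeasure T)) (x : H),
      ⟪D (polyVar Q W P q ψ x, fun j : Fin (k + 1) => polyDeriv Q W P q ψ x (j : ℕ)), D B⟫_ℝ
        = (k ! : ℝ) * ⟪polyVar Q W P q ψ x, chaosPart (wienerIntegral Q W P) b k B.1⟫_ℝ) →
      ∀ A ∈ (polyGraph Q W P H k).topologicalClosure,
        ⟪D A, D B⟫_ℝ = (k ! : ℝ) * ⟪A.1, chaosPart (wienerIntegral Q W P) b k B.1⟫_ℝ := by
    intro B h A hA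
    have := ContinuousLinearMap.eqOn_closure_span (f := innerSL ℝ (D B) ∘L D) (g := R B.1)
      (s := {G | ∃ (N : ℕ) (q : MvPolynomial (Fin N) ℝ)
        (ψ : Fin N → Lp (StrongDual ℝ (CMSpace Q)) 2 (timeMeasure T)) (x : H),
        G = (polyVar Q W P q ψ x, fun j : Fin (k + 1) => polyDeriv Q W P q ψ x (j : ℕ))}) (by
          rintro _ ⟨N, q, ψ, x, rfl⟩
          rw [hR, ← h, real_inner_comm]
          rfl) hA
    rw [← hR, ← this, real_inner_comm]
    rfl
  rw [← hD A X hX, ← hD B Y hY]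
  refine key B (fun N q ψ x => ?_) A hA
  -- With the first argument a polynomial variable, the roles are exchanged, and the same extension
  -- reaches `B`.
  rw [real_inner_comm, inner_chaosPart_comm hI b.orthonormal]
  refine key _ (fun N' q' ψ' y => ?_) B hB
  rw [hD _ (polyDeriv Q W P q' ψ' y k) rfl, hD _ (polyDeriv Q W P q ψ x k) rfl]
  exact inner_coefLp_polyDeriv hI b k q' ψ' y q ψ x

theorem inner_malliavinDeriv_meanDeriv (b : HilbertBasis κ ℝ (Lp (StrongDual ℝ (CMSpace Q)) 2
    (timeMeasure T))) {k : ℕ} {F G : Lp H 2 P} (hF : F ∈ malliavinSpace Q W P H k)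
    (hG : G ∈ malliavinSpace Q W P H k) :
    ⟪malliavinDeriv Q W P k G, meanDeriv Q W P k F⟫_ℝ
      = ⟪G, (k ! : ℝ) • chaosPart (wienerIntegral Q W P) b k F⟫_ℝ := by
  obtain ⟨U, hU, hFU⟩ := exists_mem_closure_malliavinDeriv hF
  obtain ⟨V, hV, hGV⟩ := exists_mem_closure_malliavinDeriv hG
  rw [meanDeriv, inner_const_integral, real_inner_smul_right]
  exact inner_coefLp_of_mem_closure hI b k hV hU hGV hFU

/-- By the adjoint relation and Cauchy-Schwarz, `‖k! Π_k F‖` serves as the constant. -/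
theorem meanDeriv_mem_divergenceDomain [MeasurableSpace Z]
    (b : HilbertBasis κ ℝ (Lp (StrongDual ℝ (CMSpace Q)) 2
    (timeMeasure T))) {k : ℕ} {F : Lp H 2 P} (hF : F ∈ malliavinSpace Q W P H k) :
    meanDeriv Q W P k F ∈ divergenceDomain Q W P H k := by
  refine ⟨AEStronglyMeasurable.congr (f := fun _ => ∫ ω, malliavinDeriv Q W P k F ω ∂P)
    aestronglyMeasurable_const (Lp.coeFn_const 2 P _).symm,
    ‖(k ! : ℝ) • chaosPart (wienerIntegral Q W P) b k F‖, fun G hG => ?_⟩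
  rw [inner_malliavinDeriv_meanDeriv hI b hF hG, mul_comm]
  exact abs_real_inner_le_norm _ _

section Adapted

variable [MeasurableSpace Z] [BorelSpace Z] [TopologicalSpace.SeparableSpace Z]
  [TopologicalSpace.SeparableSpace H]
  (hW : ∀ t, Measurable (W t))
  (hIm : ∀ h, AEStronglyMeasurable[sigmaW W] (wienerIntegral Q W P h) P)

include hIm

omit hI [BorelSpace Z] [TopologicalSpace.SeparableSpace Z] [CompleteSpace H]
  [TopologicalSpace.SeparableSpace H] [IsProbabilityMeasure P]
  [NormedAddCommGroup H] [InnerProductSpace ℝ H] in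
theorem aestronglyMeasurable_polyEval
    (q : MvPolynomial (Lp (StrongDual ℝ (CMSpace Q)) 2 (timeMeasure T)) ℝ) :
    AEStronglyMeasurable[sigmaW W] (polyEval (wienerIntegral Q W P) q) P := by
  induction q using MvPolynomial.induction_on with
  | C a =>
    have : polyEval (wienerIntegral Q W P) (MvPolynomial.C a) = fun _ => a := by
      ext ω
      simp [polyEval]
    rw [this]
    exact aestronglyMeasurable_const
  | add p q hp hq =>
    have : polyEval (wienerIntegral Q W P) (p + q)
      = polyEval (wienerIntegral Q W P) p + polyEval (wienerIntegral Q W P) q := by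
      ext ω
      simp [polyEval]
    rw [this]
    exact hp.add hq
  | mul_X p h hp =>
    have : polyEval (wienerIntegral Q W P) (p * MvPolynomial.X h)
      = polyEval (wienerIntegral Q W P) p * (wienerIntegral Q W P h) := by
      ext ω
      simp [polyEval]
    rw [this]
    exact hp.mul (hIm h)

omit [BorelSpace Z] [TopologicalSpace.SeparableSpace Z] [CompleteSpace H]
  [TopologicalSpace.SeparableSpace H] in
theorem aestronglyMeasurable_tensorLp_toL2_polyEval
    (q : MvPolynomial (Lp (StrongDual ℝ (CMSpace Q)) 2 (timeMeasure T)) ℝ) (x : H) :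
    AEStronglyMeasurable[sigmaW W] (tensorLp (toL2 P (polyEval (wienerIntegral Q W P) q)) x) P := by
  refine AEStronglyMeasurable.congr ((aestronglyMeasurable_polyEval hIm q).smul_const x) ?_
  filter_upwards [coeFn_tensorLp (toL2 P (polyEval (wienerIntegral Q W P) q)) x,
    coeFn_toL2 (hI.memLp_polyEval q)] with ω h1 h2
  rw [h1, h2]

omit [BorelSpace Z] [TopologicalSpace.SeparableSpace Z] [CompleteSpace H]
  [TopologicalSpace.SeparableSpace H] in
theorem aestronglyMeasurable_tensorLp_chaosBasis
    (b : κ → Lp (StrongDual ℝ (CMSpace Q)) 2 (timeMeasure T)) (α : κ →₀ ℕ) (x : H) :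
    AEStronglyMeasurable[sigmaW W] (tensorLp (chaosBasis (wienerIntegral Q W P) b α) x) P := by
  have := aestronglyMeasurable_tensorLp_toL2_polyEval hI hIm
    ((1 / √(α.prod fun _ n => (n ! : ℝ))) • hermiteProd b α) x
  rw [polyEval_smul'] at this
  exact this

include hW

-- Polynomial variables are `σ(W)`-measurable up to null sets, and this property is closed in `L²`.
omit [BorelSpace Z] [TopologicalSpace.SeparableSpace Z] [TopologicalSpace.SeparableSpace H] in
theorem aestronglyMeasurable_of_mem_malliavinSpace {k : ℕ} {F : Lp H 2 P}
    (hF : F ∈ malliavinSpace Q W P H k) : AEStronglyMeasurable[sigmaW W] F P := by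
  obtain ⟨⟨F', U⟩, hU, rfl⟩ := hF
  have hc := isClosed_aestronglyMeasurable (F := H) (p := 2) (μ := P) (sigmaW_le hW)
  have : polyGraph Q W P H k ≤ (lpMeas H ℝ (sigmaW W) 2 P).comap (LinearMap.fst ℝ _ _) := by
    refine Submodule.span_le.mpr ?_
    rintro _ ⟨N, q, ψ, x, rfl⟩
    change AEStronglyMeasurable[sigmaW W] (polyVar Q W P q ψ x) P
    rw [polyVar_eq_tensorLp hI]
    exact aestronglyMeasurable_tensorLp_toL2_polyEval hI hIm _ _
  exact closure_minimal (fun G hG => this hG) (hc.preimage continuous_fst) hU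

omit [BorelSpace Z] [TopologicalSpace.SeparableSpace Z] [TopologicalSpace.SeparableSpace H] in
theorem aestronglyMeasurable_chaosPart {b : κ → Lp (StrongDual ℝ (CMSpace Q)) 2 (timeMeasure T)}
    (hb : Orthonormal ℝ b) (k : ℕ) (F : Lp H 2 P) :
    AEStronglyMeasurable[sigmaW W] (chaosPart (wienerIntegral Q W P) b k F) P := by
  have hs := summable_tensorLp_coefLp ((hI.orthonormal_chaosBasis hb).comp
    (fun α : {α : κ →₀ ℕ // α.degree = k} => α.1) Subtype.val_injective) F
  exact (isClosed_aestronglyMeasurable (F := H) (p := 2) (μ := P) (sigmaW_le hW)).mem_of_tendsto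
    hs.hasSum (Filter.Eventually.of_forall fun s => (lpMeas H ℝ (sigmaW W) 2 P).sum_mem fun α _ =>
      aestronglyMeasurable_tensorLp_chaosBasis hI hIm b _ _)

variable (hWI : ∀ t z, ∃ h, wienerIntegral Q W P h =ᵐ[P] fun ω => ⟪W t ω, z⟫_ℝ)
include hWI

/-- The element chosen in `divergence` and `k! Π_k F` are both `σ(W)`-measurable and have the same
inner product with every `ξ_α ⊗ x`, so totality forces equality. -/
theorem divergence_meanDeriv (b : HilbertBasis κ ℝ (Lp (StrongDual ℝ (CMSpace Q)) 2
    (timeMeasure T))) {k : ℕ} {F : Lp H 2 P} (hF : F ∈ malliavinSpace Q W P H k) :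
    divergence Q W P k (meanDeriv Q W P k F)
      = (k ! : ℝ) • chaosPart (wienerIntegral Q W P) b k F := by
  have h : ∃ Y : Lp H 2 P, AEStronglyMeasurable[sigmaW W] Y P ∧
      ∀ G ∈ malliavinSpace Q W P H k,
        ⟪G, Y⟫_ℝ = ⟪malliavinDeriv Q W P k G, meanDeriv Q W P k F⟫_ℝ :=
    ⟨(k ! : ℝ) • chaosPart (wienerIntegral Q W P) b k F,
      (lpMeas H ℝ (sigmaW W) 2 P).smul_mem _
        (aestronglyMeasurable_chaosPart hI hW hIm b.orthonormal k F),
      fun G hG => (inner_malliavinDeriv_meanDeriv hI b hF hG).symm⟩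
  rw [divergence, dif_pos h, ← sub_eq_zero]
  refine hI.eq_zero_of_coefLp_eq_zero hW hWI b _ ?_ fun α => ext_inner_left ℝ fun x => ?_
  · exact (lpMeas H ℝ (sigmaW W) 2 P).sub_mem h.choose_spec.1
      ((lpMeas H ℝ (sigmaW W) 2 P).smul_mem _
        (aestronglyMeasurable_chaosPart hI hW hIm b.orthonormal k F))
  · have hG := tensorLp_chaosBasis_mem_malliavinSpace hI b α x k
    rw [← inner_tensorLp_left, inner_sub_right, h.choose_spec.2 _ hG,
      inner_malliavinDeriv_meanDeriv hI b hF hG, sub_self, inner_zero_right]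

/-- The expansion over all multi-indices is regrouped by degree. -/
theorem hasSum_chaosPart (b : HilbertBasis κ ℝ (Lp (StrongDual ℝ (CMSpace Q)) 2
    (timeMeasure T))) {F : Lp H 2 P} (hF : AEStronglyMeasurable[sigmaW W] F P) :
    HasSum (fun k => chaosPart (wienerIntegral Q W P) b k F) F := by
  have hc := isClosed_aestronglyMeasurable (F := H) (p := 2) (μ := P) (sigmaW_le hW)
  have h := hasSum_tensorLp_coefLp (hI.orthonormal_chaosBasis b.orthonormal)
    (M := lpMeas H ℝ (sigmaW W) 2 P) hc
    (fun α x => aestronglyMeasurable_tensorLp_chaosBasis hI hIm b α x)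
    (fun G hG h0 => hI.eq_zero_of_coefLp_eq_zero hW hWI b G hG h0) hF
  rw [← (Equiv.sigmaFiberEquiv (Finsupp.degree (σ := κ) (R := ℕ))).hasSum_iff] at h
  refine h.sigma fun k => ?_
  exact (summable_tensorLp_coefLp ((hI.orthonormal_chaosBasis b.orthonormal).comp
    (fun α : {α : κ →₀ ℕ // α.degree = k} => α.1) Subtype.val_injective) F).hasSum

omit hW hIm hWI [BorelSpace Z] [TopologicalSpace.SeparableSpace Z] [CompleteSpace H]
  [TopologicalSpace.SeparableSpace H] hI [MeasurableSpace Z] in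
theorem chaosPart_zero (b : κ → Lp (StrongDual ℝ (CMSpace Q)) 2 (timeMeasure T)) (F : Lp H 2 P) :
    chaosPart (wienerIntegral Q W P) b 0 F = Lp.const 2 P (∫ ω, F ω ∂P) := by
  have h1 : chaosBasis (wienerIntegral Q W P) b 0 = Lp.const 2 P (1 : ℝ) := by
    have : (fun ω => (1 / √((0 : κ →₀ ℕ).prod fun _ n => (n ! : ℝ)))
        * polyEval (wienerIntegral Q W P) (hermiteProd b 0) ω)
        =ᵐ[P] Lp.const 2 P (1 : ℝ) := by
      filter_upwards [Lp.coeFn_const 2 P (1 : ℝ)] with ω hω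
      rw [hω]
      simp [hermiteProd_zero, polyEval]
    rw [chaosBasis, toL2_congr this, toL2_coeFn]
  rw [chaosPart, tsum_eq_single ⟨0, map_zero _⟩]
  · rw [h1, tensorLp_const_one, integral_eq_coefLp]
  · rintro ⟨α, hα⟩ hne
    refine (hne (Subtype.ext ?_)).elim
    exact (Finsupp.degree_eq_zero_iff α).mp hα

end Adapted

end Closure

/-! ### The square root of `Q` and functionals on its range -/

section Root

variable {Z : Type*} [NormedAddCommGroup Z] [InnerProductSpace ℝ Z] [CompleteSpace Z]
  {ι : Type*} (e : HilbertBasis ι ℝ Z)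

omit [CompleteSpace Z] in
/-- A bounded sequence is the sequence of eigenvalues of a symmetric operator. -/
theorem exists_isSymmetric_eigenbasis {a : ι → ℝ} {C : ℝ} (ha : ∀ i, |a i| ≤ C) :
    ∃ R : Z →ₗ[ℝ] Z, (∀ i, R (e i) = a i • e i) ∧ R.IsSymmetric ∧
      ((∀ i, 0 ≤ a i) → ∀ x, 0 ≤ ⟪R x, x⟫_ℝ) := by
  classical
  let D : lp (fun _ : ι => ℝ) 2 →ₗ[ℝ] lp (fun _ : ι => ℝ) 2 :=
    { toFun := fun f => ⟨fun i => a i * f i, by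
        refine memℓp_gen (Summable.of_nonneg_of_le (fun i => by positivity) (fun i => ?_)
          (((memℓp_gen_iff (by norm_num)).mp (lp.memℓp f)).mul_left (C ^ 2)))
        have h1 : a i ^ 2 ≤ C ^ 2 := sq_le_sq.mpr ((ha i).trans (le_abs_self C))
        simpa [mul_pow] using mul_le_mul_of_nonneg_right h1 (sq_nonneg (f i))⟩
      map_add' := fun f g => lp.ext (funext fun i => mul_add _ _ _)
      map_smul' := fun c f => lp.ext (funext fun i => mul_left_comm _ _ _) }
  have hD : ∀ f i, D f i = a i * f i := fun f i => rfl
  let R : Z →ₗ[ℝ] Z := e.repr.symm.toLinearMap ∘ₗ D ∘ₗ e.repr.toLinearMap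
  have hR : ∀ z, e.repr (R z) = D (e.repr z) := fun z => e.repr.apply_symm_apply _
  have hin : ∀ x y, ⟪R x, y⟫_ℝ = ∑' i, a i * (e.repr x i * e.repr y i) := by
    intro x y
    rw [← e.repr.inner_map_map, hR, lp.inner_eq_tsum]
    refine tsum_congr fun i => ?_
    rw [hD]
    simp
    ring
  refine ⟨R, fun i => ?_, fun x y => ?_, fun h x => ?_⟩
  · refine e.repr.injective (lp.ext (funext fun j => ?_))
    rw [hR, hD, map_smul, e.repr_self]
    by_cases hij : j = i
    · subst hij
      simp
    · simp [hij]
  · rw [hin, real_inner_comm, hin]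
    simp_rw [mul_comm (e.repr x _)]
  · rw [hin]
    exact tsum_nonneg fun i => mul_nonneg (h i) (mul_self_nonneg _)

omit [CompleteSpace Z] in
theorem eigenvalue_nonneg {Q : Z →L[ℝ] Z} (hQ : Q.IsPositive) {lam : ι → ℝ}
    (he : ∀ i, Q (e i) = lam i • e i) (i : ι) : 0 ≤ lam i := by
  have h := hQ.inner_nonneg_left (e i)
  rwa [he, real_inner_smul_left, real_inner_self_eq_norm_sq, e.orthonormal.1, one_pow,
    mul_one] at h

/-- The root is diagonal with eigenvalues `√λ_i`, which are bounded because `λ_i ≤ ‖Q‖`. Hence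
`posSqrt` does not take its default value. -/
theorem exists_isPositive_comp_self {Q : Z →L[ℝ] Z} (hQ : Q.IsPositive) {lam : ι → ℝ}
    (he : ∀ i, Q (e i) = lam i • e i) : ∃ R : Z →L[ℝ] Z, R.IsPositive ∧ R ∘L R = Q := by
  have h0 := eigenvalue_nonneg e hQ he
  have hb : ∀ i, |√(lam i)| ≤ √‖Q‖ := by
    intro i
    rw [abs_of_nonneg (Real.sqrt_nonneg _)]
    refine Real.sqrt_le_sqrt ?_
    have := Q.le_opNorm (e i)
    rwa [he, norm_smul, e.orthonormal.1, mul_one, mul_one, Real.norm_of_nonneg (h0 i)] at this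
  obtain ⟨R, hRe, hRs, hRp⟩ := exists_isSymmetric_eigenbasis e hb
  let R' : Z →L[ℝ] Z := ⟨R, hRs.continuous⟩
  refine ⟨R', ⟨hRs, fun x => ?_⟩, ?_⟩
  · exact hRp (fun i => Real.sqrt_nonneg _) x
  · refine ContinuousLinearMap.ext_on (s := Set.range e) ?_ ?_
    · rw [dense_iff_closure_eq, ← Submodule.topologicalClosure_coe, e.dense_span]
      rfl
    · rintro _ ⟨i, rfl⟩
      change R (R (e i)) = Q (e i)
      rw [hRe, map_smul, hRe, smul_smul, Real.mul_self_sqrt (h0 i), he]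

theorem posSqrt_spec {Q : Z →L[ℝ] Z} (h : ∃ R : Z →L[ℝ] Z, R.IsPositive ∧ R ∘L R = Q) :
    (posSqrt Q).IsPositive ∧ posSqrt Q ∘L posSqrt Q = Q := by
  rw [posSqrt, dif_pos h]
  exact h.choose_spec

/-- The functional `⟪·, z⟫` on `R Z`. -/
noncomputable def rangeFunctional (R : Z →L[ℝ] Z) (z : Z) : StrongDual ℝ (RangeSpace R) :=
  innerSL ℝ z ∘L RangeSpace.inclL R

theorem rangeFunctional_apply (R : Z →L[ℝ] Z) (z : Z) (y : RangeSpace R) :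
    rangeFunctional R z y = ⟪z, R (RangeSpace.pinv R y)⟫_ℝ := by
  rw [RangeSpace.apply_pinv]
  rfl

theorem rangeFunctional_smul (R : Z →L[ℝ] Z) (c : ℝ) (z : Z) :
    rangeFunctional R (c • z) = c • rangeFunctional R z := by
  ext y
  simp [rangeFunctional_apply, real_inner_smul_left]

variable {R : Z →L[ℝ] Z} (hR : R.IsPositive)
include hR

/-- The Riesz representative of `⟪·, z⟫` on the range is `R(Rz)`; its pseudo-inverse is `Rz`
because, by symmetry, `Rz` is orthogonal to the kernel. -/
theorem exists_toDual_eq_rangeFunctional (z : Z) : ∃ y : RangeSpace R,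
    rangeFunctional R z = InnerProductSpace.toDual ℝ _ y ∧ RangeSpace.pinv R y = R z := by
  have hmem : R z ∈ (LinearMap.ker (R : Z →ₗ[ℝ] Z))ᗮ := by
    intro x hx
    have hx' : R x = 0 := hx
    have := hR.isSymmetric x z
    change ⟪R x, z⟫_ℝ = ⟪x, R z⟫_ℝ at this
    rw [← this, hx', inner_zero_left]
  refine ⟨RangeSpace.kerPerpEquiv R ⟨R z, hmem⟩, ?_, ?_⟩
  · ext y
    rw [rangeFunctional_apply, InnerProductSpace.toDual_apply_apply, RangeSpace.inner_eq]
    have h1 : RangeSpace.pinv R (RangeSpace.kerPerpEquiv R ⟨R z, hmem⟩) = R z := by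
      simp [RangeSpace.pinv]
    rw [h1]
    exact (hR.isSymmetric z _).symm
  · simp [RangeSpace.pinv]

/-- For `R = Q^{1/2}` the right side is `⟪Qz, z'⟫`, the covariance of the noise. -/
theorem inner_rangeFunctional (z z' : Z) :
    ⟪rangeFunctional R z, rangeFunctional R z'⟫_ℝ = ⟪R (R z), z'⟫_ℝ := by
  obtain ⟨y, hy, hy'⟩ := exists_toDual_eq_rangeFunctional hR z
  obtain ⟨w, hw, hw'⟩ := exists_toDual_eq_rangeFunctional hR z'
  rw [hy, hw, strongDual_inner_toDual, RangeSpace.inner_eq, hy', hw']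
  exact (hR.isSymmetric (R z) z').symm

/-- A vector of the range whose Riesz functional is orthogonal to these functionals is orthogonal in
`Z` to `e i` for `i ∈ s`. For `i ∉ s` it is so automatically, since `R (e i) = 0` and `R` is
symmetric. -/
theorem topologicalClosure_span_rangeFunctional {s : Set ι} (hs : ∀ i ∉ s, R (e i) = 0) :
    (Submodule.span ℝ (Set.range fun i : s => rangeFunctional R (e i))).topologicalClosure = ⊤ := by
  refine (Submodule.topologicalClosure_eq_top_iff (𝕜 := ℝ) (E := StrongDual ℝ (RangeSpace R))
    (K := Submodule.span ℝ (Set.range fun i : s => rangeFunctional R (e i)))).mpr ?_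
  rw [Submodule.eq_bot_iff]
  intro l hl
  obtain ⟨y, rfl⟩ := (InnerProductSpace.toDual ℝ (RangeSpace R)).surjective l
  have h0 : RangeSpace.incl R y = 0 := by
    rw [← RangeSpace.apply_pinv]
    refine (Submodule.eq_bot_iff _).mp (Submodule.topologicalClosure_eq_top_iff.mp e.dense_span)
      _ ?_
    rw [Submodule.mem_orthogonal]
    intro z hz
    induction hz using Submodule.span_induction with
    | zero => simp
    | add x y _ _ hx hy => rw [inner_add_left, hx, hy, add_zero]
    | smul c x _ hx => rw [real_inner_smul_left, hx, mul_zero]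
    | mem z hz =>
      obtain ⟨i, rfl⟩ := hz
      by_cases hi : i ∈ s
      · have := hl _ (Submodule.subset_span ⟨⟨i, hi⟩, rfl⟩)
        obtain ⟨w, hw, hw'⟩ := exists_toDual_eq_rangeFunctional hR (e i)
        dsimp only at this
        rw [hw, strongDual_inner_toDual, RangeSpace.inner_eq, hw'] at this
        rw [← this]
        exact (hR.isSymmetric (e i) _).symm
      · have := hR.isSymmetric (e i) (RangeSpace.pinv R y)
        change ⟪R (e i), _⟫_ℝ = ⟪e i, R _⟫_ℝ at this
        rw [← this, hs i hi, inner_zero_left]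
  have : y = 0 := Subtype.ext h0
  rw [this, map_zero]

end Root

/-! ### Totality of elementary tensors in `L²(μ; E)` -/

section Density

variable {α E A B : Type*} [MeasurableSpace α] {μ : Measure α} [NormedAddCommGroup E]
  [InnerProductSpace ℝ E]

theorem indicatorConstLp_eq_tensorLp {s : Set α} (hs : MeasurableSet s) (hμs : μ s ≠ ⊤) (c : E) :
    indicatorConstLp 2 hs hμs c = tensorLp (indicatorConstLp 2 hs hμs (1 : ℝ)) c := by
  refine Lp.ext ?_
  filter_upwards [coeFn_tensorLp (indicatorConstLp 2 hs hμs (1 : ℝ)) c,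
    indicatorConstLp_coeFn (p := 2) (hs := hs) (hμs := hμs) (c := c),
    indicatorConstLp_coeFn (p := 2) (hs := hs) (hμs := hμs) (c := (1 : ℝ))] with a h1 h2 h3
  rw [h1, h2, h3]
  by_cases ha : a ∈ s <;> simp [ha]

/-- The closed span absorbs all `x` for fixed `v a`, then all `w` for fixed `x`; it therefore
contains the indicators with vector values, which generate `L²(μ; E)`. -/
theorem topologicalClosure_span_tensorLp {v : A → Lp ℝ 2 μ} {u : B → E}
    (hv : (Submodule.span ℝ (Set.range v)).topologicalClosure = ⊤)
    (hu : (Submodule.span ℝ (Set.range u)).topologicalClosure = ⊤) :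
    (Submodule.span ℝ (Set.range fun p : A × B => tensorLp (v p.1) (u p.2))).topologicalClosure
      = ⊤ := by
  obtain ⟨M, hM⟩ : ∃ M, M = (Submodule.span ℝ (Set.range fun p : A × B =>
    tensorLp (v p.1) (u p.2))).topologicalClosure := ⟨_, rfl⟩
  rw [← hM]
  have hMc : IsClosed (M : Set (Lp E 2 μ)) := by
    rw [hM]
    exact Submodule.isClosed_topologicalClosure _
  have h1 : ∀ a x, tensorLp (v a) x ∈ M := by
    intro a x
    have : (Submodule.span ℝ (Set.range u)).topologicalClosure
        ≤ M.comap (tensorLpL (E := E) (v a)).toLinearMap := by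
      refine Submodule.topologicalClosure_minimal _ (Submodule.span_le.mpr ?_)
        (hMc.preimage (tensorLpL (v a)).continuous)
      rintro _ ⟨c, rfl⟩
      rw [hM]
      exact Submodule.le_topologicalClosure _ (Submodule.subset_span ⟨(a, c), rfl⟩)
    rw [hu] at this
    exact this trivial
  have h2 : ∀ w x, tensorLp w x ∈ M := by
    intro w x
    obtain ⟨L, hL⟩ : ∃ L : Lp ℝ 2 μ →L[ℝ] Lp E 2 μ, ∀ w, L w = tensorLp w x :=
      ⟨tensorLpL.flip x, fun w => rfl⟩
    have : (Submodule.span ℝ (Set.range v)).topologicalClosure ≤ M.comap L.toLinearMap := by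
      refine Submodule.topologicalClosure_minimal _ (Submodule.span_le.mpr ?_)
        (hMc.preimage L.continuous)
      rintro _ ⟨a, rfl⟩
      change L (v a) ∈ M
      rw [hL]
      exact h1 a x
    rw [hv] at this
    rw [← hL]
    exact this trivial
  refine eq_top_iff.mpr fun F _ => ?_
  refine Lp.induction (p := 2) (by norm_num) (motive := fun F : Lp E 2 μ => F ∈ M) ?_ ?_ hMc F
  · intro c s hs hμs
    rw [Lp.simpleFunc.coe_indicatorConst, indicatorConstLp_eq_tensorLp]
    exact h2 _ _
  · exact fun f g hf hg _ h3 h4 => M.add_mem h3 h4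

end Density

/-! ### Extension of families by continuity -/

section Extension

theorem extendFamily_apply {A E F : Type*} [NormedAddCommGroup E] [NormedSpace ℝ E]
    [NormedAddCommGroup F] [NormedSpace ℝ F] {v : A → E} {u : A → F}
    (h : ∃ I : E →L[ℝ] F, ∀ a, I (v a) = u a) (a : A) : extendFamily v u (v a) = u a := by
  rw [extendFamily, dif_pos h]
  exact h.choose_spec a

theorem extendFamily_eq {A E F : Type*} [NormedAddCommGroup E] [NormedSpace ℝ E]
    [NormedAddCommGroup F] [NormedSpace ℝ F] {v : A → E} {u : A → F}
    (hv : (Submodule.span ℝ (Set.range v)).topologicalClosure = ⊤) {I : E →L[ℝ] F}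
    (hI : ∀ a, I (v a) = u a) : extendFamily v u = I := by
  refine ContinuousLinearMap.ext_on (s := Set.range v) ?_ ?_
  · rw [dense_iff_closure_eq, ← Submodule.topologicalClosure_coe, hv]
    rfl
  · rintro _ ⟨a, rfl⟩
    rw [extendFamily_apply ⟨I, hI⟩, hI]

/-- Equal Gram matrices give linear combinations of equal norm, so the assignment is well defined
and isometric on a dense subspace. -/
theorem exists_isometry_of_gram {A E F : Type*} [NormedAddCommGroup E] [InnerProductSpace ℝ E]
    [NormedAddCommGroup F] [InnerProductSpace ℝ F] [CompleteSpace F] {v : A → E} {u : A → F}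
    (hv : (Submodule.span ℝ (Set.range v)).topologicalClosure = ⊤)
    (huv : ∀ a b, ⟪u a, u b⟫_ℝ = ⟪v a, v b⟫_ℝ) :
    ∃ I : E →L[ℝ] F, (∀ a, I (v a) = u a) ∧ ∀ x, ‖I x‖ = ‖x‖ := by
  let f := Finsupp.linearCombination ℝ u
  let g := Finsupp.linearCombination ℝ v
  have hfg : ∀ c, ‖f c‖ = ‖g c‖ := by
    intro c
    rw [← sq_eq_sq₀ (norm_nonneg _) (norm_nonneg _), ← real_inner_self_eq_norm_sq,
      ← real_inner_self_eq_norm_sq]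
    simp only [f, g, Finsupp.linearCombination_apply, Finsupp.sum, sum_inner, inner_sum,
      real_inner_smul_left, real_inner_smul_right, huv]
  have hd : DenseRange g := by
    rw [DenseRange, dense_iff_closure_eq]
    have : Set.range g = (Submodule.span ℝ (Set.range v) : Set E) := by
      rw [← Finsupp.range_linearCombination]
      rfl
    rw [this, ← Submodule.topologicalClosure_coe, hv]
    rfl
  have hI := LinearMap.extendOfNorm_eq hd (f := f) ⟨1, fun c => by rw [one_mul, hfg]⟩
  refine ⟨f.extendOfNorm g, fun a => ?_, fun x => ?_⟩
  · have := hI (Finsupp.single a 1)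
    simpa [f, g] using this
  · refine hd.induction_on x (isClosed_eq (by fun_prop) (by fun_prop)) fun c => ?_
    rw [hI, hfg]

end Extension

/-! ### Indicator functions of time intervals -/

section Indicator

theorem toL2_indicator_const {α E : Type*} [MeasurableSpace α] {μ : Measure α} [IsFiniteMeasure μ]
    [NormedAddCommGroup E] {s : Set α} (hs : MeasurableSet s) (c : E) :
    toL2 μ (s.indicator fun _ => c) = indicatorConstLp 2 hs (measure_ne_top μ s) c :=
  toL2_eq_toLp _

variable {T : ℝ}

/-- The indicator function of `[0, t]`. -/
noncomputable def iicLp (t : Set.Icc (0 : ℝ) T) : Lp ℝ 2 (timeMeasure T) :=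
  indicatorConstLp 2 (measurableSet_Iic (a := t)) (measure_ne_top _ _) 1

theorem timeMeasure_real_Iic (t : Set.Icc (0 : ℝ) T) :
    (timeMeasure T).real (Set.Iic t) = t := by
  rw [measureReal_def, timeMeasure,
    (MeasurableEmbedding.subtype_coe measurableSet_Icc).comap_apply]
  have : Subtype.val '' Set.Iic t = Set.Icc (0 : ℝ) t := by
    ext r
    constructor
    · rintro ⟨s, hs, rfl⟩
      exact ⟨s.2.1, hs⟩
    · exact fun hr => ⟨⟨r, hr.1, hr.2.trans t.2.2⟩, hr.2, rfl⟩
  rw [this, Real.volume_Icc, sub_zero, ENNReal.toReal_ofReal t.2.1]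

theorem inner_iicLp_iicLp (s t : Set.Icc (0 : ℝ) T) :
    ⟪iicLp s, iicLp t⟫_ℝ = min (s : ℝ) (t : ℝ) := by
  rw [iicLp, iicLp, L2.real_inner_indicatorConstLp_one_indicatorConstLp_one, Set.Iic_inter_Iic,
    timeMeasure_real_Iic]
  rfl

theorem iicLp_eq_zero {t : Set.Icc (0 : ℝ) T} (ht : (t : ℝ) = 0) : iicLp t = 0 := by
  rw [← norm_eq_zero, ← sq_eq_zero_iff, ← real_inner_self_eq_norm_sq, inner_iicLp_iicLp, ht,
    min_self]

theorem toL2_indicator_Ioc {E : Type*} [NormedAddCommGroup E] [InnerProductSpace ℝ E]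
    {s t : Set.Icc (0 : ℝ) T} (h : s ≤ t) (c : E) :
    toL2 (timeMeasure T) ((Set.Ioc s t).indicator fun _ => c) = tensorLp (iicLp t - iicLp s) c := by
  rw [toL2_indicator_const measurableSet_Ioc, indicatorConstLp_eq_tensorLp]
  congr 1
  refine Lp.ext ?_
  filter_upwards [Lp.coeFn_sub (iicLp t) (iicLp s),
    indicatorConstLp_coeFn (p := 2) (hs := measurableSet_Iic (a := t))
      (hμs := measure_ne_top (timeMeasure T) _) (c := (1 : ℝ)),
    indicatorConstLp_coeFn (p := 2) (hs := measurableSet_Iic (a := s))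
      (hμs := measure_ne_top (timeMeasure T) _) (c := (1 : ℝ)),
    indicatorConstLp_coeFn (p := 2) (hs := measurableSet_Ioc (a := s) (b := t))
      (hμs := measure_ne_top (timeMeasure T) _) (c := (1 : ℝ))] with r h1 h2 h3 h4
  rw [h1, h4, Pi.sub_apply, iicLp, iicLp, h2, h3]
  simp only [Set.indicator_apply, Set.mem_Ioc, Set.mem_Iic]
  by_cases h5 : r ≤ s
  · simp [h5, h5.trans h]
  · simp [h5, not_le.mp h5]

/-- A function orthogonal to all of them has zero integral over a π-system that generates the Borel
sets. The case `t = T` gives the total integral, needed for complements. -/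
theorem topologicalClosure_span_iicLp (hT : 0 ≤ T) :
    (Submodule.span ℝ (Set.range (iicLp (T := T)))).topologicalClosure = ⊤ := by
  rw [Submodule.topologicalClosure_eq_top_iff, Submodule.eq_bot_iff]
  intro f hf
  have hfi : Integrable f (timeMeasure T) := (Lp.memLp f).integrable (by norm_num)
  have h0 : ∀ t : Set.Icc (0 : ℝ) T, ∫ r in Set.Iic t, f r ∂timeMeasure T = 0 := by
    intro t
    have := hf _ (Submodule.subset_span ⟨t, rfl⟩)
    rwa [iicLp, L2.inner_indicatorConstLp_one] at this
  have h1 : ∫ r, f r ∂timeMeasure T = 0 := by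
    have := h0 ⟨T, hT, le_rfl⟩
    rwa [show Set.Iic (⟨T, hT, le_rfl⟩ : Set.Icc (0 : ℝ) T) = Set.univ from
      Set.eq_univ_of_forall fun r => r.2.2, Measure.restrict_univ] at this
  refine (Lp.eq_zero_iff_ae_eq_zero).mpr (hfi.ae_eq_zero_of_forall_setIntegral_eq_zero
    fun s hs _ => ?_)
  induction s, hs using MeasurableSpace.induction_on_inter
    ((BorelSpace.measurable_eq (α := Set.Icc (0 : ℝ) T)).trans (borel_eq_generateFrom_Iic _))
    isPiSystem_Iic with
  | empty => simp
  | basic s hs =>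
    obtain ⟨t, rfl⟩ := hs
    exact h0 t
  | compl s hs h =>
    have := integral_add_compl hs hfi
    rwa [h (measure_lt_top _ _), zero_add, h1] at this
  | iUnion s hd hs h =>
    refine (hasSum_integral_iUnion hs hd hfi.integrableOn).unique ?_
    refine hasSum_zero.congr_fun fun i => ?_
    exact h i (measure_lt_top _ _)

/-- Intervals starting at `0` suffice: `(0, t]` and `[0, t]` differ by a null set. -/
theorem topologicalClosure_span_indicator_Ioc (hT : 0 ≤ T) {B E : Type*} [NormedAddCommGroup E]
    [InnerProductSpace ℝ E] {u : B → E}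
    (hu : (Submodule.span ℝ (Set.range u)).topologicalClosure = ⊤) :
    (Submodule.span ℝ (Set.range fun p : {p : Set.Icc (0 : ℝ) T × Set.Icc (0 : ℝ) T //
      p.1 ≤ p.2} × B => toL2 (timeMeasure T) (Set.indicator (Set.Ioc p.1.1.1 p.1.1.2)
        fun _ => u p.2))).topologicalClosure = ⊤ := by
  refine eq_top_iff.mpr ((topologicalClosure_span_tensorLp
    (topologicalClosure_span_iicLp hT) hu).symm.le.trans
      (Submodule.topologicalClosure_mono (Submodule.span_mono ?_)))
  rintro _ ⟨⟨t, c⟩, rfl⟩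
  refine ⟨⟨⟨(⟨0, le_rfl, hT⟩, t), t.2.1⟩, c⟩, ?_⟩
  dsimp only
  rw [toL2_indicator_Ioc (show (⟨0, le_rfl, hT⟩ : Set.Icc (0 : ℝ) T) ≤ t from t.2.1),
    iicLp_eq_zero (t := ⟨0, le_rfl, hT⟩) rfl, sub_zero]

end Indicator

/-! ### Gaussian laws pass to `L²` limits -/

section Limits

variable {Ω : Type*} [MeasurableSpace Ω] {P : Measure Ω} [IsProbabilityMeasure P]

theorem integral_abs_le_norm (X : Lp ℝ 2 P) : ∫ ω, |X ω| ∂P ≤ ‖X‖ := by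
  have h1 : ⟪Lp.const 2 P (1 : ℝ), |X|⟫_ℝ = ∫ ω, |X ω| ∂P := by
    rw [L2.inner_def]
    refine integral_congr_ae ?_
    filter_upwards [Lp.coeFn_const 2 P (1 : ℝ), Lp.coeFn_abs X] with ω h1 h2
    rw [h1, h2]
    simp
  rw [← h1]
  refine (real_inner_le_norm _ _).trans ?_
  have h2 : ‖Lp.const 2 P (1 : ℝ)‖ = 1 := by
    rw [Lp.norm_const' 2 P 1 (by norm_num) (by norm_num)]
    simp
  rw [norm_abs_eq_norm, h2, one_mul]

theorem continuous_integral_exp (r : ℝ) :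
    Continuous fun X : Lp ℝ 2 P => ∫ ω, Complex.exp (Complex.I * ((r * X ω : ℝ) : ℂ)) ∂P := by
  have hm : ∀ X : Lp ℝ 2 P, AEStronglyMeasurable
      (fun ω => Complex.exp (Complex.I * ((r * X ω : ℝ) : ℂ))) P := fun X =>
    (show Continuous fun y : ℝ => Complex.exp (Complex.I * ((r * y : ℝ) : ℂ)) by
      fun_prop).comp_aestronglyMeasurable (Lp.aestronglyMeasurable X)
  have hn : ∀ y : ℝ, ‖Complex.exp (Complex.I * (y : ℂ))‖ = 1 := fun y => by
    rw [mul_comm, Complex.norm_exp_ofReal_mul_I]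
  have hi : ∀ X : Lp ℝ 2 P, Integrable
      (fun ω => Complex.exp (Complex.I * ((r * X ω : ℝ) : ℂ))) P := fun X =>
    Integrable.of_bound (hm X) 1 (Filter.Eventually.of_forall fun ω => (hn _).le)
  refine LipschitzWith.continuous (K := ‖r‖₊) (LipschitzWith.of_dist_le_mul fun X Y => ?_)
  rw [dist_eq_norm, dist_eq_norm, ← integral_sub (hi X) (hi Y)]
  calc _ ≤ ∫ ω, |r| * |(X - Y : Lp ℝ 2 P) ω| ∂P := by
        refine norm_integral_le_of_norm_le
          (((Lp.memLp (X - Y)).integrable (by norm_num)).abs.const_mul _) ?_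
        filter_upwards [Lp.coeFn_sub X Y] with ω hω
        have : Complex.exp (Complex.I * ((r * X ω : ℝ) : ℂ))
            - Complex.exp (Complex.I * ((r * Y ω : ℝ) : ℂ))
            = Complex.exp (Complex.I * ((r * Y ω : ℝ) : ℂ))
              * (Complex.exp (Complex.I * ((r * (X ω - Y ω) : ℝ) : ℂ)) - 1) := by
          rw [mul_sub, ← Complex.exp_add, mul_one]
          congr 2
          push_cast
          ring
        rw [this, norm_mul, hn, one_mul, hω, Pi.sub_apply, ← abs_mul]
        exact Real.norm_exp_I_mul_ofReal_sub_one_le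
    _ ≤ _ := by
        rw [integral_const_mul]
        exact mul_le_mul_of_nonneg_left (integral_abs_le_norm _) (abs_nonneg _)

omit [IsProbabilityMeasure P] in
theorem charFun_map_eq_integral_exp {X : Ω → ℝ} (hX : AEMeasurable X P) (r : ℝ) :
    charFun (P.map X) r = ∫ ω, Complex.exp (Complex.I * ((r * X ω : ℝ) : ℂ)) ∂P := by
  rw [charFun_apply, integral_map hX (by fun_prop)]
  refine integral_congr_ae (Filter.Eventually.of_forall fun ω => ?_)
  simp [mul_comm]

/-- At each `r`, the characteristic function of `I g` and that of the Gaussian law are continuous in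
`g`. -/
theorem isIsonormal_of_dense {𝓗 : Type*} [NormedAddCommGroup 𝓗] [InnerProductSpace ℝ 𝓗]
    (I : 𝓗 →L[ℝ] Lp ℝ 2 P) {S : Set 𝓗} (hS : Dense S)
    (h : ∀ g ∈ S, P.map (I g) = gaussianReal 0 (‖g‖₊ ^ 2)) : IsIsonormal I := by
  intro g
  have hm : ∀ g, AEMeasurable (I g) P := fun g => (Lp.aestronglyMeasurable _).aemeasurable
  have : IsProbabilityMeasure (P.map (I g)) := Measure.isProbabilityMeasure_map (hm g)
  refine Measure.ext_of_charFun (funext fun r => ?_)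
  rw [charFun_map_eq_integral_exp (hm g)]
  have hc : Continuous fun g : 𝓗 => charFun (gaussianReal 0 (‖g‖₊ ^ 2)) r := by
    simp_rw [charFun_gaussianReal]
    fun_prop
  refine congrFun (Continuous.ext_on hS ((continuous_integral_exp r).comp I.continuous) hc
    fun g hg => ?_) g
  dsimp only [Function.comp_apply]
  rw [← h g hg, charFun_map_eq_integral_exp (hm g)]

end Limits

/-! ### Covariance and Gaussianity of the `Q`-Brownian motion -/

section Brownian

variable {Ω : Type*} [MeasurableSpace Ω] {P : Measure Ω} [IsProbabilityMeasure P]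
  {Z : Type*} [NormedAddCommGroup Z] [InnerProductSpace ℝ Z]
  [MeasurableSpace Z] [BorelSpace Z] {T : ℝ} {Q : Z →L[ℝ] Z} {W : Set.Icc (0 : ℝ) T → Ω → Z}

namespace IsQBrownianMotion

variable (hW : IsQBrownianMotion Q W P) (hQ : Q.IsPositive)
include hW

omit [IsProbabilityMeasure P] in
theorem measurable_inner (t : Set.Icc (0 : ℝ) T) (z : Z) : Measurable fun ω => ⟪W t ω, z⟫_ℝ :=
  (show Continuous fun y : Z => ⟪y, z⟫_ℝ by fun_prop).measurable.comp (hW.measurable t)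

omit [IsProbabilityMeasure P] in
theorem indep_inner_sub {s t : Set.Icc (0 : ℝ) T} (hst : s ≤ t) (z z' : Z) :
    IndepFun (fun ω => ⟪W s ω, z⟫_ℝ) (fun ω => ⟪W t ω - W s ω, z'⟫_ℝ) P := by
  have h := hW.indep.indepFun_eval_sub (r := ⟨0, le_rfl, s.2.1.trans s.2.2⟩) (s := s) (t := t)
    s.2.1 hst (Filter.Eventually.of_forall (hW.zero _ rfl))
  have hm : ∀ z : Z, Measurable fun y : Z => ⟪y, z⟫_ℝ := fun z =>
    (show Continuous fun y : Z => ⟪y, z⟫_ℝ by fun_prop).measurable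
  exact h.comp (hm z) (hm z')

include hQ

theorem map_inner (t : Set.Icc (0 : ℝ) T) (z : Z) :
    P.map (fun ω => ⟪W t ω, z⟫_ℝ) = gaussianReal 0 ((t : ℝ) * ⟪Q z, z⟫_ℝ).toNNReal := by
  have hm := hW.measurable_inner t z
  have : IsProbabilityMeasure (P.map fun ω => ⟪W t ω, z⟫_ℝ) :=
    Measure.isProbabilityMeasure_map hm.aemeasurable
  have hc : charFun (P.map (W t)) = fun z =>
      Complex.exp (-(((t : ℝ) * ⟪Q z, z⟫_ℝ : ℝ) : ℂ) / 2) := by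
    ext z
    -- The Gaussian hypothesis concerns `s < t` only, so `t = 0` is treated through `W_0 = 0`.
    rcases eq_or_lt_of_le t.2.1 with h0 | h0
    · have : W t = fun _ => 0 := funext (hW.zero t h0.symm)
      rw [this, ← h0]
      simp
    · have h1 := hW.gaussian ⟨0, le_rfl, t.2.1.trans t.2.2⟩ t h0 z
      simp_rw [hW.zero ⟨0, le_rfl, t.2.1.trans t.2.2⟩ rfl, sub_zero] at h1
      exact h1
  refine Measure.ext_of_charFun (funext fun r => ?_)
  have h2 : charFun (P.map fun ω => ⟪W t ω, z⟫_ℝ) r = charFun (P.map (W t)) (r • z) := by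
    rw [charFun_apply, charFun_apply, integral_map hm.aemeasurable (by fun_prop),
      integral_map (hW.measurable t).aemeasurable
        (by fun_prop : Continuous fun y : Z =>
          Complex.exp (((⟪y, r • z⟫_ℝ : ℝ) : ℂ) * Complex.I)).measurable.aestronglyMeasurable]
    refine integral_congr_ae (Filter.Eventually.of_forall fun ω => ?_)
    simp [real_inner_smul_right]
  rw [h2, hc, charFun_gaussianReal, Real.coe_toNNReal _
    (mul_nonneg t.2.1 (hQ.inner_nonneg_left z))]
  simp only [map_smul, real_inner_smul_left, real_inner_smul_right]
  push_cast
  congr 1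
  ring

theorem hasLaw_inner (t : Set.Icc (0 : ℝ) T) (z : Z) : HasLaw (fun ω => ⟪W t ω, z⟫_ℝ)
    (gaussianReal 0 ((t : ℝ) * ⟪Q z, z⟫_ℝ).toNNReal) P :=
  ⟨(hW.measurable_inner t z).aemeasurable, hW.map_inner hQ t z⟩

theorem memLp_inner (t : Set.Icc (0 : ℝ) T) (z : Z) : MemLp (fun ω => ⟪W t ω, z⟫_ℝ) 2 P :=
  (hW.hasLaw_inner hQ t z).hasGaussianLaw.memLp_two

theorem integral_inner_eq_zero (t : Set.Icc (0 : ℝ) T) (z : Z) : ∫ ω, ⟪W t ω, z⟫_ℝ ∂P = 0 := by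
  rw [(hW.hasLaw_inner hQ t z).integral_eq, integral_id_gaussianReal]

theorem integral_inner_sq (t : Set.Icc (0 : ℝ) T) (z : Z) :
    ∫ ω, ⟪W t ω, z⟫_ℝ ^ 2 ∂P = (t : ℝ) * ⟪Q z, z⟫_ℝ := by
  have h := (hW.hasLaw_inner hQ t z).variance_eq
  rw [variance_of_integral_eq_zero (hW.measurable_inner t z).aemeasurable
    (hW.integral_inner_eq_zero hQ t z), variance_id_gaussianReal, Real.coe_toNNReal _
    (mul_nonneg t.2.1 (hQ.inner_nonneg_left z))] at h
  exact h

theorem integrable_inner_mul (s t : Set.Icc (0 : ℝ) T) (z z' : Z) :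
    Integrable (fun ω => ⟪W s ω, z⟫_ℝ * ⟪W t ω, z'⟫_ℝ) P :=
  (hW.memLp_inner hQ s z).integrable_mul (hW.memLp_inner hQ t z')

/-- Polarization of the variance formula; symmetry of `Q` merges the cross terms. -/
theorem integral_inner_mul_self (t : Set.Icc (0 : ℝ) T) (z z' : Z) :
    ∫ ω, ⟪W t ω, z⟫_ℝ * ⟪W t ω, z'⟫_ℝ ∂P = (t : ℝ) * ⟪Q z, z'⟫_ℝ := by
  have h := hW.integral_inner_sq hQ t (z + z')
  have h1 : ∀ ω, ⟪W t ω, z + z'⟫_ℝ ^ 2 = (⟪W t ω, z⟫_ℝ ^ 2 + ⟪W t ω, z'⟫_ℝ ^ 2)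
      + 2 * (⟪W t ω, z⟫_ℝ * ⟪W t ω, z'⟫_ℝ) := fun ω => by
    rw [inner_add_right]
    ring
  have h2 : ∀ z, Integrable (fun ω => ⟪W t ω, z⟫_ℝ ^ 2) P := fun z =>
    (hW.memLp_inner hQ t z).integrable_sq
  simp_rw [h1] at h
  rw [integral_add ((h2 z).fun_add (h2 z'))
    ((hW.integrable_inner_mul hQ t t z z').const_mul 2), integral_add (h2 z) (h2 z'), integral_const_mul,
    hW.integral_inner_sq hQ,
    hW.integral_inner_sq hQ, map_add, inner_add_left, inner_add_right, inner_add_right] at h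
  have h3 : ⟪Q z', z⟫_ℝ = ⟪Q z, z'⟫_ℝ := by
    rw [real_inner_comm]
    exact (hQ.isSymmetric z z').symm
  rw [h3] at h
  linarith

/-- Split `W_t = W_s + (W_t - W_s)`; the increment is independent of `W_s` and `⟪W_s, z⟫` is
centered. -/
theorem integral_inner_mul_of_le {s t : Set.Icc (0 : ℝ) T} (hst : s ≤ t) (z z' : Z) :
    ∫ ω, ⟪W s ω, z⟫_ℝ * ⟪W t ω, z'⟫_ℝ ∂P = (s : ℝ) * ⟪Q z, z'⟫_ℝ := by
  have h1 : ∀ ω, ⟪W s ω, z⟫_ℝ * ⟪W t ω, z'⟫_ℝ = ⟪W s ω, z⟫_ℝ * ⟪W s ω, z'⟫_ℝ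
      + ⟪W s ω, z⟫_ℝ * ⟪W t ω - W s ω, z'⟫_ℝ := fun ω => by
    rw [inner_sub_left]
    ring
  have hm := (hW.memLp_inner hQ t z').sub (hW.memLp_inner hQ s z')
  have h2 : MemLp (fun ω => ⟪W t ω - W s ω, z'⟫_ℝ) 2 P := by
    simp_rw [inner_sub_left]
    exact hm
  have h3 : Integrable (fun ω => ⟪W s ω, z⟫_ℝ * ⟪W t ω - W s ω, z'⟫_ℝ) P :=
    (hW.memLp_inner hQ s z).integrable_mul h2
  simp_rw [h1]
  rw [integral_add (hW.integrable_inner_mul hQ s s z z') h3,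
    hW.integral_inner_mul_self hQ, (hW.indep_inner_sub hst z z').integral_fun_mul_eq_mul_integral
      (hW.memLp_inner hQ s z).aestronglyMeasurable h2.aestronglyMeasurable,
    hW.integral_inner_eq_zero hQ, zero_mul, add_zero]

theorem integral_inner_mul (s t : Set.Icc (0 : ℝ) T) (z z' : Z) :
    ∫ ω, ⟪W s ω, z⟫_ℝ * ⟪W t ω, z'⟫_ℝ ∂P = min (s : ℝ) (t : ℝ) * ⟪Q z, z'⟫_ℝ := by
  rcases le_total s t with h | h
  · rw [hW.integral_inner_mul_of_le hQ h, min_eq_left (show (s : ℝ) ≤ t from h)]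
  · simp_rw [mul_comm ⟪W s _, z⟫_ℝ]
    rw [hW.integral_inner_mul_of_le hQ h, min_eq_right (show (t : ℝ) ≤ s from h), real_inner_comm]
    congr 1
    exact (hQ.isSymmetric z z').symm

variable [CompleteSpace Z] [TopologicalSpace.SeparableSpace Z]

theorem isGaussianProcess : IsGaussianProcess W P := by
  rcases lt_or_ge T 0 with hT | hT
  · have : IsEmpty (Set.Icc (0 : ℝ) T) := ⟨fun t => absurd (t.2.1.trans t.2.2) (not_le.mpr hT)⟩
    exact ⟨fun I => .of_subsingleton⟩
  have : SecondCountableTopology Z := UniformSpace.secondCountable_of_separable Z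
  let _ : OrderBot (Set.Icc (0 : ℝ) T) := { bot := ⟨0, le_rfl, hT⟩, bot_le := fun t => t.2.1 }
  refine hW.indep.isGaussianProcess (fun t => ?_) (Filter.Eventually.of_forall (hW.zero ⊥ rfl))
  refine ⟨isGaussian_of_map_eq_gaussianReal fun L =>
    ⟨0, ((t : ℝ) * ⟪Q ((InnerProductSpace.toDual ℝ Z).symm L),
      (InnerProductSpace.toDual ℝ Z).symm L⟫_ℝ).toNNReal, ?_⟩⟩
  rw [Measure.map_map L.continuous.measurable (hW.measurable t), ← hW.map_inner hQ]
  congr 1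
  ext ω
  rw [real_inner_comm, InnerProductSpace.toDual_symm_apply]
  rfl

theorem isGaussianProcess_inner :
    IsGaussianProcess (fun (p : Set.Icc (0 : ℝ) T × Z) ω => ⟪W p.1 ω, p.2⟫_ℝ) P := by
  have : SecondCountableTopology Z := UniformSpace.secondCountable_of_separable Z
  have h := ((hW.isGaussianProcess hQ).comp_right
    (fun p : Set.Icc (0 : ℝ) T × Z => p.1)).comp_left fun p => innerSL ℝ p.2
  refine h.congr fun p => Filter.Eventually.of_forall fun ω => ?_
  exact real_inner_comm _ _

end IsQBrownianMotion

end Brownian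

/-! ### Existence of the Wiener integral and the noise basis -/

section Wiener

variable {Ω : Type*} [MeasurableSpace Ω] {P : Measure Ω} [IsProbabilityMeasure P]
  {Z : Type*} [NormedAddCommGroup Z] [InnerProductSpace ℝ Z] [CompleteSpace Z]
  [MeasurableSpace Z] [BorelSpace Z] {T : ℝ} {Q : Z →L[ℝ] Z} {W : Set.Icc (0 : ℝ) T → Ω → Z}
  {ι : Type*}

namespace IsQBrownianMotion

variable (hW : IsQBrownianMotion Q W P) (hQ : Q.IsPositive)

omit [IsProbabilityMeasure P] [MeasurableSpace Z] [BorelSpace Z] in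
theorem topologicalClosure_span_cmFunctional (hR : (posSqrt Q).IsPositive)
    (e : HilbertBasis ι ℝ Z) :
    (Submodule.span ℝ (Set.range (rangeFunctional (posSqrt Q)))).topologicalClosure = ⊤ := by
  refine eq_top_iff.mpr ((topologicalClosure_span_rangeFunctional e hR (s := Set.univ)
    (fun i hi => absurd trivial hi)).symm.le.trans
      (Submodule.topologicalClosure_mono (Submodule.span_mono ?_)))
  rintro _ ⟨i, rfl⟩
  exact ⟨e i, rfl⟩

omit [IsProbabilityMeasure P] [MeasurableSpace Z] [BorelSpace Z] in
theorem topologicalClosure_span_integrand (hT : 0 ≤ T) (hR : (posSqrt Q).IsPositive)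
    (e : HilbertBasis ι ℝ Z) :
    (Submodule.span ℝ (Set.range fun p : {p : Set.Icc (0 : ℝ) T × Set.Icc (0 : ℝ) T //
      p.1 ≤ p.2} × Z => toL2 (timeMeasure T) (Set.indicator (Set.Ioc p.1.1.1 p.1.1.2) fun _ =>
        (innerSL ℝ p.2 ∘L RangeSpace.inclL (posSqrt Q) :
          StrongDual ℝ (CMSpace Q))))).topologicalClosure = ⊤ :=
  topologicalClosure_span_indicator_Ioc hT (E := StrongDual ℝ (CMSpace Q))
    (u := rangeFunctional (posSqrt Q)) (topologicalClosure_span_cmFunctional hR e)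

include hW hQ

/-- The Gram matrices of `1_{[0,t]} ⟪·, z⟫` and of `⟪W_t, z⟫` agree, both being `min(s,t) ⟪Qz, z'⟫`,
so an isometry exists. On the dense span its values are finite sums from a Gaussian process. -/
theorem exists_isIsonormal [TopologicalSpace.SeparableSpace Z] (hT : 0 ≤ T)
    (hR : (posSqrt Q).IsPositive)
    (hRR : posSqrt Q ∘L posSqrt Q = Q) (e : HilbertBasis ι ℝ Z) :
    ∃ I : Lp (StrongDual ℝ (CMSpace Q)) 2 (timeMeasure T) →L[ℝ] Lp ℝ 2 P,
      (∀ t z, I (tensorLp (iicLp t) (rangeFunctional (posSqrt Q) z))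
        = toL2 P fun ω => ⟪W t ω, z⟫_ℝ) ∧ IsIsonormal I := by
  let v : Set.Icc (0 : ℝ) T × Z → Lp (StrongDual ℝ (CMSpace Q)) 2 (timeMeasure T) :=
    fun p => tensorLp (iicLp p.1) (rangeFunctional (posSqrt Q) p.2)
  let u : Set.Icc (0 : ℝ) T × Z → Lp ℝ 2 P := fun p => toL2 P fun ω => ⟪W p.1 ω, p.2⟫_ℝ
  have hu : ∀ p, u p =ᵐ[P] fun ω => ⟪W p.1 ω, p.2⟫_ℝ := fun p =>
    coeFn_toL2 (hW.memLp_inner hQ p.1 p.2)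
  have hv : (Submodule.span ℝ (Set.range v)).topologicalClosure = ⊤ :=
    topologicalClosure_span_tensorLp (topologicalClosure_span_iicLp hT)
      (topologicalClosure_span_cmFunctional hR e)
  have hRQ : ∀ z, posSqrt Q (posSqrt Q z) = Q z := fun z => by
    nth_rw 3 [← hRR]
    rfl
  have hg : ∀ p p', ⟪u p, u p'⟫_ℝ = ⟪v p, v p'⟫_ℝ := by
    intro p p'
    simp only [v]
    rw [inner_tensorLp_tensorLp, inner_iicLp_iicLp, inner_rangeFunctional hR, hRQ,
      ← hW.integral_inner_mul hQ, L2.inner_def]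
    refine integral_congr_ae ?_
    filter_upwards [hu p, hu p'] with ω h1 h2
    rw [h1, h2]
    simp [mul_comm]
  obtain ⟨I, hI, hIn⟩ := exists_isometry_of_gram hv hg
  refine ⟨I, fun t z => hI (t, z), isIsonormal_of_dense I
    (S := (Submodule.span ℝ (Set.range v) : Set _)) ?_ fun h hh => ?_⟩
  · rw [dense_iff_closure_eq, ← Submodule.topologicalClosure_coe, hv]
    rfl
  obtain ⟨c, rfl⟩ := (Finsupp.mem_span_range_iff_exists_finsupp).mp hh
  set h := c.sum fun p a => a • v p with hh
  have hIh : I h =ᵐ[P] fun ω => ∑ p ∈ c.support, c p • ⟪W p.1 ω, p.2⟫_ℝ := by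
    have h1 : I h = ∑ p ∈ c.support, c p • u p := by
      rw [hh, Finsupp.sum, map_sum]
      exact Finset.sum_congr rfl fun p _ => by rw [map_smul, hI]
    rw [h1]
    refine (Lp.coeFn_fun_finsetSum _ _).trans ?_
    have h2 : ∀ᵐ ω ∂P, ∀ p : c.support, (c p • u p : Lp ℝ 2 P) ω
        = c p • ⟪W p.1.1 ω, p.1.2⟫_ℝ := by
      refine ae_all_iff.mpr fun p => ?_
      filter_upwards [hu p, Lp.coeFn_smul (c p) (u p)] with ω h3 h4
      rw [h4, Pi.smul_apply, h3]
    filter_upwards [h2] with ω hω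
    exact Finset.sum_congr rfl fun p hp => hω ⟨p, hp⟩
  have hlaw := (((hW.isGaussianProcess_inner hQ).smul fun p => c p).hasGaussianLaw_fun_sum
    (I := c.support)).congr hIh.symm
  have h0 : ∫ ω, I h ω ∂P = 0 := by
    have hi : ∀ p ∈ c.support, Integrable (fun ω => c p • ⟪W p.1 ω, p.2⟫_ℝ) P := fun p _ =>
      ((hW.memLp_inner hQ p.1 p.2).integrable (by norm_num)).smul (c p)
    rw [integral_congr_ae hIh, integral_finsetSum _ hi]
    refine Finset.sum_eq_zero fun p _ => ?_
    rw [integral_smul, hW.integral_inner_eq_zero hQ, smul_zero]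
  rw [hlaw.map_eq_gaussianReal, h0, variance_of_integral_eq_zero
    (Lp.aestronglyMeasurable _).aemeasurable h0]
  congr 1
  have h5 : ∫ ω, (I h ω) ^ 2 ∂P = ‖h‖ ^ 2 := by
    rw [← hIn, ← real_inner_self_eq_norm_sq, L2.inner_def]
    refine integral_congr_ae (Filter.Eventually.of_forall fun ω => ?_)
    simp [sq]
  rw [h5, Real.toNNReal_pow (norm_nonneg _), norm_toNNReal]

variable [TopologicalSpace.SeparableSpace Z] (hT : 0 ≤ T) {lam : ι → ℝ} (e : HilbertBasis ι ℝ Z)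
  (he : ∀ i, Q (e i) = lam i • e i)
include hT he

/-- The defining integrands of `wienerIntegral` are total, so it coincides with the isometry just
built. -/
theorem wienerIntegral_spec :
    IsIsonormal (wienerIntegral Q W P) ∧
      (∀ t z, wienerIntegral Q W P (tensorLp (iicLp t) (rangeFunctional (posSqrt Q) z))
        = toL2 P fun ω => ⟪W t ω, z⟫_ℝ) := by
  obtain ⟨hR, hRR⟩ := posSqrt_spec (exists_isPositive_comp_self e hQ he)
  obtain ⟨I, hI, hIn⟩ := hW.exists_isIsonormal hQ hT hR hRR e
  have : wienerIntegral Q W P = I := by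
    refine extendFamily_eq (topologicalClosure_span_integrand hT hR e) fun p => ?_
    change I (toL2 (timeMeasure T) (Set.indicator (Set.Ioc p.1.1.1 p.1.1.2) fun _ =>
      rangeFunctional (posSqrt Q) p.2)) = _
    rw [toL2_indicator_Ioc p.1.2, ← tensorLpL_apply, map_sub, sub_apply,
      map_sub, tensorLpL_apply, tensorLpL_apply, hI, hI,
      toL2_eq_toLp (hW.memLp_inner hQ _ _), toL2_eq_toLp (hW.memLp_inner hQ _ _),
      ← MemLp.toLp_sub, ← toL2_eq_toLp]
    simp_rw [inner_sub_left]
    rfl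
  rw [this]
  exact ⟨hIn, hI⟩

theorem aestronglyMeasurable_wienerIntegral
    (h : Lp (StrongDual ℝ (CMSpace Q)) 2 (timeMeasure T)) :
    AEStronglyMeasurable[sigmaW W] (wienerIntegral Q W P h) P := by
  obtain ⟨hR, hRR⟩ := posSqrt_spec (exists_isPositive_comp_self e hQ he)
  have hc := isClosed_aestronglyMeasurable (F := ℝ) (p := 2) (μ := P) (sigmaW_le hW.measurable)
  have hv := topologicalClosure_span_tensorLp (E := StrongDual ℝ (CMSpace Q))
    (u := rangeFunctional (posSqrt Q)) (topologicalClosure_span_iicLp hT)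
    (topologicalClosure_span_cmFunctional hR e)
  have hle : (Submodule.span ℝ (Set.range fun p : Set.Icc (0 : ℝ) T × Z =>
      tensorLp (iicLp p.1) (rangeFunctional (posSqrt Q) p.2))).topologicalClosure
      ≤ (lpMeas ℝ ℝ (sigmaW W) 2 P).comap (wienerIntegral Q W P).toLinearMap := by
    refine Submodule.topologicalClosure_minimal _ (Submodule.span_le.mpr ?_)
      (hc.preimage (wienerIntegral Q W P).continuous)
    rintro _ ⟨⟨t, z⟩, rfl⟩
    change AEStronglyMeasurable[sigmaW W] (wienerIntegral Q W P _) P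
    rw [(hW.wienerIntegral_spec hQ hT e he).2]
    refine AEStronglyMeasurable.congr ?_ (coeFn_toL2 (hW.memLp_inner hQ t z)).symm
    have hm : Measurable[sigmaW W] (W t) := by
      rw [measurable_iff_comap_le]
      exact le_iSup (fun t => (inferInstance : MeasurableSpace Z).comap (W t)) t
    have hm' : Measurable[sigmaW W] fun ω => ⟪W t ω, z⟫_ℝ :=
      (show Continuous fun y : Z => ⟪y, z⟫_ℝ by fun_prop).measurable.comp hm
    exact hm'.stronglyMeasurable.aestronglyMeasurable
  rw [hv] at hle
  exact hle trivial

/-- The vectors `g_j ⊗ λ_i^{-1/2} ⟪·, e_i⟫` of `L²([0, T]; L₂(Z₀; ℝ))`. -/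
noncomputable def noiseVector (Q : Z →L[ℝ] Z) (e : ι → Z) (lam : ι → ℝ)
    (g : ℕ → Lp ℝ 2 (timeMeasure T)) (p : {i : ι // 0 < lam i} × ℕ) :
    Lp (StrongDual ℝ (CMSpace Q)) 2 (timeMeasure T) :=
  tensorLp (g p.2) ((1 / √(lam p.1)) • rangeFunctional (posSqrt Q) (e p.1))

/-- For fixed `i`, both sides are continuous linear in the integrand and agree on indicators of
intervals. -/
theorem xi_eq_wienerIntegral (g : ℕ → Lp ℝ 2 (timeMeasure T)) (p : {i : ι // 0 < lam i} × ℕ) :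
    xi W P e lam g p = wienerIntegral Q W P (noiseVector Q e lam g p) := by
  let l : StrongDual ℝ (CMSpace Q) := (1 / √(lam p.1)) • rangeFunctional (posSqrt Q) (e p.1)
  let J : Lp ℝ 2 (timeMeasure T) →L[ℝ] Lp ℝ 2 P := wienerIntegral Q W P ∘L (tensorLpL.flip l)
  have hJ : ∀ g, J g = wienerIntegral Q W P (tensorLp g l) := fun g => rfl
  have hmem : ∀ t, MemLp (fun ω => (1 / √(lam p.1)) * ⟪W t ω, e p.1⟫_ℝ) 2 P := fun t =>
    (hW.memLp_inner hQ t (e p.1)).const_mul _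
  have hJt : ∀ t, J (iicLp t) = toL2 P fun ω => (1 / √(lam p.1)) * ⟪W t ω, e p.1⟫_ℝ := by
    intro t
    rw [hJ, tensorLp_smul_right, map_smul, (hW.wienerIntegral_spec hQ hT e he).2,
      toL2_eq_toLp (hW.memLp_inner hQ t (e p.1)), ← MemLp.toLp_const_smul, ← toL2_eq_toLp]
    rfl
  have : scalarWienerIntegral (fun t ω => (1 / √(lam p.1)) * ⟪W t ω, e p.1⟫_ℝ) P = J := by
    refine extendFamily_eq ?_ fun q => ?_
    · have := topologicalClosure_span_indicator_Ioc hT (B := Unit) (u := fun _ => (1 : ℝ)) (by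
        have : (Submodule.span ℝ (Set.range fun _ : Unit => (1 : ℝ))) = ⊤ := by
          rw [Set.range_const]
          exact Ideal.span_singleton_one
        rw [this]
        exact eq_top_iff.mpr (Submodule.le_topologicalClosure _))
      refine eq_top_iff.mpr (this.symm.le.trans (Submodule.topologicalClosure_mono
        (Submodule.span_mono ?_)))
      rintro _ ⟨q, rfl⟩
      exact ⟨q.1, rfl⟩
    · rw [toL2_indicator_Ioc q.2]
      -- For real values, the tensor with `1` is the function itself, so the vector-valued interval
      -- formula covers the scalar integral.
      have h1 : ∀ f : Lp ℝ 2 (timeMeasure T), tensorLp f (1 : ℝ) = f := fun f => by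
        refine Lp.ext ?_
        filter_upwards [coeFn_tensorLp f (1 : ℝ)] with r hr
        rw [hr, smul_eq_mul, mul_one]
      rw [h1, map_sub, hJt, hJt, toL2_eq_toLp (hmem _), toL2_eq_toLp (hmem _), ← MemLp.toLp_sub,
        ← toL2_eq_toLp]
      rfl
  rw [xi, this, hJ]
  rfl

-- The factor `λ_i^{-1/2}` appears twice and cancels `⟪Q e_i, e_i⟫ = λ_i`.
omit hW hT [TopologicalSpace.SeparableSpace Z] [MeasurableSpace Z] [BorelSpace Z] in
theorem orthonormal_noiseVector (g : HilbertBasis ℕ ℝ (Lp ℝ 2 (timeMeasure T))) :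
    Orthonormal ℝ (noiseVector Q e lam g) := by
  classical
  obtain ⟨hR, hRR⟩ := posSqrt_spec (exists_isPositive_comp_self e hQ he)
  have hRQ : ∀ z, posSqrt Q (posSqrt Q z) = Q z := fun z => by
    nth_rw 3 [← hRR]
    rfl
  rw [orthonormal_iff_ite]
  rintro ⟨i, j⟩ ⟨i', j'⟩
  rw [noiseVector, noiseVector, inner_tensorLp_tensorLp, ← rangeFunctional_smul,
    ← rangeFunctional_smul, inner_rangeFunctional hR, hRQ, map_smul, he, real_inner_smul_left,
    real_inner_smul_left, real_inner_smul_right, orthonormal_iff_ite.mp g.orthonormal,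
    orthonormal_iff_ite.mp e.orthonormal]
  by_cases hj : j = j'
  · by_cases hi : i = i'
    · subst hj hi
      have h1 := Real.mul_self_sqrt i.2.le
      have h2 : √(lam i) ≠ 0 := (Real.sqrt_pos.mpr i.2).ne'
      simp only [if_true]
      field_simp
      rw [sq, h1]
    · have : (i : ι) ≠ i' := fun h => hi (Subtype.ext h)
      simp [hi, this]
  · simp [hj]

-- Indices with `λ_i = 0` may be omitted, because `Q^{1/2} e_i = 0` there.
omit hW hT [TopologicalSpace.SeparableSpace Z] [MeasurableSpace Z] [BorelSpace Z] in
theorem topologicalClosure_span_noiseVector (g : HilbertBasis ℕ ℝ (Lp ℝ 2 (timeMeasure T))) :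
    (Submodule.span ℝ (Set.range (noiseVector Q e lam g))).topologicalClosure = ⊤ := by
  obtain ⟨hR, hRR⟩ := posSqrt_spec (exists_isPositive_comp_self e hQ he)
  have h0 : ∀ i ∉ {i | 0 < lam i}, posSqrt Q (e i) = 0 := by
    intro i hi
    have hl : lam i = 0 := le_antisymm (not_lt.mp hi) (eigenvalue_nonneg e hQ he i)
    rw [← norm_eq_zero, ← sq_eq_zero_iff, ← real_inner_self_eq_norm_sq]
    have h1 : ⟪posSqrt Q (e i), posSqrt Q (e i)⟫_ℝ = ⟪posSqrt Q (posSqrt Q (e i)), e i⟫_ℝ :=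
      (hR.isSymmetric (posSqrt Q (e i)) (e i)).symm
    have h2 : posSqrt Q (posSqrt Q (e i)) = Q (e i) := by
      nth_rw 3 [← hRR]
      rfl
    rw [h1, h2, he, hl, zero_smul, inner_zero_left]
  have h := topologicalClosure_span_tensorLp (E := StrongDual ℝ (CMSpace Q))
    (u := fun i : {i | 0 < lam i} => rangeFunctional (posSqrt Q) (e i)) g.dense_span
    (topologicalClosure_span_rangeFunctional e hR h0)
  refine eq_top_iff.mpr (h.symm.le.trans (Submodule.topologicalClosure_mono
    (Submodule.span_le.mpr ?_)))
  rintro _ ⟨⟨j, i⟩, rfl⟩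
  have h3 : tensorLp (g j) (rangeFunctional (posSqrt Q) (e i))
      = √(lam i) • noiseVector Q e lam g (i, j) := by
    have h2 : √(lam i) ≠ 0 := (Real.sqrt_pos.mpr i.2).ne'
    rw [noiseVector, ← tensorLp_smul_right, smul_smul, mul_one_div_cancel h2, one_smul]
  change tensorLp (g j) (rangeFunctional (posSqrt Q) (e i)) ∈ _
  rw [h3]
  exact Submodule.smul_mem _ _ (Submodule.subset_span ⟨(i, j), rfl⟩)

end IsQBrownianMotion

end Wiener

/-! ### Wick polynomials as normalized Hermite products -/

section Wick

theorem polyEval_hermiteProd {Ω : Type*} [MeasurableSpace Ω] {P : Measure Ω} {𝓗 : Type*}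
    [NormedAddCommGroup 𝓗] [InnerProductSpace ℝ 𝓗] (I : 𝓗 →L[ℝ] Lp ℝ 2 P) {κ : Type*} (b : κ → 𝓗)
    (α : κ →₀ ℕ) (ω : Ω) : polyEval I (hermiteProd b α) ω
      = α.prod fun p n => Polynomial.aeval (I (b p) ω) (Polynomial.hermite n) := by
  rw [polyEval, hermiteProd, Finsupp.prod, map_prod]
  refine Finset.prod_congr rfl fun p _ => ?_
  dsimp only
  rw [← aeval_realHermite, ← MvPolynomial.coe_aeval_eq_eval]
  change MvPolynomial.aeval (fun g => I g ω) (Polynomial.aeval (MvPolynomial.X (b p)) _) = _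
  rw [← Polynomial.aeval_algHom_apply, MvPolynomial.aeval_X]

variable {Ω : Type*} [MeasurableSpace Ω] {P : Measure Ω} [IsProbabilityMeasure P]
  {Z : Type*} [NormedAddCommGroup Z] [InnerProductSpace ℝ Z] [CompleteSpace Z] {T : ℝ}
  {Q : Z →L[ℝ] Z} {W : Set.Icc (0 : ℝ) T → Ω → Z}
  {ι : Type*} {e : ι → Z} {lam : ι → ℝ} {g : ℕ → Lp ℝ 2 (timeMeasure T)}
  {b : {i : ι // 0 < lam i} × ℕ → Lp (StrongDual ℝ (CMSpace Q)) 2 (timeMeasure T)}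
  (hI : IsIsonormal (wienerIntegral Q W P))
  (hb : ∀ p, xi W P e lam g p = wienerIntegral Q W P (b p))
  {H : Type*} [NormedAddCommGroup H] [InnerProductSpace ℝ H]
include hb hI

theorem wickTerm_eq_tensorLp (F : Lp H 2 P) (α : ({i : ι // 0 < lam i} × ℕ) →₀ ℕ) :
    wickTerm W P e lam g F α = tensorLp (chaosBasis (wienerIntegral Q W P) b α)
      (coefLp (chaosBasis (wienerIntegral Q W P) b α) F) := by
  have h1 : wick W P e lam g α = fun ω => (1 / √(α.prod fun _ n => (n ! : ℝ))) *
      polyEval (wienerIntegral Q W P) (hermiteProd b α) ω := by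
    ext ω
    rw [wick, polyEval_hermiteProd]
    simp_rw [hb]
  have h2 : MemLp (wick W P e lam g α) 2 P := by
    rw [h1]
    exact (hI.memLp_polyEval _).const_mul _
  have h3 : toL2 P (wick W P e lam g α) = chaosBasis (wienerIntegral Q W P) b α := by
    rw [h1]
    rfl
  rw [wickTerm, toL2_smul_const h2, h3]
  congr 1
  refine integral_congr_ae ?_
  filter_upwards [coeFn_toL2 h2] with ω hω
  rw [← h3, hω]

theorem chaosProj_eq_chaosPart (k : ℕ) (F : Lp H 2 P) :
    chaosProj W P e lam g k F = chaosPart (wienerIntegral Q W P) b k F :=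
  tsum_congr fun α => wickTerm_eq_tensorLp hI hb F α.1

end Wick

end StroockTaylor
-- The Stroock–Taylor formula
theorem mainTheorem7 {Ω : Type*} [MeasurableSpace Ω] (P : Measure Ω) [IsProbabilityMeasure P]
    {Z : Type*} [NormedAddCommGroup Z] [InnerProductSpace ℝ Z] [CompleteSpace Z]
    [TopologicalSpace.SeparableSpace Z] [MeasurableSpace Z] [BorelSpace Z]
    {H : Type*} [NormedAddCommGroup H] [InnerProductSpace ℝ H] [CompleteSpace H]
    [TopologicalSpace.SeparableSpace H]
    {T : ℝ} (hT : 0 < T)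
    (Q : Z →L[ℝ] Z) (hQ : Q.IsPositive) (hQn : IsNuclear Q)
    (W : Set.Icc (0 : ℝ) T → Ω → Z) (hW : IsQBrownianMotion Q W P)
    {ι : Type*} (e : HilbertBasis ι ℝ Z) (lam : ι → ℝ) (he : ∀ i, Q (e i) = lam i • e i)
    (g : HilbertBasis ℕ ℝ (Lp ℝ 2 (timeMeasure T)))
    (F : Lp H 2 P) (hF : F ∈ malliavinSpaceTop Q W P H) :
    (∀ k : ℕ,
      Summable (fun α : {α : ({i : ι // 0 < lam i} × ℕ) →₀ ℕ // α.degree = k} =>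
        wickTerm W P e lam g F α) ∧
      meanDeriv Q W P k F ∈ divergenceDomain Q W P H k ∧
      chaosProj W P e lam g k F = (1 / (k ! : ℝ)) • divergence Q W P k (meanDeriv Q W P k F)) ∧
    divergence Q W P 0 (meanDeriv Q W P 0 F) = Lp.const 2 P (∫ ω, F ω ∂P) ∧
    HasSum (fun k : ℕ => chaosProj W P e lam g k F) F ∧
    HasSum (fun k : ℕ => (1 / (k ! : ℝ)) • divergence Q W P k (meanDeriv Q W P k F)) F := by
  have hI := (hW.wienerIntegral_spec hQ hT.le e he).1
  have hIm := hW.aestronglyMeasurable_wienerIntegral hQ hT.le e he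
  have hWI : ∀ t z, ∃ h, wienerIntegral Q W P h =ᵐ[P] fun ω => ⟪W t ω, z⟫_ℝ := fun t z =>
    ⟨tensorLp (iicLp t) (rangeFunctional (posSqrt Q) z), by
      rw [(hW.wienerIntegral_spec hQ hT.le e he).2]
      exact coeFn_toL2 (hW.memLp_inner hQ t z)⟩
  let b : HilbertBasis ({i : ι // 0 < lam i} × ℕ) ℝ
      (Lp (StrongDual ℝ (CMSpace Q)) 2 (timeMeasure T)) :=
    HilbertBasis.mk (IsQBrownianMotion.orthonormal_noiseVector hQ e he g)
      (IsQBrownianMotion.topologicalClosure_span_noiseVector hQ e he g).symm.le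
  have hb : ∀ p, xi W P e lam g p = wienerIntegral Q W P (b p) := fun p => by
    rw [hW.xi_eq_wienerIntegral hQ hT.le e he, HilbertBasis.coe_mk]
  have hFk : ∀ k, F ∈ malliavinSpace Q W P H k := by
    have h1 : ∀ k, 1 ≤ k → F ∈ malliavinSpace Q W P H k := fun k hk =>
      (Submodule.mem_iInf _).mp ((Submodule.mem_iInf _).mp hF k) hk
    intro k
    rcases Nat.eq_zero_or_pos k with rfl | hk
    · exact malliavinSpace_le_zero 1 (h1 1 le_rfl)
    · exact h1 k hk
  have hdiv := fun k => divergence_meanDeriv hI hW.measurable hIm hWI b (hFk k)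
  have hproj : ∀ k, chaosProj W P e lam g k F = chaosPart (wienerIntegral Q W P) b k F := fun k =>
    chaosProj_eq_chaosPart hI hb k F
  have heq : ∀ k : ℕ, chaosProj W P e lam g k F
      = (1 / (k ! : ℝ)) • divergence Q W P k (meanDeriv Q W P k F) := fun k => by
    rw [hproj, hdiv, smul_smul, one_div_mul_cancel (by positivity), one_smul]
  have hsum : HasSum (fun k : ℕ => chaosProj W P e lam g k F) F := by
    simp_rw [hproj]
    exact hasSum_chaosPart hI hW.measurable hIm hWI b
      (aestronglyMeasurable_of_mem_malliavinSpace hI hW.measurable hIm (hFk 0))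
  refine ⟨fun k => ⟨?_, meanDeriv_mem_divergenceDomain hI b (hFk k), heq k⟩, ?_, hsum, ?_⟩
  · simp_rw [wickTerm_eq_tensorLp hI hb]
    exact summable_tensorLp_coefLp ((hI.orthonormal_chaosBasis b.orthonormal).comp
      (fun α : {α : ({i : ι // 0 < lam i} × ℕ) →₀ ℕ // α.degree = k} => α.1)
      Subtype.val_injective) F
  · rw [hdiv, chaosPart_zero]
    simp
  · simp_rw [← heq]
    exact hsum
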